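/- For $(u,\eta)\in\mathbb R^2$ and $f\in L^2(\mathbb R)$ let $\pi(u,\eta)f(x)=e^{2\pi i\eta x}f(x-u)$. For $g\in L^2(\mathbb R)$ and $\Lambda\subset\mathbb R^2$ let $(g,\Lambda)=\{\pi(\lambda)g:\lambda\in\Lambda\}$ be the Gabor system and $\mathcal G(g,\Lambda)$ its closed linear span in $L^2(\mathbb R)$. A family $(\varphi_i)_{i\in I}$ is a Riesz basis of a Hilbert space $H$ if it is the image of the standard orthonormal basis of $\ell^2(I)$ under a bounded, boundedly invertible linear map $\ell^2(I)\to H$. The Zak transform of $f\in L^2(\mathbb R)$ is given on $[0,1]^2$ by $$Zf(x,\omega)=\sum_{k\in\mathbb Z}f(x+k)e^{-2\pi ik\omega}$$ (convergence in $L^2([0,1]^2)$), and is extended to $\mathbb R^2$ by $Zf(x+m,\omega+n)=e^{2\pi im\omega}Zf(x,\omega)$ for $m,n\in\mathbb Z$. For $F\in L^1_{\rm loc}(\mathbb R^2)$ and a square $S=[a,a+\delta]\times[b,b+\delta]$, $\delta>0$, let $F_S=\frac1{|S|}\int_SF$ and $M_S(F)=\frac1{|S|}\int_S|F-F_S|$.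 We write $F\in \mathrm{VMO}_{\rm loc}(\mathbb R^2)$ if $F\in L^1_{\rm loc}(\mathbb R^2)$ and, for every bounded open $U\subset\mathbb R^2$, $\sup\{M_S(F):S\subset U\}<\infty$ and $\lim_{\varepsilon\to0^+}\sup\{M_S(F):S\subset U,\ |S|<\varepsilon\}=0$, where $S$ ranges over such squares. **Proposition 4.1.** Let $g\in L^2(\mathbb R)$ and let $\Lambda=\tfrac1Q\mathbb Z\times P\mathbb Z$ with coprime positive integers $P,Q$, such that the Gabor system $(g,\Lambda)$ is a Riesz basis of its closed linear span $\mathcal G(g,\Lambda)$. If $\pi(u,\eta)g\in\mathcal G(g,\Lambda)$ for some $(u,\eta)\in\mathbb R^2\setminus\Lambda$, then $Zg\notin\mathrm{VMO}_{\rm loc}(\mathbb R^2)$. -/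

import Mathlib

open MeasureTheory Set Filter Topology
open scoped ENNReal

noncomputable section

/-- The pointwise time-frequency shift `x ↦ e^{2πiηx} f(x - u)` of a function in `L²` is in `L²`. -/
theorem memLp_timeFreqShift (u η : ℝ) (f : Lp ℂ 2 (volume : Measure ℝ)) :
    MemLp (fun x : ℝ => Complex.exp (2 * Real.pi * Complex.I * η * x) * f (x - u)) 2 volume := by
  have h1 : MemLp (fun x : ℝ => f (x - u)) 2 volume :=
    (Lp.memLp f).comp_measurePreserving (measurePreserving_sub_right volume u)
  refine h1.of_le ?_ (Eventually.of_forall fun x => ?_)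
  · exact (by fun_prop : Continuous fun x : ℝ =>
      Complex.exp (2 * Real.pi * Complex.I * η * x)).aestronglyMeasurable.mul h1.1
  · have : (2 * Real.pi * Complex.I * η * x : ℂ) = ((2 * Real.pi * η * x : ℝ) : ℂ) * Complex.I := by
      push_cast; ring
    rw [norm_mul, this, Complex.norm_exp_ofReal_mul_I, one_mul]

/-- The time-frequency shift `π(u, η)` on `L²(ℝ)`: `(π(u, η) f)(x) = e^{2πiηx} f(x - u)`. -/
def timeFreqShift (p : ℝ × ℝ) (f : Lp ℂ 2 (volume : Measure ℝ)) : Lp ℂ 2 (volume : Measure ℝ) :=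
  (memLp_timeFreqShift p.1 p.2 f).toLp

/-- `𝒢(g, Λ)`: the closed linear span in `L²(ℝ)` of the Gabor system `{π(λ) g : λ ∈ Λ}`. -/
def gaborSpace (g : Lp ℂ 2 (volume : Measure ℝ)) (Λ : Set (ℝ × ℝ)) :
    Submodule ℂ (Lp ℂ 2 (volume : Measure ℝ)) :=
  (Submodule.span ℂ ((fun p => timeFreqShift p g) '' Λ)).topologicalClosure

theorem timeFreqShift_mem_gaborSpace (g : Lp ℂ 2 (volume : Measure ℝ)) {Λ : Set (ℝ × ℝ)}
    {p : ℝ × ℝ} (hp : p ∈ Λ) : timeFreqShift p g ∈ gaborSpace g Λ :=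
  Submodule.le_topologicalClosure _ (Submodule.subset_span (mem_image_of_mem _ hp))

/-- The Gabor system `(g, Λ) = (π(λ) g)_{λ ∈ Λ}`, as a family in its closed linear span. -/
def gaborSystem (g : Lp ℂ 2 (volume : Measure ℝ)) (Λ : Set (ℝ × ℝ)) (p : Λ) : gaborSpace g Λ :=
  ⟨timeFreqShift p g, timeFreqShift_mem_gaborSpace g p.2⟩

/-- A family `φ` in a Hilbert space `H` is a Riesz basis of `H` if it is the image of the standard
orthonormal basis of `ℓ²(ι)` under a bounded, boundedly invertible linear map `ℓ²(ι) → H`. -/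
def IsRieszBasis {ι H : Type*} [NormedAddCommGroup H] [InnerProductSpace ℂ H] (φ : ι → H) : Prop :=
  open Classical in
  ∃ T : lp (fun _ : ι => ℂ) 2 ≃L[ℂ] H, ∀ i, T (lp.single 2 i (1 : ℂ)) = φ i

/-- The lattice `(1/Q)ℤ × Pℤ`. -/
def separableLattice (P Q : ℕ) : Set (ℝ × ℝ) :=
  {p | ∃ m n : ℤ, p = ((m : ℝ) / Q, (n : ℝ) * P)}

/-- The unit square `[0,1]²`. -/
def unitSquare : Set (ℝ × ℝ) := Icc 0 1 ×ˢ Icc 0 1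

theorem restrict_unitSquare : (volume : Measure (ℝ × ℝ)).restrict unitSquare =
    ((volume : Measure ℝ).restrict (Icc 0 1)).prod ((volume : Measure ℝ).restrict (Icc 0 1)) := by
  rw [Measure.prod_restrict]; rfl

/-- The character `ω ↦ e^{-2πikω}`. -/
def zakChar (k : ℤ) (ω : ℝ) : ℂ := Complex.exp (-(2 * Real.pi * Complex.I * k * ω))

theorem norm_zakChar (k : ℤ) (ω : ℝ) : ‖zakChar k ω‖ = 1 := by
  have : (-(2 * Real.pi * Complex.I * k * ω) : ℂ)
      = ((-(2 * Real.pi * k * ω) : ℝ) : ℂ) * Complex.I := by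
    push_cast; ring
  rw [zakChar, this, Complex.norm_exp_ofReal_mul_I]

theorem continuous_zakChar (k : ℤ) : Continuous (zakChar k) := by
  unfold zakChar; fun_prop

theorem memLp_zakTerm (f : Lp ℂ 2 (volume : Measure ℝ)) (k : ℤ) :
    MemLp (fun p : ℝ × ℝ => f (p.1 + k) * zakChar k p.2) 2 (volume.restrict unitSquare) := by
  have h1 : MemLp (fun x : ℝ => f (x + k)) 2 (volume.restrict (Icc (0 : ℝ) 1)) :=
    ((Lp.memLp f).comp_measurePreserving
      (measurePreserving_add_right volume (k : ℝ))).restrict _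
  rw [restrict_unitSquare]
  have h2 : MemLp (fun p : ℝ × ℝ => f (p.1 + k)) 2
      (((volume : Measure ℝ).restrict (Icc 0 1)).prod ((volume : Measure ℝ).restrict (Icc 0 1))) :=
    h1.comp_fst _
  refine h2.of_le ?_ (Eventually.of_forall fun p => ?_)
  · exact h2.1.mul ((continuous_zakChar k).comp continuous_snd).aestronglyMeasurable
  · rw [norm_mul, norm_zakChar, mul_one]

/-- The `k`-th term `f(x + k) e^{-2πikω}` of the Zak series, as an element of `L²([0,1]²)`. -/
def zakTerm (f : Lp ℂ 2 (volume : Measure ℝ)) (k : ℤ) :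
    Lp ℂ 2 ((volume : Measure (ℝ × ℝ)).restrict unitSquare) :=
  (memLp_zakTerm f k).toLp

theorem integral_zakChar {j k : ℤ} (h : j ≠ k) :
    ∫ ω in Icc (0 : ℝ) 1, zakChar k ω * (starRingEnd ℂ) (zakChar j ω) = 0 := by
  have h0 : (2 * Real.pi * Complex.I * ((j : ℂ) - k)) ≠ 0 := by
    have : (j : ℂ) - k ≠ 0 := sub_ne_zero.mpr (by exact_mod_cast h)
    simp [Real.pi_ne_zero, this]
  have h1 : ∀ ω : ℝ, zakChar k ω * (starRingEnd ℂ) (zakChar j ω)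
      = Complex.exp ((2 * Real.pi * Complex.I * ((j : ℂ) - k)) * ω) := by
    intro ω
    rw [zakChar, zakChar, ← Complex.exp_conj, ← Complex.exp_add]
    congr 1
    simp only [map_neg, map_mul, Complex.conj_ofReal, Complex.conj_I, map_intCast, map_ofNat]
    ring
  rw [integral_Icc_eq_integral_Ioc, ← intervalIntegral.integral_of_le zero_le_one]
  simp_rw [h1]
  rw [integral_exp_mul_complex h0]
  have h2 : Complex.exp ((2 * Real.pi * Complex.I * ((j : ℂ) - k)) * (1 : ℝ)) = 1 := by
    rw [Complex.exp_eq_one_iff]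
    exact ⟨j - k, by push_cast; ring⟩
  rw [h2]
  simp

theorem inner_zakTerm (f : Lp ℂ 2 (volume : Measure ℝ)) {j k : ℤ} (h : j ≠ k) :
    inner ℂ (zakTerm f j) (zakTerm f k) = 0 := by
  rw [L2.inner_def]
  have h1 : ∀ᵐ p ∂((volume : Measure (ℝ × ℝ)).restrict unitSquare),
      inner ℂ (zakTerm f j p) (zakTerm f k p)
        = (f (p.1 + k) * (starRingEnd ℂ) (f (p.1 + j))) *
          (zakChar k p.2 * (starRingEnd ℂ) (zakChar j p.2)) := by
    filter_upwards [(memLp_zakTerm f j).coeFn_toLp, (memLp_zakTerm f k).coeFn_toLp] with p hj hk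
    rw [zakTerm, zakTerm, hj, hk, RCLike.inner_apply, map_mul]
    ring
  rw [integral_congr_ae h1, restrict_unitSquare,
    integral_prod_mul (fun x : ℝ => f (x + k) * (starRingEnd ℂ) (f (x + j)))
      (fun ω : ℝ => zakChar k ω * (starRingEnd ℂ) (zakChar j ω)), integral_zakChar h, mul_zero]

theorem norm_sq_zakTerm (f : Lp ℂ 2 (volume : Measure ℝ)) (k : ℤ) :
    ‖zakTerm f k‖ ^ 2 = ∫ x in (0 : ℝ)..1, ‖f (x + k)‖ ^ 2 := by
  have h0 := L2.inner_def (𝕜 := ℂ) (zakTerm f k) (zakTerm f k)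
  have h1 : ∀ᵐ p ∂((volume : Measure (ℝ × ℝ)).restrict unitSquare),
      inner ℂ (zakTerm f k p) (zakTerm f k p) = ((‖f (p.1 + k)‖ ^ 2 : ℝ) : ℂ) * 1 := by
    filter_upwards [(memLp_zakTerm f k).coeFn_toLp] with p hk
    rw [zakTerm, hk, inner_self_eq_norm_sq_to_K, norm_mul, norm_zakChar]
    simp
  have h2 : ∫ p in unitSquare, ((‖f (p.1 + k)‖ ^ 2 : ℝ) : ℂ) * 1
      = (∫ x in Icc (0 : ℝ) 1, ((‖f (x + k)‖ ^ 2 : ℝ) : ℂ)) * ∫ _ in Icc (0 : ℝ) 1, (1 : ℂ) := by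
    rw [restrict_unitSquare]
    exact integral_prod_mul (fun x : ℝ => ((‖f (x + k)‖ ^ 2 : ℝ) : ℂ)) (fun _ : ℝ => (1 : ℂ))
  rw [integral_congr_ae h1, h2, inner_self_eq_norm_sq_to_K, integral_complex_ofReal, integral_Icc_eq_integral_Ioc,
    ← intervalIntegral.integral_of_le zero_le_one] at h0
  simp only [integral_const, measureReal_restrict_apply_univ, Real.volume_real_Icc] at h0
  simp only [sub_zero, zero_le_one, sup_of_le_left, one_smul, mul_one] at h0
  exact Complex.ofReal_injective (by push_cast; exact h0)

/-- The Zak series of every `f ∈ L²(ℝ)` converges unconditionally in `L²([0,1]²)`. -/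
theorem summable_zakTerm (f : Lp ℂ 2 (volume : Measure ℝ)) : Summable (zakTerm f) := by
  have hV : OrthogonalFamily ℂ (fun k => Submodule.span ℂ {zakTerm f k})
      fun k => (Submodule.span ℂ {zakTerm f k}).subtypeₗᵢ := by
    apply OrthogonalFamily.of_pairwise
    intro j k hjk
    rw [Function.onFun, Submodule.isOrtho_span]
    rintro _ rfl _ rfl
    exact inner_zakTerm f hjk
  have h := hV.summable_iff_norm_sq_summable
    (fun k => ⟨zakTerm f k, Submodule.mem_span_singleton_self _⟩)
  refine h.2 ?_
  have hint : Integrable (fun x : ℝ => ‖f x‖ ^ 2) volume :=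
    (memLp_two_iff_integrable_sq_norm (Lp.memLp f).1).1 (Lp.memLp f)
  refine hint.hasSum_intervalIntegral_comp_add_int.summable.congr fun k => ?_
  exact (norm_sq_zakTerm f k).symm

/-- The restriction of the Zak transform `Zf` to `[0,1]²`: the sum in `L²([0,1]²)` of the series
`∑_{k ∈ ℤ} f(x + k) e^{-2πikω}`. -/
def zakSquare (f : Lp ℂ 2 (volume : Measure ℝ)) :
    Lp ℂ 2 ((volume : Measure (ℝ × ℝ)).restrict unitSquare) :=
  ∑' k : ℤ, zakTerm f k

/-- The Zak transform `Zf` on `ℝ²`: the extension of `Zf|_{[0,1]²}` by the quasi-periodicity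
`Zf(x + m, ω + n) = e^{2πimω} Zf(x, ω)` for `m, n ∈ ℤ`. -/
def zak (f : Lp ℂ 2 (volume : Measure ℝ)) (p : ℝ × ℝ) : ℂ :=
  Complex.exp (2 * Real.pi * Complex.I * ⌊p.1⌋ * p.2) * zakSquare f (Int.fract p.1, Int.fract p.2)

/-- The closed square `[a₁, a₁ + δ] × [a₂, a₂ + δ]` (a cube in `ℝ²` when `0 < δ`). -/
def square (a : ℝ × ℝ) (δ : ℝ) : Set (ℝ × ℝ) := Icc a.1 (a.1 + δ) ×ˢ Icc a.2 (a.2 + δ)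

/-- The mean oscillation `M_Δ(F)`, the average over `Δ` of `|F - F_Δ|`, where `F_Δ` is the average
of `F` over `Δ`. -/
def meanOsc (F : ℝ × ℝ → ℂ) (Δ : Set (ℝ × ℝ)) : ℝ :=
  ⨍ p in Δ, ‖F p - ⨍ q in Δ, F q‖

/-- `S_{ε,U}(F)`: the supremum of the mean oscillations of `F` over the squares in `U` of area
less than `ε`, with values in `[0, ∞]`. -/
def oscSup (F : ℝ × ℝ → ℂ) (U : Set (ℝ × ℝ)) (ε : ℝ) : ℝ≥0∞ :=
  ⨆ (a : ℝ × ℝ) (δ : ℝ) (_ : 0 < δ) (_ : square a δ ⊆ U) (_ : δ ^ 2 < ε),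
    ENNReal.ofReal (meanOsc F (square a δ))

/-- `F ∈ BMO(U)`: `F` is locally integrable on `ℝ²` and its mean oscillations over the squares
contained in `U` are bounded. -/
def MemBMO (F : ℝ × ℝ → ℂ) (U : Set (ℝ × ℝ)) : Prop :=
  LocallyIntegrable F volume ∧ ∃ C : ℝ, ∀ a δ, 0 < δ → square a δ ⊆ U → meanOsc F (square a δ) ≤ C

/-- `F ∈ VMO(U)`: `F ∈ BMO(U)` and `S_{ε,U}(F) → 0` as `ε → 0`. -/
def MemVMO (F : ℝ × ℝ → ℂ) (U : Set (ℝ × ℝ)) : Prop :=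
  MemBMO F U ∧ Tendsto (oscSup F U) (𝓝[>] 0) (𝓝 0)

/-- `F ∈ VMO_loc(ℝ²)`: `F ∈ VMO(U)` for every bounded open `U ⊆ ℝ²`. -/
def MemVMOLoc (F : ℝ × ℝ → ℂ) : Prop :=
  ∀ U : Set (ℝ × ℝ), IsOpen U → Bornology.IsBounded U → MemVMO F U

end

/-! Write F = Zg and let π(μ) also denote `zakShift μ`, the time-frequency shift on the Zak side. To
a function F attach the P × Q matrix with entries F(x + k/P - l/Q, ω). Its columns describe the
Gabor space pointwise: if π(μ)g lies in 𝒢(g, Λ), then almost everywhere the Zak matrix of π(μ)F is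
that of F times a Q × Q matrix (`shiftInRange_of_mem_gaborSpace`). The Riesz property bounds the
entries of the Zak matrix and keeps its Gram determinant away from 0 (`ae_zakBounded`). The shifts μ
with this range property form a monoid Γ containing Λ.

Suppose first that F is continuous. For μ in Γ the determinant d_μ = det(Z_F^* Z_{π(μ)F}) has no
zeros (`norm_sq_det_cross`) and has periods (1/(PQ), 0) and (0, 1), so it has a winding number along
each. By `det_cross_identity`, d_μ is multiplicative in μ up to translations, a constant and the
normalisation by d_0; hence the two winding numbers, minus those of d_0, form a homomorphism w from
Γ to ℤ² (`exists_windingHom`). On Λ it is explicit: w(m/Q, nP) = (n, -m). By continuity w vanishes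
on small elements of Γ. Given μ in Γ, add a lattice element to reach ν with w(ν) = 0. Arbitrarily
large multiples Nν come close to lattice points q; since Nν - q is small, w(q) = 0, so q = 0 and Nν
itself is small. Hence ν = 0 and μ lies in Λ (`mem_separableLattice_of_crossDet`).

For F in VMO, replace F by the continuous average H of π(-σ)F over small σ. Vanishing oscillation
makes H close to π(-σ)F, for a common σ, at the finitely many points entering the determinants at a
given z. The determinant identity then holds for H with an error smaller than its terms
(`exists_continuous_crossDet_lt`), which is enough to compare winding numbers. -/

/-! ### Winding numbers of nonvanishing functions on the plane -/

/-- `φ` has a continuous logarithm which increases by `2πik` under translation by `p`. -/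
def HasWinding (φ : ℝ × ℝ → ℂ) (p : ℝ × ℝ) (k : ℤ) : Prop :=
  ∃ L : ℝ × ℝ → ℂ, Continuous L ∧ (∀ z, Complex.exp (L z) = φ z) ∧
    ∀ z, L (z + p) = L z + 2 * Real.pi * Complex.I * k

/-- The difference of two logarithms, divided by 2πi, is continuous and integer-valued on a
connected space. This makes winding numbers well defined. -/
theorem exists_int_of_exp_eq {L M : ℝ × ℝ → ℂ} (hL : Continuous L) (hM : Continuous M)
    (h : ∀ z, Complex.exp (L z) = Complex.exp (M z)) :
    ∃ k : ℤ, ∀ z, L z = M z + 2 * Real.pi * Complex.I * k := by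
  choose n hn using fun z => Complex.exp_eq_exp_iff_exists_int.1 (h z)
  have hpi : (2 * Real.pi * Complex.I : ℂ) ≠ 0 := Complex.two_pi_I_ne_zero
  have hcont : Continuous fun z => ((n z : ℤ) : ℂ) := by
    have : (fun z => ((n z : ℤ) : ℂ)) = fun z => (L z - M z) / (2 * Real.pi * Complex.I) := by
      funext z
      rw [hn z]; field_simp; ring
    rw [this]
    fun_prop
  have hcont' : Continuous n := by
    have h1 : Continuous fun z => ((n z : ℤ) : ℝ) := by
      have := Complex.continuous_re.comp hcont
      simpa [Function.comp_def] using this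
    exact Int.isClosedEmbedding_coe_real.isEmbedding.continuous_iff.2 h1
  refine ⟨n 0, fun z => ?_⟩
  rw [hn z, PreconnectedSpace.constant inferInstance hcont' (x := z) (y := 0)]
  ring

/-- The exponential covers the punctured plane and ℝ² is simply connected, so `φ` lifts to a
logarithm. -/
theorem exists_hasWinding {φ : ℝ × ℝ → ℂ} (hφ : Continuous φ) (h0 : ∀ z, φ z ≠ 0) {p : ℝ × ℝ}
    (hp : ∀ z, φ (z + p) = φ z) : ∃ k, HasWinding φ p k := by
  obtain ⟨L, ⟨-, hL⟩, -⟩ := Complex.isCoveringMapOn_exp.existsUnique_continuousMap_lifts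
    (f := ⟨φ, hφ⟩) (a₀ := 0) (e₀ := Complex.log (φ 0)) (Complex.exp_log (h0 0)) (fun z => h0 z)
  have hL' : ∀ z, Complex.exp (L z) = φ z := fun z => congrFun hL z
  obtain ⟨k, hk⟩ := exists_int_of_exp_eq (L := fun z => L (z + p)) (M := L) (by fun_prop)
    (by fun_prop) (fun z => by rw [hL', hL', hp])
  exact ⟨k, L, L.continuous, hL', hk⟩

namespace HasWinding

variable {φ ψ : ℝ × ℝ → ℂ} {p : ℝ × ℝ} {j k : ℤ}

theorem unique (h : HasWinding φ p j) (h' : HasWinding φ p k) : j = k := by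
  obtain ⟨L, hL, hL1, hL2⟩ := h
  obtain ⟨M, hM, hM1, hM2⟩ := h'
  obtain ⟨n, hn⟩ := exists_int_of_exp_eq hL hM (fun z => by rw [hL1, hM1])
  have h1 := hL2 0
  rw [hn, hn, hM2] at h1
  have h2 : (2 * Real.pi * Complex.I : ℂ) * j = 2 * Real.pi * Complex.I * k := by
    linear_combination -h1
  exact_mod_cast mul_left_cancel₀ Complex.two_pi_I_ne_zero h2

theorem mul (h : HasWinding φ p j) (h' : HasWinding ψ p k) :
    HasWinding (fun z => φ z * ψ z) p (j + k) := by
  obtain ⟨L, hL, hL1, hL2⟩ := h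
  obtain ⟨M, hM, hM1, hM2⟩ := h'
  refine ⟨fun z => L z + M z, hL.add hM, fun z => by rw [Complex.exp_add, hL1, hM1], fun z => ?_⟩
  simp only [hL2, hM2]
  push_cast
  ring

theorem comp_sub (h : HasWinding φ p j) (a : ℝ × ℝ) : HasWinding (fun z => φ (z - a)) p j := by
  obtain ⟨L, hL, hL1, hL2⟩ := h
  refine ⟨fun z => L (z - a), by fun_prop, fun z => hL1 _, fun z => ?_⟩
  simp only
  rw [← hL2, sub_add_eq_add_sub]

theorem const {c : ℂ} (hc : c ≠ 0) (p : ℝ × ℝ) : HasWinding (fun _ => c) p 0 :=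
  ⟨fun _ => Complex.log c, continuous_const, fun _ => Complex.exp_log hc, fun _ => by simp⟩

/-- Rouché's argument: the quotient ψ/φ stays in the disc of radius 1 about 1, where the principal
logarithm is continuous, and its logarithm is `p`-periodic, so it contributes no winding. -/
theorem perturb (h : HasWinding φ p j) (hφ : ∀ z, φ (z + p) = φ z) (hψc : Continuous ψ)
    (hψ : ∀ z, ψ (z + p) = ψ z) (hlt : ∀ z, ‖ψ z - φ z‖ < ‖φ z‖) : HasWinding ψ p j := by
  obtain ⟨L, hL, hL1, hL2⟩ := h
  have h0 : ∀ z, φ z ≠ 0 := fun z => by rw [← hL1]; exact Complex.exp_ne_zero _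
  have hφc : Continuous φ := by
    have : φ = fun z => Complex.exp (L z) := funext fun z => (hL1 z).symm
    rw [this]; fun_prop
  have hs : ∀ z, ψ z / φ z ∈ Complex.slitPlane := fun z => by
    have h1 : ‖ψ z / φ z - 1‖ < 1 := by
      rw [div_sub_one (h0 z), norm_div, div_lt_one (norm_pos_iff.2 (h0 z))]
      exact hlt z
    have := Complex.mem_slitPlane_of_norm_lt_one h1
    simpa using this
  refine ⟨fun z => L z + Complex.log (ψ z / φ z), ?_, fun z => ?_, fun z => ?_⟩
  · exact hL.add ((hψc.div hφc h0).clog hs)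
  · rw [Complex.exp_add, Complex.exp_log (Complex.slitPlane_ne_zero (hs z)), hL1,
      mul_div_cancel₀ _ (h0 z)]
  · simp only [hL2, hφ, hψ]
    ring

theorem of_exp {ℓ : ℝ × ℝ → ℂ} (hℓ : Continuous ℓ)
    (h : ∀ z, ℓ (z + p) = ℓ z + 2 * Real.pi * Complex.I * k) :
    HasWinding (fun z => Complex.exp (ℓ z)) p k :=
  ⟨ℓ, hℓ, fun _ => rfl, h⟩

end HasWinding

/-! ### Characters and time-frequency shifts of quasi-periodic functions -/

/-- The character `t ↦ e^{2πit}`. -/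
noncomputable def unitExp (t : ℝ) : ℂ := Complex.exp (2 * Real.pi * Complex.I * t)

theorem unitExp_add (s t : ℝ) : unitExp (s + t) = unitExp s * unitExp t := by
  rw [unitExp, unitExp, unitExp, ← Complex.exp_add]
  congr 1
  push_cast
  ring

theorem norm_unitExp (t : ℝ) : ‖unitExp t‖ = 1 := by
  have : (2 * Real.pi * Complex.I * t : ℂ) = ((2 * Real.pi * t : ℝ) : ℂ) * Complex.I := by
    push_cast; ring
  rw [unitExp, this, Complex.norm_exp_ofReal_mul_I]

theorem unitExp_ne_zero (t : ℝ) : unitExp t ≠ 0 := Complex.exp_ne_zero _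

theorem unitExp_int (n : ℤ) : unitExp n = 1 := by
  rw [unitExp, Complex.exp_eq_one_iff]
  exact ⟨n, by push_cast; ring⟩

theorem unitExp_zero : unitExp 0 = 1 := by simpa using unitExp_int 0

theorem unitExp_add_int (t : ℝ) (n : ℤ) : unitExp (t + n) = unitExp t := by
  rw [unitExp_add, unitExp_int, mul_one]

theorem unitExp_neg_mul (t : ℝ) : unitExp (-t) * unitExp t = 1 := by
  rw [← unitExp_add, neg_add_cancel, unitExp_zero]

theorem conj_unitExp (t : ℝ) : (starRingEnd ℂ) (unitExp t) = unitExp (-t) := by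
  rw [unitExp, unitExp, ← Complex.exp_conj]
  congr 1
  simp only [map_mul, Complex.conj_ofReal, Complex.conj_I, map_ofNat]
  push_cast
  ring

@[fun_prop]
theorem continuous_unitExp : Continuous unitExp := by unfold unitExp; fun_prop

/-- The time-frequency shift `F ↦ e^{2πi μ₂ x} F(x - μ₁, ω - μ₂)` on the Zak transform side. -/
noncomputable def zakShift (μ : ℝ × ℝ) (F : ℝ × ℝ → ℂ) (z : ℝ × ℝ) : ℂ :=
  unitExp (μ.2 * z.1) * F (z - μ)

/-- Quasi-periodicity of functions on `ℝ²`. -/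
def QuasiPeriodic (F : ℝ × ℝ → ℂ) : Prop :=
  ∀ (z : ℝ × ℝ) (m n : ℤ), F (z + ((m : ℝ), (n : ℝ))) = unitExp (m * z.2) * F z

/-- Shifts form a projective representation. The cocycle is a unimodular constant, so it affects
neither ranges nor winding numbers. -/
theorem zakShift_zakShift (μ ν : ℝ × ℝ) (F : ℝ × ℝ → ℂ) (z : ℝ × ℝ) :
    zakShift μ (zakShift ν F) z = unitExp (-(ν.2 * μ.1)) * zakShift (μ + ν) F z := by
  simp only [zakShift, ← mul_assoc, ← unitExp_add, sub_sub, Prod.snd_add,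
    Prod.fst_sub]
  congr 2
  ring

theorem QuasiPeriodic.zakShift {F : ℝ × ℝ → ℂ} (hF : QuasiPeriodic F) (μ : ℝ × ℝ) :
    QuasiPeriodic (zakShift μ F) := by
  intro z m n
  have h : z + ((m : ℝ), (n : ℝ)) - μ = (z - μ) + ((m : ℝ), (n : ℝ)) := by abel
  simp only [_root_.zakShift, h, hF (z - μ) m n, ← mul_assoc, ← unitExp_add]
  congr 2
  simp only [Prod.fst_add, Prod.snd_sub]
  ring

theorem norm_zakShift (μ : ℝ × ℝ) (F : ℝ × ℝ → ℂ) (z : ℝ × ℝ) :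
    ‖zakShift μ F z‖ = ‖F (z - μ)‖ := by
  rw [zakShift, norm_mul, norm_unitExp, one_mul]

/-! ### Zak matrices, periodicity of cross determinants, and their values on the lattice -/

section ZakMatrix

variable {P Q : ℕ}

/-- The point `z + (k/P - l/Q, 0)`. -/
noncomputable def gridPoint (P Q : ℕ) (z : ℝ × ℝ) (k l : ℕ) : ℝ × ℝ :=
  z + ((k : ℝ) / P - (l : ℝ) / Q, 0)

/-- The Zak matrix `(F(x + k/P - l/Q, ω))_{k, l}`. -/
noncomputable def zakMatrix (P Q : ℕ) (F : ℝ × ℝ → ℂ) (z : ℝ × ℝ) : Matrix (Fin P) (Fin Q) ℂ :=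
  Matrix.of fun k l => F (gridPoint P Q z k l)

/-- The determinant of the cross Gram matrix of two Zak matrices. -/
noncomputable def crossDet (P Q : ℕ) (F H : ℝ × ℝ → ℂ) (z : ℝ × ℝ) : ℂ :=
  ((zakMatrix P Q F z).conjTranspose * zakMatrix P Q H z).det

theorem crossGram_apply (F H : ℝ × ℝ → ℂ) (z : ℝ × ℝ) (l l' : Fin Q) :
    ((zakMatrix P Q F z).conjTranspose * zakMatrix P Q H z) l l' =
      ∑ k ∈ Finset.range P, (starRingEnd ℂ) (F (gridPoint P Q z k l)) *
        H (gridPoint P Q z k l') := by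
  rw [Matrix.mul_apply, ← Fin.sum_univ_eq_sum_range
    (fun k => (starRingEnd ℂ) (F (gridPoint P Q z k l)) * H (gridPoint P Q z k l'))]
  rfl

theorem det_conj_mul_submatrix (M : Matrix (Fin Q) (Fin Q) ℂ) (σ : Equiv.Perm (Fin Q))
    {c : Fin Q → ℂ} (hc : ∀ i, ‖c i‖ = 1) :
    (Matrix.of fun i j => (starRingEnd ℂ) (c i) * (c j * M (σ i) (σ j))).det = M.det := by
  have h1 := Matrix.det_mul_column (fun i => (starRingEnd ℂ) (c i))
    (Matrix.of fun i j => c j * (M.submatrix σ σ) i j)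
  have h2 := Matrix.det_mul_row c (M.submatrix σ σ)
  rw [h2, Matrix.det_submatrix_equiv_self, ← mul_assoc, ← Finset.prod_mul_distrib] at h1
  have h3 : ∏ i, (starRingEnd ℂ) (c i) * c i = 1 := by
    refine Finset.prod_eq_one fun i _ => ?_
    rw [mul_comm, Complex.mul_conj, Complex.normSq_eq_norm_sq, hc]
    simp
  rw [h3, one_mul] at h1
  exact h1

/-- Translation by 1/Q moves each column to the next one; only the last wraps around, and there
quasi-periodicity produces the phase. -/
theorem QuasiPeriodic.gridPoint_sub_inv {F : ℝ × ℝ → ℂ} (hF : QuasiPeriodic F) (hQ : 0 < Q)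
    (z : ℝ × ℝ) (k : ℕ) (l : Fin Q) :
    F (gridPoint P Q (z - (1 / (Q : ℝ), 0)) k l) =
      (if (l : ℕ) + 1 = Q then unitExp (-z.2) else 1) *
        F (gridPoint P Q z k (finRotate Q l : Fin Q)) := by
  obtain ⟨n, rfl⟩ : ∃ n, Q = n + 1 := ⟨Q - 1, by omega⟩
  have hn : ((n : ℝ) + 1) ≠ 0 := by positivity
  by_cases hl : (l : ℕ) + 1 = n + 1
  · have hl' : l = Fin.last n := Fin.ext (by simpa using hl)
    subst hl'
    rw [if_pos hl, finRotate_last]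
    have h1 : gridPoint P (n + 1) (z - (1 / ((n + 1 : ℕ) : ℝ), 0)) k (Fin.last n : Fin (n + 1)) =
        gridPoint P (n + 1) z k ((0 : Fin (n + 1)) : ℕ) + (((-1 : ℤ) : ℝ), ((0 : ℤ) : ℝ)) := by
      ext
      · simp [gridPoint]; field_simp; ring
      · simp [gridPoint]
    rw [h1, hF]
    congr 2
    simp [gridPoint]
  · have hl' : l ≠ Fin.last n := fun h => hl (by simp [h])
    rw [if_neg hl, one_mul, coe_finRotate_of_ne_last hl']
    congr 1
    ext
    · simp [gridPoint]; field_simp; ring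
    · simp [gridPoint]

theorem crossDet_sub_inv_right {F H : ℝ × ℝ → ℂ} (hF : QuasiPeriodic F) (hH : QuasiPeriodic H)
    (hQ : 0 < Q) (z : ℝ × ℝ) :
    crossDet P Q F H (z - (1 / (Q : ℝ), 0)) = crossDet P Q F H z := by
  refine Eq.trans ?_ (det_conj_mul_submatrix _ (finRotate Q)
    (c := fun l => if (l : ℕ) + 1 = Q then unitExp (-z.2) else 1)
    (fun l => by split_ifs <;> simp [norm_unitExp]))
  rw [crossDet]
  congr 1
  ext l l'
  simp only [Matrix.of_apply, crossGram_apply, hF.gridPoint_sub_inv hQ, hH.gridPoint_sub_inv hQ,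
    map_mul, Finset.mul_sum]
  refine Finset.sum_congr rfl fun k _ => by ring

/-- Translation by 1/P moves the row index by one. The row that wraps around acquires the same phase
in both factors, one of them conjugated, so the sum over rows is unchanged. -/
theorem crossDet_add_inv_left {F H : ℝ × ℝ → ℂ} (hF : QuasiPeriodic F) (hH : QuasiPeriodic H)
    (hP : 0 < P) (z : ℝ × ℝ) :
    crossDet P Q F H (z + (1 / (P : ℝ), 0)) = crossDet P Q F H z := by
  rw [crossDet, crossDet]
  congr 1
  ext l l'
  rw [crossGram_apply, crossGram_apply]
  set G : ℕ → ℂ := fun k => (starRingEnd ℂ) (F (gridPoint P Q z k l)) * H (gridPoint P Q z k l')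
  have h1 : ∀ (k l : ℕ), gridPoint P Q (z + (1 / (P : ℝ), 0)) k l = gridPoint P Q z (k + 1) l := by
    intro k l
    ext
    · simp [gridPoint]; ring
    · simp [gridPoint]
  have h2 : G P = G 0 := by
    have h3 : ∀ l : ℕ, gridPoint P Q z P l =
        gridPoint P Q z 0 l + (((1 : ℤ) : ℝ), ((0 : ℤ) : ℝ)) := by
      intro l
      have : (P : ℝ) ≠ 0 := by positivity
      ext
      · simp [gridPoint, this]; ring
      · simp [gridPoint]
    simp only [G, h3, hF _ 1 0, hH _ 1 0, map_mul, conj_unitExp]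
    have : ∀ l : ℕ, (gridPoint P Q z 0 l).2 = z.2 := by simp [gridPoint]
    rw [this, this]
    linear_combination (starRingEnd ℂ) (F (gridPoint P Q z 0 l)) * H (gridPoint P Q z 0 l') *
      unitExp_neg_mul ((1 : ℤ) * z.2)
  simp only [h1]
  have h3 := Finset.sum_range_succ G P
  rw [Finset.sum_range_succ', h2] at h3
  exact add_right_cancel h3

theorem crossDet_add_snd {F H : ℝ × ℝ → ℂ} (hF : QuasiPeriodic F) (hH : QuasiPeriodic H)
    (z : ℝ × ℝ) : crossDet P Q F H (z + (0, 1)) = crossDet P Q F H z := by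
  have h1 : ∀ k l, gridPoint P Q (z + (0, 1)) k l =
      gridPoint P Q z k l + (((0 : ℤ) : ℝ), ((1 : ℤ) : ℝ)) := by
    intro k l
    ext <;> simp [gridPoint]
  have h2 : ∀ {F}, QuasiPeriodic F → zakMatrix P Q F (z + (0, 1)) = zakMatrix P Q F z := by
    intro F hF
    ext k l
    simp only [zakMatrix, Matrix.of_apply, h1, hF _ 0 1]
    simp [unitExp_zero]
  rw [crossDet, crossDet, h2 hF, h2 hH]

/-- Bézout combines the periods 1/P and 1/Q into 1/(PQ). This is the role of coprimality: along this
short period the character of frequency PQ winds exactly once, so w maps Λ onto all of ℤ². -/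
theorem crossDet_add_fst {F H : ℝ × ℝ → ℂ} (hF : QuasiPeriodic F) (hH : QuasiPeriodic H)
    (hP : 0 < P) (hQ : 0 < Q) (hPQ : Nat.Coprime P Q) (z : ℝ × ℝ) :
    crossDet P Q F H (z + (1 / ((P : ℝ) * Q), 0)) = crossDet P Q F H z := by
  have h1 : Function.Periodic (crossDet P Q F H) (1 / (P : ℝ), 0) := crossDet_add_inv_left hF hH hP
  have h2 : Function.Periodic (crossDet P Q F H) (1 / (Q : ℝ), 0) := fun z => by
    rw [← crossDet_sub_inv_right (P := P) hF hH hQ (z + (1 / (Q : ℝ), 0)), add_sub_cancel_right]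
  have h3 := Nat.gcd_eq_gcd_ab P Q
  rw [hPQ.gcd_eq_one] at h3
  have h4 := (h1.zsmul (Nat.gcdB P Q)).add_period (h2.zsmul (Nat.gcdA P Q)) z
  rw [← h4]
  congr 2
  have hP' : (P : ℝ) ≠ 0 := by positivity
  have hQ' : (Q : ℝ) ≠ 0 := by positivity
  have h5 : (1 : ℝ) = P * Nat.gcdA P Q + Q * Nat.gcdB P Q := by exact_mod_cast h3
  ext
  · simp
    field_simp
    linarith
  · simp

/-- The phase at a grid point splits into a row factor and a column factor, so a shift moves the
base point and multiplies by unitary diagonal matrices on both sides. Range inclusions survive this.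
-/
theorem zakMatrix_zakShift (μ : ℝ × ℝ) (F : ℝ × ℝ → ℂ) (z : ℝ × ℝ) :
    zakMatrix P Q (zakShift μ F) z =
      Matrix.diagonal (fun k : Fin P => unitExp (μ.2 * (z.1 + (k : ℕ) / P))) *
        zakMatrix P Q F (z - μ) *
        Matrix.diagonal (fun l : Fin Q => unitExp (-(μ.2 * ((l : ℕ) / Q)))) := by
  ext k l
  rw [Matrix.mul_diagonal, Matrix.diagonal_mul]
  simp only [zakMatrix, Matrix.of_apply, zakShift]
  rw [mul_right_comm, ← unitExp_add]
  have : gridPoint P Q z k l - μ = gridPoint P Q (z - μ) k l := by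
    simp only [gridPoint]; abel
  rw [this]
  congr 2
  simp [gridPoint]
  ring

theorem zakMatrix_const_mul (c : ℂ) (F : ℝ × ℝ → ℂ) (z : ℝ × ℝ) :
    zakMatrix P Q (fun w => c * F w) z = c • zakMatrix P Q F z := by
  ext k l
  simp [zakMatrix]

theorem crossDet_zakShift_zakShift (μ : ℝ × ℝ) (F H : ℝ × ℝ → ℂ) (z : ℝ × ℝ) :
    crossDet P Q (zakShift μ F) (zakShift μ H) z = crossDet P Q F H (z - μ) := by
  refine Eq.trans ?_ (det_conj_mul_submatrix _ (Equiv.refl _)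
    (c := fun l : Fin Q => unitExp (-(μ.2 * ((l : ℕ) / Q)))) (fun l => norm_unitExp _))
  rw [crossDet]
  congr 1
  ext l l'
  have hk : ∀ k l : ℕ, zakShift μ F (gridPoint P Q z k l) = unitExp (μ.2 * (z.1 + k / P)) *
      (unitExp (-(μ.2 * (l / Q))) * F (gridPoint P Q (z - μ) k l)) := by
    intro k l
    rw [zakShift, ← mul_assoc, ← unitExp_add]
    have : gridPoint P Q z k l - μ = gridPoint P Q (z - μ) k l := by
      simp only [gridPoint]; abel
    rw [this]
    congr 2
    simp [gridPoint]
    ring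
  have hk' : ∀ k l : ℕ, zakShift μ H (gridPoint P Q z k l) = unitExp (μ.2 * (z.1 + k / P)) *
      (unitExp (-(μ.2 * (l / Q))) * H (gridPoint P Q (z - μ) k l)) := by
    intro k l
    rw [zakShift, ← mul_assoc, ← unitExp_add]
    have : gridPoint P Q z k l - μ = gridPoint P Q (z - μ) k l := by
      simp only [gridPoint]; abel
    rw [this]
    congr 2
    simp [gridPoint]
    ring
  simp only [Matrix.of_apply, crossGram_apply, hk, hk', map_mul, Finset.mul_sum, conj_unitExp,
    Equiv.refl_apply]
  refine Finset.sum_congr rfl fun k _ => ?_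
  linear_combination (unitExp (- -(μ.2 * (l / Q))) * (starRingEnd ℂ) (F (gridPoint P Q (z - μ) k l)) *
    (unitExp (-(μ.2 * (l' / Q))) * H (gridPoint P Q (z - μ) k l'))) *
      unitExp_neg_mul (μ.2 * (z.1 + k / P))

theorem crossDet_const_mul_right (c : ℂ) (F H : ℝ × ℝ → ℂ) (z : ℝ × ℝ) :
    crossDet P Q F (fun w => c * H w) z = c ^ Q * crossDet P Q F H z := by
  rw [crossDet, zakMatrix_const_mul, Matrix.mul_smul, Matrix.det_smul, Fintype.card_fin, crossDet]

/-- The generator (1/Q, 0) permutes the columns cyclically and gives one of them the phase of the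
wrap-around; the constant is the sign of the cycle. -/
theorem exists_crossDet_zakShift_time (P : ℕ) (hQ : 0 < Q) :
    ∃ c : ℂ, c ≠ 0 ∧ ∀ F, QuasiPeriodic F → ∀ z : ℝ × ℝ,
      crossDet P Q F (zakShift (1 / (Q : ℝ), 0) F) z =
        c * unitExp (-z.2) * crossDet P Q F F z := by
  refine ⟨((Equiv.Perm.sign (finRotate Q) : ℤ) : ℂ), ?_, fun F hF z => ?_⟩
  · rcases Int.units_eq_one_or (Equiv.Perm.sign (finRotate Q)) with h | h <;> simp [h]
  have h1 : (zakMatrix P Q F z).conjTranspose * zakMatrix P Q (zakShift (1 / (Q : ℝ), 0) F) z =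
      Matrix.of fun l l' : Fin Q => (if (l' : ℕ) + 1 = Q then unitExp (-z.2) else 1) *
        (((zakMatrix P Q F z).conjTranspose * zakMatrix P Q F z).submatrix id (finRotate Q)) l l' := by
    ext l l'
    have hk : ∀ k : ℕ, zakShift (1 / (Q : ℝ), 0) F (gridPoint P Q z k l') =
        F (gridPoint P Q (z - (1 / (Q : ℝ), 0)) k l') := by
      intro k
      have : gridPoint P Q z k l' - (1 / (Q : ℝ), 0) =
          gridPoint P Q (z - (1 / (Q : ℝ), 0)) k l' := by
        simp only [gridPoint]; abel
      rw [zakShift, this]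
      simp [unitExp_zero]
    simp only [Matrix.of_apply, Matrix.submatrix_apply, crossGram_apply, hk,
      hF.gridPoint_sub_inv hQ, id, Finset.mul_sum]
    refine Finset.sum_congr rfl fun k _ => by ring
  have h2 : ∏ l : Fin Q, (if (l : ℕ) + 1 = Q then unitExp (-z.2) else 1) = unitExp (-z.2) := by
    rw [Finset.prod_eq_single (⟨Q - 1, by omega⟩ : Fin Q)]
    · rw [if_pos (by simp; omega)]
    · intro l _ hl
      rw [if_neg]
      intro h
      exact hl (Fin.ext (by simp; omega))
    · simp
  rw [crossDet, h1, Matrix.det_mul_row, h2, Matrix.det_permute', crossDet]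
  ring

/-- The generator (0, P) multiplies by a character of frequency P, which does not see the row
offsets k/P. Each of the Q columns is thus multiplied by a single factor, whence the frequency PQ.
-/
theorem exists_crossDet_zakShift_freq (hP : 0 < P) (Q : ℕ) :
    ∃ c : ℂ, c ≠ 0 ∧ ∀ F, QuasiPeriodic F → ∀ z : ℝ × ℝ,
      crossDet P Q F (zakShift (0, (P : ℝ)) F) z =
        c * unitExp (P * Q * z.1) * crossDet P Q F F z := by
  refine ⟨∏ l : Fin Q, unitExp (-(P * ((l : ℕ) / Q : ℝ))),
    Finset.prod_ne_zero_iff.2 fun l _ => unitExp_ne_zero _, fun F hF z => ?_⟩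
  have h1 : (zakMatrix P Q F z).conjTranspose * zakMatrix P Q (zakShift (0, (P : ℝ)) F) z =
      Matrix.of fun l l' : Fin Q => (unitExp (P * z.1) * unitExp (-(P * ((l' : ℕ) / Q : ℝ)))) *
        ((zakMatrix P Q F z).conjTranspose * zakMatrix P Q F z) l l' := by
    ext l l'
    have hk : ∀ k : ℕ, zakShift (0, (P : ℝ)) F (gridPoint P Q z k l') =
        (unitExp (P * z.1) * unitExp (-(P * ((l' : ℕ) / Q : ℝ)))) * F (gridPoint P Q z k l') := by
      intro k
      have : gridPoint P Q z k l' - (0, (P : ℝ)) =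
          gridPoint P Q z k l' + (((0 : ℤ) : ℝ), ((-P : ℤ) : ℝ)) := by
        ext <;> simp
        ring
      rw [zakShift, this, hF]
      have h2 : (P : ℝ) * (gridPoint P Q z k l').1 =
          (P * z.1 + -(P * ((l' : ℕ) / Q : ℝ))) + (k : ℤ) := by
        simp [gridPoint]; field_simp; ring
      simp only [h2, unitExp_add_int]
      rw [unitExp_add]
      simp [unitExp_zero]
    simp only [Matrix.of_apply, crossGram_apply, hk, Finset.mul_sum]
    refine Finset.sum_congr rfl fun k _ => by ring
  have h2 : ∀ n : ℕ, unitExp (P * z.1) ^ n = unitExp (P * n * z.1) := by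
    intro n
    rw [unitExp, ← Complex.exp_nat_mul, unitExp]
    congr 1
    push_cast
    ring
  rw [crossDet, h1, Matrix.det_mul_row, Finset.prod_mul_distrib, Finset.prod_const,
    Finset.card_univ, Fintype.card_fin, h2, crossDet]
  ring

end ZakMatrix

/-! ### Determinant identities for nested ranges -/

section CrossIdentity

variable {P Q : ℕ}

/-- Both sides contain det B once, because the products involved are square of size Q. Applied to
the Zak matrices of F, π(μ)F and π(μ)π(ν)F, it is the source of the additivity of winding numbers.
-/
theorem det_cross_identity (A₁ A₂ A₃ : Matrix (Fin P) (Fin Q) ℂ) {B : Matrix (Fin Q) (Fin Q) ℂ}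
    (hB : A₃ = A₂ * B) :
    (A₁.conjTranspose * A₃).det * (A₂.conjTranspose * A₂).det =
      (A₁.conjTranspose * A₂).det * (A₂.conjTranspose * A₃).det := by
  subst hB
  simp only [← Matrix.mul_assoc, Matrix.det_mul]
  ring

/-- Equality case of Cauchy–Schwarz for determinants. It turns lower bounds for Gram determinants
into lower bounds for cross determinants. -/
theorem norm_sq_det_cross (A₁ A₂ : Matrix (Fin P) (Fin Q) ℂ) {B : Matrix (Fin Q) (Fin Q) ℂ}
    (hB : A₂ = A₁ * B) :
    ‖(A₁.conjTranspose * A₂).det‖ ^ 2 =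
      ‖(A₁.conjTranspose * A₁).det‖ * ‖(A₂.conjTranspose * A₂).det‖ := by
  subst hB
  have h : (A₁ * B).conjTranspose * (A₁ * B) =
      B.conjTranspose * ((A₁.conjTranspose * A₁) * B) := by
    simp only [Matrix.conjTranspose_mul, Matrix.mul_assoc]
  rw [h, ← Matrix.mul_assoc]
  simp only [Matrix.det_mul, norm_mul, Matrix.det_conjTranspose, norm_star]
  ring

end CrossIdentity

/-! ### Averaging over small shifts and vanishing mean oscillation -/

theorem measurableSet_square (a : ℝ × ℝ) (δ : ℝ) : MeasurableSet (square a δ) :=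
  measurableSet_Icc.prod measurableSet_Icc

theorem isCompact_square (a : ℝ × ℝ) (δ : ℝ) : IsCompact (square a δ) :=
  isCompact_Icc.prod isCompact_Icc

theorem volume_real_square (a : ℝ × ℝ) {δ : ℝ} (hδ : 0 < δ) :
    (volume : Measure (ℝ × ℝ)).real (square a δ) = δ ^ 2 := by
  rw [square, Measure.real, Measure.volume_eq_prod, Measure.prod_prod, Real.volume_Icc,
    Real.volume_Icc, add_sub_cancel_left, add_sub_cancel_left,
    ← ENNReal.ofReal_mul hδ.le, ENNReal.toReal_ofReal (by positivity), sq]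

theorem preimage_add_square (z : ℝ × ℝ) (δ : ℝ) :
    (fun σ => z + σ) ⁻¹' square z δ = square 0 δ := by
  ext σ
  simp only [square, mem_preimage, mem_prod, mem_Icc, Prod.fst_add, Prod.snd_add, Prod.fst_zero,
    Prod.snd_zero, zero_add, add_le_add_iff_left, le_add_iff_nonneg_right]

theorem setIntegral_add_square {E : Type*} [NormedAddCommGroup E] [NormedSpace ℝ E]
    (f : ℝ × ℝ → E) (z : ℝ × ℝ) (δ : ℝ) :
    ∫ σ in square 0 δ, f (z + σ) = ∫ w in square z δ, f w := by
  rw [← (measurePreserving_add_left volume z).setIntegral_preimage_emb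
    (measurableEmbedding_addLeft z) f (square z δ), preimage_add_square]

theorem integrableOn_square_add {F : ℝ × ℝ → ℂ} (hF : LocallyIntegrable F) (z : ℝ × ℝ) (δ : ℝ) :
    IntegrableOn (fun σ => F (z + σ)) (square 0 δ) := by
  have h := (measurePreserving_add_left volume z).integrableOn_comp_preimage
    (measurableEmbedding_addLeft z) (f := F) (s := square z δ)
  rw [preimage_add_square] at h
  exact h.2 (hF.integrableOn_isCompact (isCompact_square z δ))

theorem zakShift_neg (σ : ℝ × ℝ) (F : ℝ × ℝ → ℂ) (z : ℝ × ℝ) :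
    zakShift (-σ) F z = unitExp (-(σ.2 * z.1)) * F (z + σ) := by
  rw [zakShift, sub_neg_eq_add, Prod.snd_neg, neg_mul]

theorem integrableOn_zakShift_neg {F : ℝ × ℝ → ℂ} (hF : LocallyIntegrable F) (z : ℝ × ℝ) (δ : ℝ) :
    IntegrableOn (fun σ => zakShift (-σ) F z) (square 0 δ) := by
  simp only [zakShift_neg]
  refine (integrableOn_square_add hF z δ).bdd_mul (c := 1) ?_ ?_
  · exact (by fun_prop : Continuous fun σ : ℝ × ℝ => unitExp (-(σ.2 * z.1))).aestronglyMeasurable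
  · exact Eventually.of_forall fun σ => (norm_unitExp _).le

/-- The average of the time-frequency shifts of `F` over a small square of shifts. -/
noncomputable def zakAvg (F : ℝ × ℝ → ℂ) (ε : ℝ) (z : ℝ × ℝ) : ℂ :=
  ⨍ σ in square 0 ε, zakShift (-σ) F z

/-- All shifts of F have the same quasi-periodicity factors, so their average keeps them. Averaging
plain translates would not, since the factor depends on the second coordinate. -/
theorem QuasiPeriodic.zakAvg {F : ℝ × ℝ → ℂ} (hF : QuasiPeriodic F) (ε : ℝ) :
    QuasiPeriodic (zakAvg F ε) := by
  intro z m n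
  simp only [_root_.zakAvg, setAverage_eq, (hF.zakShift _) z m n]
  rw [integral_const_mul, mul_smul_comm]

theorem ae_fst_ne (c : ℝ) : ∀ᵐ w : ℝ × ℝ, w.1 ≠ c := by
  have : ∀ᵐ x : ℝ, x ≠ c := by simp [ae_iff, measure_singleton]
  exact Measure.quasiMeasurePreserving_fst.ae this

theorem ae_snd_ne (c : ℝ) : ∀ᵐ w : ℝ × ℝ, w.2 ≠ c := by
  have : ∀ᵐ x : ℝ, x ≠ c := by simp [ae_iff, measure_singleton]
  exact Measure.quasiMeasurePreserving_snd.ae this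

/-- After a change of variables the average is an integral of F, with a continuous phase, over a
square moving with z, and dominated convergence applies. -/
theorem continuous_zakAvg {F : ℝ × ℝ → ℂ} (hF : LocallyIntegrable F) (ε : ℝ) :
    Continuous (zakAvg F ε) := by
  have h0 : ∀ z, zakAvg F ε z = (volume.real (square 0 ε))⁻¹ •
      ∫ w, (square z ε).indicator (fun w => unitExp (-((w.2 - z.2) * z.1)) * F w) w := by
    intro z
    rw [zakAvg, setAverage_eq, integral_indicator (measurableSet_square z ε),
      ← setIntegral_add_square (fun w => unitExp (-((w.2 - z.2) * z.1)) * F w)]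
    congr 2
    funext σ
    simp [zakShift_neg]
  have h1 : zakAvg F ε = _ := funext h0
  rw [h1]
  suffices h : Continuous fun z : ℝ × ℝ =>
      ∫ w, (square z ε).indicator (fun w => unitExp (-((w.2 - z.2) * z.1)) * F w) w from
    h.const_smul (volume.real (square (0 : ℝ × ℝ) ε))⁻¹
  refine continuous_iff_continuousAt.2 fun z₀ => ?_
  refine continuousAt_of_dominated
    (bound := (Metric.closedBall z₀ (1 + |ε|)).indicator fun w => ‖F w‖) ?_ ?_ ?_ ?_
  · refine Eventually.of_forall fun z => AEStronglyMeasurable.indicator ?_ (measurableSet_square z ε)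
    exact (by fun_prop : Continuous fun w : ℝ × ℝ =>
      unitExp (-((w.2 - z.2) * z.1))).aestronglyMeasurable.mul hF.aestronglyMeasurable
  · filter_upwards [Metric.ball_mem_nhds z₀ one_pos] with z hz
    refine Eventually.of_forall fun w => ?_
    by_cases hw : w ∈ square z ε
    · have hw' : w ∈ Metric.closedBall z₀ (1 + |ε|) := by
        have h2 : dist w z ≤ |ε| := by
          obtain ⟨⟨a1, a2⟩, b1, b2⟩ := hw
          rw [Prod.dist_eq, Real.dist_eq, Real.dist_eq]
          refine max_le ?_ ?_ <;> rw [abs_le] <;> constructor <;>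
            linarith [le_abs_self ε, abs_nonneg ε]
        have := dist_triangle w z z₀
        rw [Metric.mem_closedBall]
        linarith [Metric.mem_ball.1 hz]
      rw [indicator_of_mem hw, indicator_of_mem hw', norm_mul, norm_unitExp, one_mul]
    · rw [indicator_of_notMem hw, norm_zero]
      exact indicator_nonneg (fun _ _ => norm_nonneg _) _
  · rw [integrable_indicator_iff measurableSet_closedBall]
    exact (hF.integrableOn_isCompact (isCompact_closedBall _ _)).norm
  -- Away from the four lines bounding the square at `z₀`, membership of `w` in the moving square is
  -- locally constant in z.
  · filter_upwards [ae_fst_ne z₀.1, ae_fst_ne (z₀.1 + ε), ae_snd_ne z₀.2, ae_snd_ne (z₀.2 + ε)] with w w1 w2 w3 w4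
    have hc : ContinuousAt (fun z : ℝ × ℝ => unitExp (-((w.2 - z.2) * z.1)) * F w) z₀ := by
      fun_prop
    have hev : ∀ {f g : ℝ × ℝ → ℝ}, Continuous f → Continuous g → f z₀ ≠ g z₀ →
        ∀ᶠ z in 𝓝 z₀, (f z ≤ g z ↔ f z₀ ≤ g z₀) := by
      intro f g hf hg hfg
      rcases lt_or_gt_of_ne hfg with h | h
      · filter_upwards [(hf.tendsto z₀).eventually_lt (hg.tendsto z₀) h] with z hz
        exact ⟨fun _ => h.le, fun _ => hz.le⟩
      · filter_upwards [(hg.tendsto z₀).eventually_lt (hf.tendsto z₀) h] with z hz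
        exact ⟨fun h' => absurd hz h'.not_gt, fun h' => absurd h h'.not_gt⟩
    have hmem : ∀ᶠ z in 𝓝 z₀, (w ∈ square z ε ↔ w ∈ square z₀ ε) := by
      filter_upwards [hev continuous_fst (continuous_const (y := w.1)) w1.symm,
        hev (continuous_const (y := w.1)) (g := fun z => z.1 + ε) (by fun_prop) w2,
        hev continuous_snd (continuous_const (y := w.2)) w3.symm,
        hev (continuous_const (y := w.2)) (g := fun z => z.2 + ε) (by fun_prop) w4]
        with z a1 a2 a3 a4
      simp only [square, mem_prod, mem_Icc, a1, a2, a3, a4]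
    by_cases hw : w ∈ square z₀ ε
    · refine hc.congr ?_
      filter_upwards [hmem] with z hz
      rw [indicator_of_mem (hz.2 hw)]
    · refine (continuousAt_const (y := (0 : ℂ))).congr ?_
      filter_upwards [hmem] with z hz
      rw [indicator_of_notMem (fun h => hw (hz.1 h))]

/-- The mean is within a factor 2 of the best constant. It allows the average of the shifts to be
compared with the plain mean of F. -/
theorem setIntegral_norm_sub_average_le {G : ℝ × ℝ → ℂ} {ε : ℝ} (hε : 0 < ε)
    (hG : IntegrableOn G (square 0 ε)) (c : ℂ) :
    ∫ σ in square 0 ε, ‖G σ - ⨍ τ in square 0 ε, G τ‖ ≤ 2 * ∫ σ in square 0 ε, ‖G σ - c‖ := by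
  have hfin : volume (square (0 : ℝ × ℝ) ε) ≠ ⊤ := (isCompact_square 0 ε).measure_ne_top
  have hv := volume_real_square 0 hε
  have hc : IntegrableOn (fun _ : ℝ × ℝ => c) (square 0 ε) := integrableOn_const hfin
  have h1 : ‖c - ⨍ τ in square 0 ε, G τ‖ ≤ (ε ^ 2)⁻¹ * ∫ σ in square 0 ε, ‖G σ - c‖ := by
    have h2 : c - ⨍ τ in square 0 ε, G τ = -((ε ^ 2)⁻¹ • ∫ σ in square 0 ε, (G σ - c)) := by
      rw [integral_sub hG hc, setIntegral_const, setAverage_eq, hv, smul_sub, smul_smul,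
        inv_mul_cancel₀ (by positivity), one_smul]
      ring
    rw [h2, norm_neg, norm_smul, norm_inv, Real.norm_of_nonneg (by positivity)]
    gcongr
    exact norm_integral_le_integral_norm _
  have hI : IntegrableOn (fun σ => ‖G σ - c‖) (square 0 ε) := (hG.sub hc).norm
  calc ∫ σ in square 0 ε, ‖G σ - ⨍ τ in square 0 ε, G τ‖
      ≤ ∫ σ in square 0 ε, (‖G σ - c‖ + (ε ^ 2)⁻¹ * ∫ σ in square 0 ε, ‖G σ - c‖) := by
        refine integral_mono (hG.sub (integrableOn_const hfin)).norm
          (hI.add (integrableOn_const hfin)) fun σ => ?_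
        have := norm_add_le (G σ - c) (c - ⨍ τ in square 0 ε, G τ)
        rw [sub_add_sub_cancel] at this
        exact this.trans (by gcongr)
    _ = 2 * ∫ σ in square 0 ε, ‖G σ - c‖ := by
        rw [integral_add hI (integrableOn_const hfin), setIntegral_const, hv, smul_eq_mul]
        field_simp
        ring

theorem norm_unitExp_sub_one_le (t : ℝ) : ‖unitExp t - 1‖ ≤ 2 * Real.pi * |t| := by
  have := Real.norm_exp_I_mul_ofReal_sub_one_le (x := 2 * Real.pi * t)
  rw [Real.norm_eq_abs, abs_mul, abs_of_pos (by positivity : (0 : ℝ) < 2 * Real.pi)] at this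
  convert this using 3
  rw [unitExp]
  congr 1
  push_cast
  ring

/-- On a small square the phase in the shift is nearly 1, and F is bounded, so the oscillation of σ
↦ π(-σ)F(z) is controlled by that of F. Uniformity in z comes from quasi-periodicity. -/
theorem exists_forall_setIntegral_zakShift_sub_zakAvg_le {F : ℝ × ℝ → ℂ} (hF : QuasiPeriodic F)
    (hV : MemVMOLoc F) {C : ℝ} (hC : ∀ᵐ z, ‖F z‖ ≤ C) {δ : ℝ} (hδ : 0 < δ) :
    ∃ ε > 0, ∀ z, ∫ σ in square 0 ε, ‖zakShift (-σ) F z - zakAvg F ε z‖ ≤ δ * ε ^ 2 := by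
  obtain ⟨⟨hloc, -⟩, htend⟩ := hV (Metric.ball 0 3) Metric.isOpen_ball Metric.isBounded_ball
  have hC0 : 0 ≤ C := by
    obtain ⟨z, hz⟩ := hC.exists
    exact (norm_nonneg _).trans hz
  have hev := (tendsto_order.1 htend).2 (ENNReal.ofReal (δ / 4)) (by simpa using hδ)
  obtain ⟨s, hs, hs0⟩ := (hev.and self_mem_nhdsWithin).exists
  have hs0 : 0 < s := hs0
  -- The bounds `r < 1` and `r < s` make the area less than `s`; the last bound makes the phase
  -- error 2πrC at most δ/4. With oscillation δ/4 this gives δ/2, and the factor 2 above gives δ.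
  obtain ⟨r, hr0, hr1⟩ : ∃ r : ℝ, 0 < r ∧ r < min (min 1 s) (δ / (8 * Real.pi * (C + 1))) :=
    exists_between (by have := Real.pi_pos; positivity)
  have hr1' : r < 1 := hr1.trans_le ((min_le_left _ _).trans (min_le_left _ _))
  have hr2 : r < s := hr1.trans_le ((min_le_left _ _).trans (min_le_right _ _))
  have hr3 : r < δ / (8 * Real.pi * (C + 1)) := hr1.trans_le (min_le_right _ _)
  refine ⟨r, hr0, fun z => ?_⟩
  have hfin : volume (square (0 : ℝ × ℝ) r) ≠ ⊤ := (isCompact_square 0 r).measure_ne_top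
  have key : ∀ z : ℝ × ℝ, z.1 ∈ Ico (0 : ℝ) 1 → z.2 ∈ Ico (0 : ℝ) 1 →
      ∫ σ in square 0 r, ‖zakShift (-σ) F z - zakAvg F r z‖ ≤ δ * r ^ 2 := by
    intro z hz1 hz2
    have hsub : square z r ⊆ Metric.ball 0 3 := by
      rintro w ⟨⟨a1, a2⟩, b1, b2⟩
      rw [Metric.mem_ball, Prod.dist_eq, Real.dist_eq, Real.dist_eq]
      have h1 := hz1.1; have h2 := hz1.2; have h3 := hz2.1; have h4 := hz2.2
      refine max_lt ?_ ?_ <;> rw [abs_lt] <;> constructor <;> simp <;> linarith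
    have hosc : meanOsc F (square z r) ≤ δ / 4 := by
      have h1 : ENNReal.ofReal (meanOsc F (square z r)) ≤ oscSup F (Metric.ball 0 3) s := by
        unfold oscSup
        refine le_iSup_of_le z (le_iSup_of_le r (le_iSup_of_le hr0 (le_iSup_of_le hsub
          (le_iSup_of_le ?_ le_rfl))))
        nlinarith
      exact (ENNReal.ofReal_le_ofReal_iff (by positivity)).1 (h1.trans hs.le)
    set c : ℂ := ⨍ q in square z r, F q with hc
    have h2 : ∫ σ in square 0 r, ‖F (z + σ) - c‖ ≤ δ / 4 * r ^ 2 := by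
      rw [setIntegral_add_square (fun w => ‖F w - c‖)]
      rw [meanOsc, setAverage_eq, volume_real_square z hr0, ← hc, smul_eq_mul,
        inv_mul_le_iff₀ (by positivity)] at hosc
      linarith
    have hI1 : IntegrableOn (fun σ => F (z + σ) - c) (square 0 r) :=
      (integrableOn_square_add hloc z r).sub (integrableOn_const hfin)
    have hI2 := integrableOn_zakShift_neg hloc z r
    have hCz : ∀ᵐ σ, ‖F (z + σ)‖ ≤ C :=
      (measurePreserving_add_left volume z).quasiMeasurePreserving.ae hC
    have h3 : ∫ σ in square 0 r, ‖zakShift (-σ) F z - c‖ ≤ δ / 2 * r ^ 2 := by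
      calc ∫ σ in square 0 r, ‖zakShift (-σ) F z - c‖
          ≤ ∫ σ in square 0 r, (‖F (z + σ) - c‖ + δ / 4) := by
            refine integral_mono_ae (hI2.sub (integrableOn_const hfin)).norm
              (hI1.norm.add (integrableOn_const hfin)) ?_
            rw [Filter.EventuallyLE, ae_restrict_iff' (measurableSet_square _ _)]
            filter_upwards [hCz] with σ hσ hσr
            have h4 : zakShift (-σ) F z - c =
                (F (z + σ) - c) + (unitExp (-(σ.2 * z.1)) - 1) * F (z + σ) := by
              rw [zakShift_neg]; ring
            rw [h4]
            refine (norm_add_le _ _).trans ?_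
            gcongr
            rw [norm_mul]
            have h5 : |-(σ.2 * z.1)| ≤ r := by
              obtain ⟨-, b1, b2⟩ := hσr
              simp only [Prod.snd_zero, zero_add] at b1 b2
              rw [abs_neg, abs_mul, abs_of_nonneg b1, abs_of_nonneg hz1.1]
              nlinarith [hz1.1, hz1.2]
            have h6 := norm_unitExp_sub_one_le (-(σ.2 * z.1))
            have hpi := Real.pi_pos
            calc _ ≤ (2 * Real.pi * r) * C := by
                  refine mul_le_mul (h6.trans (by gcongr)) hσ (norm_nonneg _) (by positivity)
              _ ≤ (2 * Real.pi * (δ / (8 * Real.pi * (C + 1)))) * (C + 1) := by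
                  gcongr
                  linarith
              _ = δ / 4 := by field_simp; ring
        _ = (∫ σ in square 0 r, ‖F (z + σ) - c‖) + δ / 4 * r ^ 2 := by
            rw [integral_add hI1.norm (integrableOn_const hfin), setIntegral_const,
              volume_real_square 0 hr0, smul_eq_mul]
            ring
        _ ≤ δ / 2 * r ^ 2 := by nlinarith
    have h7 := setIntegral_norm_sub_average_le hr0 hI2 c
    exact h7.trans (by linarith)
  -- An integer translation multiplies the shift and the average by the same unimodular factor, so
  -- the cell [0,1)² suffices.
  have hz : z = (Int.fract z.1, Int.fract z.2) + ((⌊z.1⌋ : ℝ), (⌊z.2⌋ : ℝ)) := by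
    ext <;> simp
  have h8 := key (Int.fract z.1, Int.fract z.2) ⟨Int.fract_nonneg _, Int.fract_lt_one _⟩
    ⟨Int.fract_nonneg _, Int.fract_lt_one _⟩
  convert h8 using 3 with σ
  conv_lhs => rw [hz]
  rw [(hF.zakShift _) _ _ _, (hF.zakAvg r) _ _ _, ← mul_sub, norm_mul, norm_unitExp, one_mul]

/-- The sum of the deviations at the points `y i` has mean at most card ι · δ, so outside a null set
some σ does no worse than the mean. One σ then serves all points at once and also avoids the
exceptional set of `p`. -/
theorem exists_shift_near_zakAvg {ι : Type*} [Fintype ι] {F : ℝ × ℝ → ℂ} (hF : LocallyIntegrable F)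
    {ε δ : ℝ} (hε : 0 < ε)
    (h : ∀ z, ∫ σ in square 0 ε, ‖zakShift (-σ) F z - zakAvg F ε z‖ ≤ δ * ε ^ 2)
    (y : ι → ℝ × ℝ) {p : ℝ × ℝ → Prop} (hp : ∀ᵐ w, p w) (z : ℝ × ℝ) :
    ∃ σ, p (z + σ) ∧
      ∀ i, ‖zakShift (-σ) F (y i) - zakAvg F ε (y i)‖ ≤ Fintype.card ι * δ := by
  have hfin : volume (square (0 : ℝ × ℝ) ε) ≠ ⊤ := (isCompact_square 0 ε).measure_ne_top
  have hv := volume_real_square 0 hε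
  have hne : (volume.restrict (square (0 : ℝ × ℝ) ε)) ≠ 0 := by
    intro h0
    have : volume.real (square (0 : ℝ × ℝ) ε) = 0 := by
      rw [Measure.real, Measure.restrict_eq_zero.1 h0, ENNReal.toReal_zero]
    rw [hv] at this
    exact (by positivity : ε ^ 2 ≠ 0) this
  have hI : ∀ i, IntegrableOn (fun σ => ‖zakShift (-σ) F (y i) - zakAvg F ε (y i)‖) (square 0 ε) :=
    fun i => ((integrableOn_zakShift_neg hF (y i) ε).sub (integrableOn_const hfin)).norm
  have hp' : ∀ᵐ σ, p (z + σ) := (measurePreserving_add_left volume z).quasiMeasurePreserving.ae hp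
  have : IsFiniteMeasure (volume.restrict (square (0 : ℝ × ℝ) ε)) := ⟨by
    rw [Measure.restrict_apply_univ]; exact hfin.lt_top⟩
  obtain ⟨σ, hσ, hle⟩ := exists_notMem_null_le_average hne
    (integrable_finsetSum Finset.univ fun i _ => hI i)
    (ae_iff.1 (ae_restrict_of_ae (s := square (0 : ℝ × ℝ) ε) hp'))
  refine ⟨σ, by simpa using hσ, fun i => ?_⟩
  have h1 : ⨍ σ in square 0 ε, ∑ i, ‖zakShift (-σ) F (y i) - zakAvg F ε (y i)‖ ≤
      Fintype.card ι * δ := by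
    rw [setAverage_eq, integral_finsetSum _ fun i _ => hI i, hv, smul_eq_mul,
      inv_mul_le_iff₀ (by positivity)]
    calc _ ≤ ∑ _i : ι, δ * ε ^ 2 := Finset.sum_le_sum fun i _ => h (y i)
      _ = _ := by rw [Finset.sum_const, Finset.card_univ, nsmul_eq_mul]; ring
  refine le_trans ?_ (hle.trans h1)
  exact Finset.single_le_sum (f := fun i => ‖zakShift (-σ) F (y i) - zakAvg F ε (y i)‖)
    (fun _ _ => norm_nonneg _) (Finset.mem_univ i)

/-! ### Stability of the determinant identity, by compactness -/

/-- The lower bound passes to the closure by continuity, so the set itself need not be closed; the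
closure is compact and has a thickening on which Ψ > 0. -/
theorem exists_pos_of_bounded_of_le {E : Type*} [PseudoMetricSpace E] [ProperSpace E] {X : Set E}
    (hX : Bornology.IsBounded X) {Ψ : E → ℝ} (hΨ : Continuous Ψ) {κ : ℝ} (hκ : 0 < κ)
    (h : ∀ a ∈ X, κ ≤ Ψ a) : ∃ δ > 0, ∀ a ∈ X, ∀ b, dist b a ≤ δ → 0 < Ψ b := by
  have hK : IsCompact (closure X) := hX.isCompact_closure
  have hsub : closure X ⊆ {b | 0 < Ψ b} := fun a ha => by
    have : κ ≤ Ψ a := closure_minimal h (isClosed_le continuous_const hΨ) ha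
    exact hκ.trans_le this
  obtain ⟨δ, hδ, hδ'⟩ := hK.exists_cthickening_subset_open (isOpen_lt continuous_const hΨ) hsub
  refine ⟨δ, hδ, fun a ha b hb => hδ' ?_⟩
  exact Metric.mem_cthickening_of_dist_le b a δ _ (subset_closure ha) hb

section

variable {P Q : ℕ}

/-- The left diagonal factor of `zakMatrix_zakShift` is common to both matrices; the right one is
absorbed into B by conjugation. -/
theorem exists_zakMatrix_zakShift {G H : ℝ × ℝ → ℂ} {μ z : ℝ × ℝ}
    (h : ∃ B : Matrix (Fin Q) (Fin Q) ℂ, zakMatrix P Q H (z - μ) = zakMatrix P Q G (z - μ) * B) :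
    ∃ B : Matrix (Fin Q) (Fin Q) ℂ, zakMatrix P Q (zakShift μ H) z = zakMatrix P Q (zakShift μ G) z * B := by
  obtain ⟨B, hB⟩ := h
  refine ⟨Matrix.diagonal (fun l : Fin Q => unitExp (μ.2 * ((l : ℕ) / Q))) * B *
    Matrix.diagonal (fun l : Fin Q => unitExp (-(μ.2 * ((l : ℕ) / Q)))), ?_⟩
  have h1 : Matrix.diagonal (fun l : Fin Q => unitExp (-(μ.2 * ((l : ℕ) / Q)))) *
      Matrix.diagonal (fun l : Fin Q => unitExp (μ.2 * ((l : ℕ) / Q))) = 1 := by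
    rw [Matrix.diagonal_mul_diagonal, ← Matrix.diagonal_one]
    congr 1
    funext l
    exact unitExp_neg_mul _
  rw [zakMatrix_zakShift, zakMatrix_zakShift, hB]
  simp only [← Matrix.mul_assoc]
  rw [Matrix.mul_assoc (_ * _) (Matrix.diagonal fun l : Fin Q => unitExp (-(μ.2 * ((l : ℕ) / Q))))
    (Matrix.diagonal fun l : Fin Q => unitExp (μ.2 * ((l : ℕ) / Q))), h1, Matrix.mul_one]

theorem exists_zakMatrix_zakShift_comm {F : ℝ × ℝ → ℂ} {μ σ z : ℝ × ℝ}
    (h : ∃ B : Matrix (Fin Q) (Fin Q) ℂ, zakMatrix P Q (zakShift μ F) (z - σ) = zakMatrix P Q F (z - σ) * B) :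
    ∃ B : Matrix (Fin Q) (Fin Q) ℂ, zakMatrix P Q (zakShift μ (zakShift σ F)) z = zakMatrix P Q (zakShift σ F) z * B := by
  obtain ⟨B, hB⟩ := exists_zakMatrix_zakShift h
  have h1 : zakShift μ (zakShift σ F) = fun z =>
      (unitExp (-(σ.2 * μ.1)) * unitExp (μ.2 * σ.1)) * zakShift σ (zakShift μ F) z := by
    funext z
    rw [zakShift_zakShift, zakShift_zakShift, add_comm σ μ]
    linear_combination -unitExp (-(σ.2 * μ.1)) * zakShift (μ + σ) F z * unitExp_neg_mul (μ.2 * σ.1)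
  refine ⟨(unitExp (-(σ.2 * μ.1)) * unitExp (μ.2 * σ.1)) • B, ?_⟩
  rw [h1, zakMatrix_const_mul, hB, Matrix.mul_smul]

/-- The Zak matrix of `zakShift μ F` has its columns in the range of the Zak matrix of `F`,
almost everywhere. -/
def ShiftInRange (P Q : ℕ) (F : ℝ × ℝ → ℂ) (μ : ℝ × ℝ) : Prop :=
  ∀ᵐ w, ∃ B : Matrix (Fin Q) (Fin Q) ℂ, zakMatrix P Q (zakShift μ F) w = zakMatrix P Q F w * B

theorem ae_sub {p : ℝ × ℝ → Prop} (h : ∀ᵐ w, p w) (a : ℝ × ℝ) : ∀ᵐ w, p (w - a) :=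
  (measurePreserving_sub_right volume a).quasiMeasurePreserving.ae h

theorem ae_add {p : ℝ × ℝ → Prop} (h : ∀ᵐ w, p w) (a : ℝ × ℝ) : ∀ᵐ w, p (w + a) :=
  (measurePreserving_add_right volume a).quasiMeasurePreserving.ae h

/-- Up to a constant, π(μ + ν)F is π(μ)π(ν)F; its range lies in that of π(μ)F by transporting the
hypothesis on ν, and the latter lies in that of F. -/
theorem ShiftInRange.add {F : ℝ × ℝ → ℂ} {μ ν : ℝ × ℝ} (hμ : ShiftInRange P Q F μ)
    (hν : ShiftInRange P Q F ν) : ShiftInRange P Q F (μ + ν) := by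
  filter_upwards [hμ, ae_sub hν μ] with w h1 h2
  obtain ⟨B₁, h1⟩ := h1
  obtain ⟨B₂, h2⟩ := exists_zakMatrix_zakShift h2
  have h3 : zakShift (μ + ν) F = fun z => unitExp (ν.2 * μ.1) * zakShift μ (zakShift ν F) z := by
    funext z
    rw [zakShift_zakShift]
    linear_combination -zakShift (μ + ν) F z * unitExp_neg_mul (ν.2 * μ.1)
  refine ⟨unitExp (ν.2 * μ.1) • (B₁ * B₂), ?_⟩
  rw [h3, zakMatrix_const_mul, h2, h1, Matrix.mul_smul, Matrix.mul_assoc]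

/-- Bounds for the Zak matrix of `F` at a point. -/
def ZakBounded (P Q : ℕ) (F : ℝ × ℝ → ℂ) (C κ : ℝ) (w : ℝ × ℝ) : Prop :=
  (∀ (k : Fin P) (l : Fin Q), ‖zakMatrix P Q F w k l‖ ≤ C) ∧ κ ≤ ‖crossDet P Q F F w‖

theorem ZakBounded.zakShift {F : ℝ × ℝ → ℂ} {C κ : ℝ} {μ z : ℝ × ℝ}
    (h : ZakBounded P Q F C κ (z - μ)) : ZakBounded P Q (zakShift μ F) C κ z := by
  refine ⟨fun k l => ?_, ?_⟩
  · have : gridPoint P Q z k l - μ = gridPoint P Q (z - μ) k l := by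
      simp only [gridPoint]; abel
    rw [zakMatrix, Matrix.of_apply, norm_zakShift, this]
    exact h.1 k l
  · rw [crossDet_zakShift_zakShift]
    exact h.2

variable (P Q) in
/-- Triples of matrices with entries bounded by `C`, with Gram determinants bounded below by `κ`,
and with decreasing ranges. -/
def goodTriples (C κ : ℝ) :
    Set ((Fin P → Fin Q → ℂ) × (Fin P → Fin Q → ℂ) × (Fin P → Fin Q → ℂ)) :=
  {A | ((∀ k l, ‖A.1 k l‖ ≤ C) ∧ (∀ k l, ‖A.2.1 k l‖ ≤ C) ∧ ∀ k l, ‖A.2.2 k l‖ ≤ C) ∧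
    (κ ≤ ‖((Matrix.of A.1).conjTranspose * Matrix.of A.1).det‖ ∧
      κ ≤ ‖((Matrix.of A.2.1).conjTranspose * Matrix.of A.2.1).det‖ ∧
      κ ≤ ‖((Matrix.of A.2.2).conjTranspose * Matrix.of A.2.2).det‖) ∧
    (∃ B : Matrix (Fin Q) (Fin Q) ℂ, Matrix.of A.2.1 = Matrix.of A.1 * B) ∧ ∃ B : Matrix (Fin Q) (Fin Q) ℂ, Matrix.of A.2.2 = Matrix.of A.2.1 * B}

/-- On good triples the difference vanishes by `det_cross_identity` and the product is at least κ²
by `norm_sq_det_cross`. The strict inequality therefore persists on a neighbourhood of uniform size.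
-/
theorem exists_goodTriples_near (C : ℝ) {κ : ℝ} (hκ : 0 < κ) :
    ∃ δ > 0, ∀ A ∈ goodTriples P Q C κ, ∀ A', dist A' A ≤ δ →
      ‖((Matrix.of A'.1).conjTranspose * Matrix.of A'.2.2).det *
          ((Matrix.of A'.2.1).conjTranspose * Matrix.of A'.2.1).det -
        ((Matrix.of A'.1).conjTranspose * Matrix.of A'.2.1).det *
          ((Matrix.of A'.2.1).conjTranspose * Matrix.of A'.2.2).det‖ <
      ‖((Matrix.of A'.1).conjTranspose * Matrix.of A'.2.1).det *
          ((Matrix.of A'.2.1).conjTranspose * Matrix.of A'.2.2).det‖ := by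
  have hb : Bornology.IsBounded (goodTriples P Q C κ) := by
    refine (Metric.isBounded_closedBall (x := 0) (r := max C 0)).subset fun A hA => ?_
    rw [mem_closedBall_zero_iff]
    have h1 : ∀ A : Fin P → Fin Q → ℂ, (∀ k l, ‖A k l‖ ≤ C) → ‖A‖ ≤ max C 0 := fun A hA => by
      refine (pi_norm_le_iff_of_nonneg (le_max_right _ _)).2 fun k =>
        (pi_norm_le_iff_of_nonneg (le_max_right _ _)).2 fun l => (hA k l).trans (le_max_left _ _)
    exact norm_prod_le_iff.2 ⟨h1 _ hA.1.1, norm_prod_le_iff.2 ⟨h1 _ hA.1.2.1, h1 _ hA.1.2.2⟩⟩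
  have hc : ∀ {f g : (Fin P → Fin Q → ℂ) × (Fin P → Fin Q → ℂ) × (Fin P → Fin Q → ℂ) →
      Fin P → Fin Q → ℂ}, Continuous f → Continuous g →
      Continuous fun A => ((Matrix.of (f A)).conjTranspose * Matrix.of (g A)).det := by
    intro f g hf hg
    have hf' : Continuous fun A => Matrix.of (f A) := hf
    have hg' : Continuous fun A => Matrix.of (g A) := hg
    exact (hf'.matrix_conjTranspose.matrix_mul hg').matrix_det
  have c13 := hc continuous_fst (continuous_snd.comp continuous_snd)
  have c22 := hc (continuous_fst.comp continuous_snd) (continuous_fst.comp continuous_snd)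
  have c12 := hc continuous_fst (continuous_fst.comp continuous_snd)
  have c23 := hc (continuous_fst.comp continuous_snd) (continuous_snd.comp continuous_snd)
  obtain ⟨δ, hδ, h⟩ := exists_pos_of_bounded_of_le hb
    (Ψ := fun A => ‖((Matrix.of A.1).conjTranspose * Matrix.of A.2.1).det *
          ((Matrix.of A.2.1).conjTranspose * Matrix.of A.2.2).det‖ -
      ‖((Matrix.of A.1).conjTranspose * Matrix.of A.2.2).det *
          ((Matrix.of A.2.1).conjTranspose * Matrix.of A.2.1).det -
        ((Matrix.of A.1).conjTranspose * Matrix.of A.2.1).det *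
          ((Matrix.of A.2.1).conjTranspose * Matrix.of A.2.2).det‖)
    ((c12.mul c23).norm.sub ((c13.mul c22).sub (c12.mul c23)).norm) (κ := κ * κ) (by positivity)
    (fun A hA => by
      obtain ⟨-, ⟨k1, k2, k3⟩, ⟨B, hB⟩, B', hB'⟩ := hA
      have e := det_cross_identity (Matrix.of A.1) (Matrix.of A.2.1) (Matrix.of A.2.2) hB'
      have n12 := norm_sq_det_cross (Matrix.of A.1) (Matrix.of A.2.1) hB
      have n23 := norm_sq_det_cross (Matrix.of A.2.1) (Matrix.of A.2.2) hB'
      rw [e, sub_self, norm_zero, sub_zero, norm_mul]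
      refine mul_le_mul ?_ ?_ hκ.le (norm_nonneg _)
      · refine (sq_le_sq₀ hκ.le (norm_nonneg _)).1 ?_
        rw [n12, sq]
        exact mul_le_mul k1 k2 hκ.le (norm_nonneg _)
      · refine (sq_le_sq₀ hκ.le (norm_nonneg _)).1 ?_
        rw [n23, sq]
        exact mul_le_mul k2 k3 hκ.le (norm_nonneg _))
  exact ⟨δ, hδ, fun A hA A' hA' => sub_pos.1 (h A hA A' hA')⟩

/-- The three Zak matrices built from π(-σ)F form a good triple, and those built from H are close to
it for a suitable σ. The averaging scale depends only on C, κ, P, Q and F, so a single H serves all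
μ and ν. -/
theorem exists_continuous_crossDet_lt {F : ℝ × ℝ → ℂ} (hF : QuasiPeriodic F) (hV : MemVMOLoc F)
    {C κ : ℝ} (hκ : 0 < κ) (hC : ∀ᵐ z, ‖F z‖ ≤ C) (hb : ∀ᵐ w, ZakBounded P Q F C κ w) :
    ∃ H : ℝ × ℝ → ℂ, Continuous H ∧ QuasiPeriodic H ∧ ∀ μ ν, ShiftInRange P Q F μ →
      ShiftInRange P Q F ν → ∀ z,
        ‖crossDet P Q H (zakShift μ (zakShift ν H)) z * crossDet P Q H H (z - μ) -
          crossDet P Q H (zakShift μ H) z * crossDet P Q H (zakShift ν H) (z - μ)‖ <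
        ‖crossDet P Q H (zakShift μ H) z * crossDet P Q H (zakShift ν H) (z - μ)‖ := by
  have hloc : LocallyIntegrable F := (hV (Metric.ball 0 1) Metric.isOpen_ball
    Metric.isBounded_ball).1.1
  obtain ⟨δ, hδ, hnear⟩ := exists_goodTriples_near (P := P) (Q := Q) C hκ
  -- Number of values that determine the three matrices; simultaneous approximation costs this
  -- factor, which δ / (N + 1) compensates.
  set N : ℕ := Fintype.card (Fin P × Fin Q × Fin 3)
  obtain ⟨ε, hε, havg⟩ := exists_forall_setIntegral_zakShift_sub_zakAvg_le hF hV hC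
    (δ := δ / (N + 1)) (by positivity)
  refine ⟨zakAvg F ε, continuous_zakAvg hloc ε, hF.zakAvg ε, fun μ ν hμ hν z => ?_⟩
  set H := zakAvg F ε with hH
  have hp : ∀ᵐ w, (ZakBounded P Q F C κ w ∧ ZakBounded P Q F C κ (w - μ) ∧
      ZakBounded P Q F C κ (w - μ - ν)) ∧
      (∃ B : Matrix (Fin Q) (Fin Q) ℂ, zakMatrix P Q (zakShift μ F) w = zakMatrix P Q F w * B) ∧
      ∃ B : Matrix (Fin Q) (Fin Q) ℂ, zakMatrix P Q (zakShift ν F) (w - μ) = zakMatrix P Q F (w - μ) * B := by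
    filter_upwards [hb, ae_sub hb μ, ae_sub (ae_sub hb ν) μ, hμ, ae_sub hν μ] with w h1 h2 h3 h4 h5
    exact ⟨⟨h1, h2, h3⟩, h4, h5⟩
  obtain ⟨σ, ⟨⟨b1, b2, b3⟩, r1, r2⟩, hσ⟩ := exists_shift_near_zakAvg hloc hε havg
    (fun i : Fin P × Fin Q × Fin 3 => gridPoint P Q z i.1 i.2.1 - ![0, μ, μ + ν] i.2.2) hp z
  have hle : (N : ℝ) * (δ / (N + 1)) ≤ δ := by
    rw [mul_div_assoc', div_le_iff₀ (by positivity)]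
    nlinarith
  set G := zakShift (-σ) F with hG
  have hσ0 : z + σ = z - -σ := (sub_neg_eq_add _ _).symm
  have hσ1 : z + σ - μ = z - μ - -σ := by abel
  have hσ2 : z + σ - μ - ν = z - μ - ν - -σ := by abel
  rw [hσ0] at b1 r1
  rw [hσ1] at b2 r2
  rw [hσ2] at b3
  have hA1 : ZakBounded P Q G C κ z := b1.zakShift
  have hA2 : ZakBounded P Q (zakShift μ G) C κ z := b2.zakShift.zakShift
  have hA3 : ZakBounded P Q (zakShift μ (zakShift ν G)) C κ z := b3.zakShift.zakShift.zakShift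
  have hmem : ((fun k l => zakMatrix P Q G z k l, fun k l => zakMatrix P Q (zakShift μ G) z k l,
      fun k l => zakMatrix P Q (zakShift μ (zakShift ν G)) z k l) :
      (Fin P → Fin Q → ℂ) × (Fin P → Fin Q → ℂ) × (Fin P → Fin Q → ℂ)) ∈ goodTriples P Q C κ :=
    ⟨⟨hA1.1, hA2.1, hA3.1⟩, ⟨hA1.2, hA2.2, hA3.2⟩, exists_zakMatrix_zakShift_comm r1,
      exists_zakMatrix_zakShift (exists_zakMatrix_zakShift_comm r2)⟩
  have key := hnear _ hmem (fun k l => zakMatrix P Q H z k l,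
      fun k l => zakMatrix P Q (zakShift μ H) z k l,
      fun k l => zakMatrix P Q (zakShift μ (zakShift ν H)) z k l) ?_
  · have e1 := crossDet_zakShift_zakShift (P := P) (Q := Q) μ H H z
    have e2 := crossDet_zakShift_zakShift (P := P) (Q := Q) μ H (zakShift ν H) z
    rw [← e1, ← e2]
    exact key
  · have hent : ∀ (A A' : Fin P → Fin Q → ℂ), (∀ k l, ‖A k l - A' k l‖ ≤ N * (δ / (N + 1))) →
        dist A' A ≤ δ := by
      intro A A' h
      refine (dist_pi_le_iff hδ.le).2 fun k => (dist_pi_le_iff hδ.le).2 fun l => ?_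
      rw [dist_comm, dist_eq_norm]
      exact (h k l).trans hle
    rw [Prod.dist_eq, Prod.dist_eq]
    refine max_le (hent _ _ fun k l => ?_) (max_le (hent _ _ fun k l => ?_) (hent _ _ fun k l => ?_))
    · have := hσ (k, l, 0)
      simpa [-Fintype.card_prod, -Fintype.card_fin, zakMatrix, N, hH] using this
    · have := hσ (k, l, 1)
      simp only [zakMatrix, Matrix.of_apply, zakShift, ← mul_sub, norm_mul, norm_unitExp, one_mul]
      simpa [-Fintype.card_prod, -Fintype.card_fin, N, hG, hH, zakShift] using this
    · have := hσ (k, l, 2)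
      simp only [zakMatrix, Matrix.of_apply, zakShift, ← mul_sub, norm_mul, norm_unitExp, one_mul]
      simpa [-Fintype.card_prod, -Fintype.card_fin, N, hG, hH, zakShift, sub_sub] using this

end

/-! ### Recurrence modulo the lattice -/

section Lattice

variable {P Q : ℕ}

theorem separableLattice_sub {x y : ℝ × ℝ} (hx : x ∈ separableLattice P Q)
    (hy : y ∈ separableLattice P Q) : x - y ∈ separableLattice P Q := by
  obtain ⟨m, n, rfl⟩ := hx
  obtain ⟨m', n', rfl⟩ := hy
  refine ⟨m - m', n - n', ?_⟩
  ext <;> simp <;> ring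

/-- The residues of jν lie in a compact rectangle, so some subsequence of them is Cauchy; the
difference of two far-apart terms gives a large multiple. -/
theorem exists_nsmul_near_lattice (hP : 0 < P) (hQ : 0 < Q) (ν : ℝ × ℝ) {δ : ℝ} (hδ : 0 < δ)
    (k : ℕ) : ∃ N ≥ k, ∃ p ∈ separableLattice P Q, ‖N • ν - p‖ < δ := by
  have hP' : (0 : ℝ) < P := by positivity
  have hQ' : (0 : ℝ) < Q := by positivity
  set p : ℕ → ℝ × ℝ := fun j =>
    ((⌊(j : ℝ) * ν.1 * Q⌋ : ℝ) / Q, (⌊(j : ℝ) * ν.2 / P⌋ : ℝ) * P) with hp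
  have hmem : ∀ j : ℕ, j • ν - p j ∈ Icc (0 : ℝ) (1 / Q) ×ˢ Icc (0 : ℝ) P := by
    intro j
    have h1 := Int.floor_le ((j : ℝ) * ν.1 * Q)
    have h2 := (Int.lt_floor_add_one ((j : ℝ) * ν.1 * Q)).le
    have h3 := Int.floor_le ((j : ℝ) * ν.2 / P)
    have h4 := (Int.lt_floor_add_one ((j : ℝ) * ν.2 / P)).le
    simp only [hp, mem_prod, mem_Icc, Prod.fst_sub, Prod.snd_sub, Prod.smul_fst, Prod.smul_snd,
      sub_nonneg]
    rw [nsmul_eq_mul, nsmul_eq_mul]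
    refine ⟨⟨?_, ?_⟩, ?_, ?_⟩
    · rwa [div_le_iff₀ hQ']
    · rw [sub_le_iff_le_add, ← add_div, le_div_iff₀ hQ']
      linarith
    · rwa [le_div_iff₀ hP'] at h3
    · rw [div_le_iff₀ hP'] at h4
      linarith
  obtain ⟨a, -, φ, hφ, hlim⟩ := (isCompact_Icc.prod isCompact_Icc).tendsto_subseq hmem
  obtain ⟨n, hn⟩ := Metric.cauchySeq_iff'.1 hlim.cauchySeq δ hδ
  have h5 : k + φ n ≤ φ (n + k) := (hφ.add_le_nat k n).trans_eq (by rw [add_comm])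
  refine ⟨φ (n + k) - φ n, by omega, p (φ (n + k)) - p (φ n),
    separableLattice_sub ⟨_, _, rfl⟩ ⟨_, _, rfl⟩, ?_⟩
  have h6 := hn (n + k) (by omega)
  rw [dist_eq_norm] at h6
  have h7 : φ (n + k) • ν = (φ (n + k) - φ n) • ν + φ n • ν := by
    rw [← add_smul]; congr 1; omega
  have h8 : (φ (n + k) - φ n) • ν - (p (φ (n + k)) - p (φ n)) =
      (φ (n + k) • ν - p (φ (n + k))) - (φ n • ν - p (φ n)) := by
    rw [h7]; abel
  rw [h8]
  exact h6

end Lattice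

/-! ### The winding homomorphism and its rigidity -/

section Winding

variable {P Q : ℕ} {H : ℝ × ℝ → ℂ}

theorem zakShift_zero (H : ℝ × ℝ → ℂ) : zakShift 0 H = H := by
  funext z
  simp [zakShift, unitExp_zero]

theorem continuous_crossDet_zakShift (hH : Continuous H) :
    Continuous fun x : (ℝ × ℝ) × (ℝ × ℝ) => crossDet P Q H (zakShift x.1 H) x.2 := by
  have h1 : ∀ k l : ℕ, Continuous fun x : (ℝ × ℝ) × (ℝ × ℝ) => gridPoint P Q x.2 k l := by
    intro k l
    unfold gridPoint
    fun_prop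
  have h2 : Continuous fun x : (ℝ × ℝ) × (ℝ × ℝ) => zakMatrix P Q H x.2 :=
    continuous_matrix fun k l => hH.comp (h1 k l)
  have h3 : Continuous fun x : (ℝ × ℝ) × (ℝ × ℝ) => zakMatrix P Q (zakShift x.1 H) x.2 := by
    refine continuous_matrix fun k l => ?_
    simp only [zakMatrix, Matrix.of_apply, zakShift]
    have := h1 k l
    fun_prop
  exact (h2.matrix_conjTranspose.matrix_mul h3).matrix_det

theorem continuous_crossDet (hH : Continuous H) (μ : ℝ × ℝ) :
    Continuous (crossDet P Q H (zakShift μ H)) :=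
  (continuous_crossDet_zakShift (P := P) (Q := Q) hH).comp
    (f := fun z : ℝ × ℝ => (μ, z)) (by fun_prop)

theorem crossDet_add_int (hP : 0 < P) (hQ : 0 < Q) (hPQ : Nat.Coprime P Q) {F G : ℝ × ℝ → ℂ}
    (hF : QuasiPeriodic F) (hG : QuasiPeriodic G) (z : ℝ × ℝ) (m n : ℤ) :
    crossDet P Q F G (z + ((m : ℝ), (n : ℝ))) = crossDet P Q F G z := by
  have h1 : Function.Periodic (crossDet P Q F G) (1 / ((P : ℝ) * Q), 0) :=
    crossDet_add_fst hF hG hP hQ hPQ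
  have h2 : Function.Periodic (crossDet P Q F G) (0, 1) := crossDet_add_snd hF hG
  rw [← (h1.zsmul (m * P * Q)).add_period (h2.zsmul n) z]
  congr 2
  have hP' : (P : ℝ) ≠ 0 := by positivity
  have hQ' : (Q : ℝ) ≠ 0 := by positivity
  ext
  · simp
    field_simp
  · simp

/-- Joint continuity in (μ, z) gives uniformity over the compact unit square, and periodicity
extends it to the plane. -/
theorem eventually_crossDet_near (hP : 0 < P) (hQ : 0 < Q) (hPQ : Nat.Coprime P Q)
    (hc : Continuous H) (hH : QuasiPeriodic H) (h0 : ∀ z, crossDet P Q H H z ≠ 0) :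
    ∀ᶠ μ in 𝓝 (0 : ℝ × ℝ), ∀ z,
      ‖crossDet P Q H (zakShift μ H) z - crossDet P Q H H z‖ < ‖crossDet P Q H H z‖ := by
  have hK : IsCompact (Icc (0 : ℝ) 1 ×ˢ Icc (0 : ℝ) 1) := isCompact_Icc.prod isCompact_Icc
  have hc1 := continuous_crossDet_zakShift (P := P) (Q := Q) hc
  have hc2 : Continuous (crossDet P Q H H) := by
    simpa only [zakShift_zero] using continuous_crossDet (P := P) (Q := Q) hc 0
  have hev := hK.eventually_forall_of_forall_eventually (x₀ := (0 : ℝ × ℝ))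
    (P := fun μ z =>
      ‖crossDet P Q H (zakShift μ H) z - crossDet P Q H H z‖ < ‖crossDet P Q H H z‖)
    (fun z _ => by
      refine (isOpen_lt (hc1.sub (hc2.comp continuous_snd)).norm
        (hc2.comp continuous_snd).norm).mem_nhds ?_
      simpa [zakShift_zero] using h0 z)
  filter_upwards [hev] with μ hμ z
  have hz : z = (Int.fract z.1, Int.fract z.2) + ((⌊z.1⌋ : ℝ), (⌊z.2⌋ : ℝ)) := by
    ext <;> simp
  have := hμ (Int.fract z.1, Int.fract z.2) ⟨⟨Int.fract_nonneg _, (Int.fract_lt_one _).le⟩,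
    Int.fract_nonneg _, (Int.fract_lt_one _).le⟩
  rw [hz, crossDet_add_int hP hQ hPQ hH (hH.zakShift μ), crossDet_add_int hP hQ hPQ hH hH]
  exact this

theorem hasWinding_unitExp (a : ℝ × ℝ) (p : ℝ × ℝ) (k : ℤ) (h : a.1 * p.1 + a.2 * p.2 = k) :
    HasWinding (fun z => unitExp (a.1 * z.1 + a.2 * z.2)) p k := by
  refine HasWinding.of_exp (ℓ := fun z => 2 * Real.pi * Complex.I *
    ((a.1 * z.1 + a.2 * z.2 : ℝ) : ℂ)) (by fun_prop) fun z => ?_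
  have : a.1 * (z + p).1 + a.2 * (z + p).2 = (a.1 * z.1 + a.2 * z.2) + k := by
    rw [← h, Prod.fst_add, Prod.snd_add]; ring
  simp only [this]
  push_cast
  ring

/-- The hypothesis is the one `HasWinding.perturb` needs to equate the windings of the two products.
Translating the argument by μ does not change a winding number, and subtracting the winding of d_0
normalises. -/
theorem exists_windingHom (Γ : AddSubmonoid (ℝ × ℝ)) (hc : Continuous H) (hH : QuasiPeriodic H)
    (hlt : ∀ μ ∈ Γ, ∀ ν ∈ Γ, ∀ z,
      ‖crossDet P Q H (zakShift μ (zakShift ν H)) z * crossDet P Q H H (z - μ) -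
        crossDet P Q H (zakShift μ H) z * crossDet P Q H (zakShift ν H) (z - μ)‖ <
      ‖crossDet P Q H (zakShift μ H) z * crossDet P Q H (zakShift ν H) (z - μ)‖)
    {p : ℝ × ℝ} (hp : ∀ F G, QuasiPeriodic F → QuasiPeriodic G → ∀ z,
      crossDet P Q F G (z + p) = crossDet P Q F G z) :
    ∃ (w : Γ →+ ℤ) (w₀ : ℤ), ∀ μ : Γ, HasWinding (crossDet P Q H (zakShift μ H)) p (w μ + w₀) := by
  -- A zero would make the right side of the strict inequality vanish.
  have hne : ∀ μ ∈ Γ, ∀ z, crossDet P Q H (zakShift μ H) z ≠ 0 := by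
    intro μ hμ z h
    have := hlt μ hμ 0 Γ.zero_mem z
    rw [h, zero_mul, norm_zero] at this
    exact absurd this (norm_nonneg _).not_gt
  have hex : ∀ μ : Γ, ∃ k, HasWinding (crossDet P Q H (zakShift μ H)) p k := fun μ =>
    exists_hasWinding (continuous_crossDet hc μ) (hne μ μ.2) (hp _ _ hH (hH.zakShift μ))
  choose w hw using hex
  have hw0 : HasWinding (crossDet P Q H H) p (w 0) := by
    have := hw 0
    rwa [AddSubmonoid.coe_zero, zakShift_zero] at this
  have hper : ∀ μ ν : ℝ × ℝ, ∀ z,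
      crossDet P Q H (zakShift ν H) (z + p - μ) = crossDet P Q H (zakShift ν H) (z - μ) := by
    intro μ ν z
    rw [add_sub_right_comm, hp _ _ hH (hH.zakShift ν)]
  have hadd : ∀ μ ν : Γ, w (μ + ν) + w 0 = w μ + w ν := by
    intro μ ν
    have h1 := (hw μ).mul ((hw ν).comp_sub μ)
    have hcomp : zakShift (μ : ℝ × ℝ) (zakShift ν H) = fun z =>
        unitExp (-((ν : ℝ × ℝ).2 * (μ : ℝ × ℝ).1)) * zakShift ((μ + ν : Γ) : ℝ × ℝ) H z :=
      funext fun z => zakShift_zakShift _ _ _ _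
    have h2 : HasWinding (fun z => crossDet P Q H (zakShift μ (zakShift ν H)) z *
        crossDet P Q H H (z - μ)) p (w (μ + ν) + w 0) := by
      have h3 := ((HasWinding.const (pow_ne_zero Q (unitExp_ne_zero
        (-((ν : ℝ × ℝ).2 * (μ : ℝ × ℝ).1)))) p).mul (hw (μ + ν))).mul (hw0.comp_sub μ)
      rw [zero_add] at h3
      simpa only [hcomp, crossDet_const_mul_right] using h3
    refine h2.unique (h1.perturb (fun z => ?_) ?_ (fun z => ?_) (hlt μ μ.2 ν ν.2))
    · rw [hper, hp _ _ hH (hH.zakShift μ)]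
    · simp only [hcomp, crossDet_const_mul_right]
      have c1 := continuous_crossDet (P := P) (Q := Q) hc ((μ + ν : Γ) : ℝ × ℝ)
      have c2 := continuous_crossDet (P := P) (Q := Q) hc 0
      rw [zakShift_zero] at c2
      fun_prop
    · have := hper μ 0 z
      rw [zakShift_zero] at this
      rw [this, hp _ _ hH ((hH.zakShift ν).zakShift μ)]
  refine ⟨AddMonoidHom.mk' (fun μ => w μ - w 0) ?_, w 0, fun μ => ?_⟩
  · intro μ ν
    have := hadd μ ν
    omega
  · simpa using hw μ

theorem mem_separableLattice_of_crossDet (hP : 0 < P) (hQ : 0 < Q) (hPQ : Nat.Coprime P Q)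
    (Γ : AddSubmonoid (ℝ × ℝ)) (hΓ : separableLattice P Q ⊆ Γ)
    (hc : Continuous H) (hH : QuasiPeriodic H)
    (hlt : ∀ μ ∈ Γ, ∀ ν ∈ Γ, ∀ z,
      ‖crossDet P Q H (zakShift μ (zakShift ν H)) z * crossDet P Q H H (z - μ) -
        crossDet P Q H (zakShift μ H) z * crossDet P Q H (zakShift ν H) (z - μ)‖ <
      ‖crossDet P Q H (zakShift μ H) z * crossDet P Q H (zakShift ν H) (z - μ)‖)
    {μ : ℝ × ℝ} (hμ : μ ∈ Γ) : μ ∈ separableLattice P Q := by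
  have hP' : (P : ℝ) ≠ 0 := by positivity
  have hQ' : (Q : ℝ) ≠ 0 := by positivity
  have hp1 : ∀ F G, QuasiPeriodic F → QuasiPeriodic G → ∀ z,
      crossDet P Q F G (z + (1 / ((P : ℝ) * Q), 0)) = crossDet P Q F G z :=
    fun F G hF hG => crossDet_add_fst hF hG hP hQ hPQ
  have hp2 : ∀ F G, QuasiPeriodic F → QuasiPeriodic G → ∀ z,
      crossDet P Q F G (z + (0, 1)) = crossDet P Q F G z :=
    fun F G hF hG => crossDet_add_snd hF hG
  obtain ⟨w₁, k₁, hw₁⟩ := exists_windingHom Γ hc hH hlt hp1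
  obtain ⟨w₂, k₂, hw₂⟩ := exists_windingHom Γ hc hH hlt hp2
  have h0₁ : HasWinding (crossDet P Q H H) (1 / ((P : ℝ) * Q), 0) k₁ := by
    simpa [zakShift_zero] using hw₁ 0
  have h0₂ : HasWinding (crossDet P Q H H) (0, 1) k₂ := by
    simpa [zakShift_zero] using hw₂ 0
  have hlat : ∀ m n : ℤ, ((m : ℝ) / Q, (n : ℝ) * P) ∈ Γ := fun m n => hΓ ⟨m, n, rfl⟩
  let ι : ℤ × ℤ →+ Γ :=
    { toFun := fun x => ⟨_, hlat x.1 x.2⟩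
      map_zero' := by ext <;> simp
      map_add' := fun x y => by ext <;> simp <;> ring }
  have hι : ∀ (v : Γ →+ ℤ) (m n : ℤ), v (ι (m, n)) = m * v (ι (1, 0)) + n * v (ι (0, 1)) := by
    intro v m n
    have : ((m, n) : ℤ × ℤ) = m • (1, 0) + n • (0, 1) := by ext <;> simp
    change (v.comp ι) (m, n) = m * (v.comp ι) (1, 0) + n * (v.comp ι) (0, 1)
    rw [this, map_add, map_zsmul, map_zsmul, smul_eq_mul, smul_eq_mul]
  obtain ⟨c₁, hc₁, e₁⟩ := exists_crossDet_zakShift_time (Q := Q) P hQ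
  obtain ⟨c₂, hc₂, e₂⟩ := exists_crossDet_zakShift_freq hP Q
  have hι1 : ((ι (1, 0) : Γ) : ℝ × ℝ) = (1 / (Q : ℝ), 0) := by
    ext <;> simp [ι]
  have hι2 : ((ι (0, 1) : Γ) : ℝ × ℝ) = (0, (P : ℝ)) := by
    ext <;> simp [ι]
  have f₁ : crossDet P Q H (zakShift (ι (1, 0) : Γ) H) =
      fun z => c₁ * unitExp ((0, (-1 : ℝ)).1 * z.1 + (0, (-1 : ℝ)).2 * z.2) *
        crossDet P Q H H z := by
    funext z
    rw [hι1, e₁ H hH]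
    simp
  have f₂ : crossDet P Q H (zakShift (ι (0, 1) : Γ) H) =
      fun z => c₂ * unitExp (((P : ℝ) * Q, (0 : ℝ)).1 * z.1 + ((P : ℝ) * Q, (0 : ℝ)).2 * z.2) *
        crossDet P Q H H z := by
    funext z
    rw [hι2, e₂ H hH]
    simp
  have a₁ : w₁ (ι (1, 0)) = 0 := by
    have h := ((HasWinding.const hc₁ _).mul (hasWinding_unitExp (0, -1) (1 / ((P : ℝ) * Q), 0) 0
      (by simp))).mul h0₁
    rw [← f₁] at h
    have := h.unique (hw₁ _)
    omega
  have a₂ : w₂ (ι (1, 0)) = -1 := by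
    have h := ((HasWinding.const hc₁ _).mul (hasWinding_unitExp (0, -1) (0, 1) (-1)
      (by simp))).mul h0₂
    rw [← f₁] at h
    have := h.unique (hw₂ _)
    omega
  have b₁ : w₁ (ι (0, 1)) = 1 := by
    have h := ((HasWinding.const hc₂ _).mul (hasWinding_unitExp ((P : ℝ) * Q, 0)
      (1 / ((P : ℝ) * Q), 0) 1 (by simp; field_simp))).mul h0₁
    rw [← f₂] at h
    have := h.unique (hw₁ _)
    omega
  have b₂ : w₂ (ι (0, 1)) = 0 := by
    have h := ((HasWinding.const hc₂ _).mul (hasWinding_unitExp ((P : ℝ) * Q, 0) (0, 1) 0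
      (by simp))).mul h0₂
    rw [← f₂] at h
    have := h.unique (hw₂ _)
    omega
  have v₁ : ∀ m n : ℤ, w₁ (ι (m, n)) = n := fun m n => by rw [hι, a₁, b₁]; ring
  have v₂ : ∀ m n : ℤ, w₂ (ι (m, n)) = -m := fun m n => by rw [hι, a₂, b₂]; ring
  have hne : ∀ z, crossDet P Q H H z ≠ 0 := by
    intro z h
    have := hlt 0 Γ.zero_mem 0 Γ.zero_mem z
    simp only [zakShift_zero, sub_zero, h, zero_mul, norm_zero] at this
    exact lt_irrefl 0 this
  obtain ⟨δ, hδ, hnear⟩ := Metric.eventually_nhds_iff.1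
    (eventually_crossDet_near hP hQ hPQ hc hH hne)
  -- Near 0 the determinant is a small perturbation of d_0, hence has the same windings.
  have small : ∀ ξ : Γ, ‖(ξ : ℝ × ℝ)‖ < δ → w₁ ξ = 0 ∧ w₂ ξ = 0 := by
    intro ξ hξ
    have hlt' := hnear (y := (ξ : ℝ × ℝ)) (by rwa [dist_zero_right])
    have s₁ := (h0₁.perturb (hp1 _ _ hH hH) (continuous_crossDet hc ξ)
      (hp1 _ _ hH (hH.zakShift ξ)) hlt').unique (hw₁ ξ)
    have s₂ := (h0₂.perturb (hp2 _ _ hH hH) (continuous_crossDet hc ξ)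
      (hp2 _ _ hH (hH.zakShift ξ)) hlt').unique (hw₂ ξ)
    exact ⟨by omega, by omega⟩
  set m : ℤ := w₂ ⟨μ, hμ⟩
  set n : ℤ := w₁ ⟨μ, hμ⟩
  -- Γ is only a monoid, but it contains the whole lattice, so the windings of μ can be cancelled by
  -- adding a lattice element.
  set ν : Γ := ⟨μ, hμ⟩ + ι (m, -n) with hν
  have hν₁ : w₁ ν = 0 := by rw [hν, map_add, v₁]; omega
  have hν₂ : w₂ ν = 0 := by rw [hν, map_add, v₂]; omega
  -- The small element Nν - q has windings (-j, i), where q = (i/Q, jP). They must vanish, so q = 0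
  -- and Nν itself is small.
  have hle : ∀ k : ℕ, (k : ℝ) * ‖(ν : ℝ × ℝ)‖ ≤ δ := by
    intro k
    obtain ⟨N, hN, q, hq, hlt'⟩ := exists_nsmul_near_lattice hP hQ (ν : ℝ × ℝ) hδ k
    obtain ⟨i, j, rfl⟩ := hq
    have hcoe : ((N • ν + ι (-i, -j) : Γ) : ℝ × ℝ) =
        N • (ν : ℝ × ℝ) - ((i : ℝ) / Q, (j : ℝ) * P) := by
      ext <;> simp [ι] <;> ring
    have hs := small (N • ν + ι (-i, -j)) (by rwa [hcoe])
    rw [map_add, map_add, map_nsmul, map_nsmul, hν₁, hν₂, v₁, v₂] at hs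
    have hi : i = 0 := by simpa using hs.2
    have hj : j = 0 := by simpa using hs.1
    subst hi hj
    have h0 : (((0 : ℤ) : ℝ) / Q, ((0 : ℤ) : ℝ) * P) = (0 : ℝ × ℝ) := by simp
    rw [h0, sub_zero, ← Nat.cast_smul_eq_nsmul ℝ, norm_smul, Real.norm_natCast] at hlt'
    have : (k : ℝ) ≤ N := by exact_mod_cast hN
    nlinarith [norm_nonneg (ν : ℝ × ℝ)]
  have hν0 : (ν : ℝ × ℝ) = 0 := by
    by_contra h
    have hpos := norm_pos_iff.2 h
    obtain ⟨k, hk⟩ := exists_nat_gt (δ / ‖(ν : ℝ × ℝ)‖)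
    rw [div_lt_iff₀ hpos] at hk
    linarith [hle k]
  refine ⟨-m, n, ?_⟩
  have : (ν : ℝ × ℝ) = μ + ((m : ℝ) / Q, ((-n : ℤ) : ℝ) * P) := rfl
  rw [hν0] at this
  rw [eq_neg_of_add_eq_zero_left this.symm]
  ext <;> simp
  ring

end Winding

/-! ### The Zak transform: quasi-periodicity, isometry, intertwining of shifts -/

theorem zakChar_eq_unitExp (k : ℤ) (ω : ℝ) : zakChar k ω = unitExp (-(k * ω)) := by
  rw [zakChar, unitExp]
  congr 1
  push_cast
  ring

theorem zak_apply (f : Lp ℂ 2 (volume : Measure ℝ)) (p : ℝ × ℝ) :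
    zak f p = unitExp (⌊p.1⌋ * p.2) * zakSquare f (Int.fract p.1, Int.fract p.2) := by
  rw [zak, unitExp]
  congr 2
  push_cast
  ring

theorem quasiPeriodic_zak (f : Lp ℂ 2 (volume : Measure ℝ)) : QuasiPeriodic (zak f) := by
  intro z m n
  rw [zak_apply, zak_apply, ← mul_assoc, ← unitExp_add]
  simp only [Prod.fst_add, Prod.snd_add, Int.fract_add_intCast, Int.floor_add_intCast]
  congr 1
  have : ((⌊z.1⌋ + m : ℤ) : ℝ) * (z.2 + n) =
      (m * z.2 + ⌊z.1⌋ * z.2) + ((⌊z.1⌋ + m) * n : ℤ) := by push_cast; ring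
  rw [this, unitExp_add_int]

theorem measurable_zak (f : Lp ℂ 2 (volume : Measure ℝ)) : Measurable (zak f) := by
  have h : zak f = fun p : ℝ × ℝ =>
      unitExp (⌊p.1⌋ * p.2) * zakSquare f (Int.fract p.1, Int.fract p.2) := funext (zak_apply f)
  rw [h]
  have h1 : Measurable (zakSquare f) := (Lp.stronglyMeasurable _).measurable
  have h2 : Measurable fun p : ℝ × ℝ => ((⌊p.1⌋ : ℤ) : ℝ) :=
    (measurable_from_top (f := fun n : ℤ => (n : ℝ))).comp (Int.measurable_floor.comp measurable_fst)
  refine (continuous_unitExp.measurable.comp (h2.mul measurable_snd)).mul (h1.comp ?_)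
  exact (measurable_fract.comp measurable_fst).prodMk (measurable_fract.comp measurable_snd)

theorem measurableSet_unitSquare : MeasurableSet unitSquare :=
  measurableSet_Icc.prod measurableSet_Icc

theorem ae_fract_of_ae_unitSquare {p : ℝ × ℝ → Prop}
    (h : ∀ᵐ z ∂(volume.restrict unitSquare), p z) : ∀ᵐ z : ℝ × ℝ, p (Int.fract z.1, Int.fract z.2) := by
  rw [ae_restrict_iff' measurableSet_unitSquare] at h
  have h1 : ∀ᵐ z : ℝ × ℝ, ∀ x : ℤ × ℤ, z - ((x.1 : ℝ), (x.2 : ℝ)) ∈ unitSquare →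
      p (z - ((x.1 : ℝ), (x.2 : ℝ))) := ae_all_iff.2 fun x => ae_sub h _
  filter_upwards [h1] with z hz
  refine hz (⌊z.1⌋, ⌊z.2⌋) ⟨⟨Int.fract_nonneg _, (Int.fract_lt_one _).le⟩,
    Int.fract_nonneg _, (Int.fract_lt_one _).le⟩

theorem ae_of_ae_unitSquare {p : ℝ × ℝ → Prop}
    (h : ∀ᵐ z ∂(volume.restrict unitSquare), p z)
    (hp : ∀ (z : ℝ × ℝ) (m n : ℤ), p z → p (z + ((m : ℝ), (n : ℝ)))) : ∀ᵐ z : ℝ × ℝ, p z := by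
  filter_upwards [ae_fract_of_ae_unitSquare h] with z hz
  have := hp _ ⌊z.1⌋ ⌊z.2⌋ hz
  convert this using 1
  ext <;> simp

theorem zak_ae_eq_zakSquare (f : Lp ℂ 2 (volume : Measure ℝ)) :
    ∀ᵐ z ∂(volume.restrict unitSquare), zak f z = zakSquare f z := by
  rw [ae_restrict_iff' measurableSet_unitSquare]
  filter_upwards [ae_fst_ne 1, ae_snd_ne 1] with z h1 h2 hz
  have e1 : Int.fract z.1 = z.1 := Int.fract_eq_self.2 ⟨hz.1.1, lt_of_le_of_ne hz.1.2 h1⟩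
  have e2 : Int.fract z.2 = z.2 := Int.fract_eq_self.2 ⟨hz.2.1, lt_of_le_of_ne hz.2.2 h2⟩
  have e3 : ⌊z.1⌋ = 0 := Int.floor_eq_zero_iff.2 ⟨hz.1.1, lt_of_le_of_ne hz.1.2 h1⟩
  rw [zak_apply, e1, e2, e3]
  simp [unitExp_zero]

theorem ae_fst_add {p : ℝ → Prop} (h : ∀ᵐ x, p x) (a : ℝ) : ∀ᵐ z : ℝ × ℝ, p (z.1 + a) :=
  Measure.quasiMeasurePreserving_fst.ae
    ((measurePreserving_add_right volume a).quasiMeasurePreserving.ae h)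

theorem zakTerm_add (f g : Lp ℂ 2 (volume : Measure ℝ)) (k : ℤ) :
    zakTerm (f + g) k = zakTerm f k + zakTerm g k := by
  apply Lp.ext
  filter_upwards [(memLp_zakTerm (f + g) k).coeFn_toLp, (memLp_zakTerm f k).coeFn_toLp,
    (memLp_zakTerm g k).coeFn_toLp, Lp.coeFn_add (zakTerm f k) (zakTerm g k),
    ae_restrict_of_ae (ae_fst_add (Lp.coeFn_add f g) k)] with z h1 h2 h3 h4 h5
  rw [h4, Pi.add_apply, zakTerm, zakTerm, zakTerm, h1, h2, h3, h5, Pi.add_apply, add_mul]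

theorem zakTerm_smul (c : ℂ) (f : Lp ℂ 2 (volume : Measure ℝ)) (k : ℤ) :
    zakTerm (c • f) k = c • zakTerm f k := by
  apply Lp.ext
  filter_upwards [(memLp_zakTerm (c • f) k).coeFn_toLp, (memLp_zakTerm f k).coeFn_toLp,
    Lp.coeFn_smul c (zakTerm f k),
    ae_restrict_of_ae (ae_fst_add (Lp.coeFn_smul c f) k)] with z h1 h2 h4 h5
  rw [h4, Pi.smul_apply, zakTerm, zakTerm, h1, h2, h5, Pi.smul_apply, smul_eq_mul, smul_eq_mul,
    mul_assoc]

/-- Parseval: the terms of the series are orthogonal, and their squared norms are the integrals of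
|f|² over consecutive unit intervals. -/
theorem norm_zakSquare (f : Lp ℂ 2 (volume : Measure ℝ)) : ‖zakSquare f‖ = ‖f‖ := by
  have hint : Integrable (fun x : ℝ => ‖f x‖ ^ 2) volume :=
    (memLp_two_iff_integrable_sq_norm (Lp.memLp f).1).1 (Lp.memLp f)
  have h1 : HasSum (fun k : ℤ => ‖zakTerm f k‖ ^ 2) (‖f‖ ^ 2) := by
    have h2 := hint.hasSum_intervalIntegral_comp_add_int
    have h3 : ∫ x, ‖f x‖ ^ 2 = ‖f‖ ^ 2 := by
      have h4 := L2.inner_def (𝕜 := ℂ) f f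
      rw [inner_self_eq_norm_sq_to_K] at h4
      have h5 : ∀ x, inner ℂ (f x) (f x) = ((‖f x‖ ^ 2 : ℝ) : ℂ) := fun x => by
        rw [inner_self_eq_norm_sq_to_K]; simp
      simp only [h5] at h4
      rw [integral_complex_ofReal] at h4
      exact (Complex.ofReal_injective (by push_cast; exact h4)).symm
    rw [h3] at h2
    simpa only [norm_sq_zakTerm] using h2
  have h2 : Tendsto (fun s : Finset ℤ => ‖∑ k ∈ s, zakTerm f k‖ ^ 2) atTop
      (𝓝 (‖zakSquare f‖ ^ 2)) :=
    ((summable_zakTerm f).hasSum.norm).pow 2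
  have h3 : ∀ s : Finset ℤ, ‖∑ k ∈ s, zakTerm f k‖ ^ 2 = ∑ k ∈ s, ‖zakTerm f k‖ ^ 2 := by
    intro s
    have h4 : ((‖∑ k ∈ s, zakTerm f k‖ ^ 2 : ℝ) : ℂ) = ((∑ k ∈ s, ‖zakTerm f k‖ ^ 2 : ℝ) : ℂ) := by
      have h5 := inner_self_eq_norm_sq_to_K (𝕜 := ℂ) (∑ k ∈ s, zakTerm f k)
      push_cast
      refine h5.symm.trans ?_
      rw [sum_inner]
      refine Finset.sum_congr rfl fun j hj => ?_
      rw [inner_sum, Finset.sum_eq_single j]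
      · exact inner_self_eq_norm_sq_to_K (zakTerm f j)
      · intro k _ hk
        exact inner_zakTerm f hk.symm
      · exact fun h => absurd hj h
    exact Complex.ofReal_injective h4
  simp only [h3] at h2
  have h4 := tendsto_nhds_unique h2 h1
  exact (sq_eq_sq₀ (norm_nonneg _) (norm_nonneg _)).1 h4

/-- The Zak transform as a linear isometry `L²(ℝ) → L²([0,1]²)`. -/
noncomputable def zakIsometry :
    Lp ℂ 2 (volume : Measure ℝ) →ₗᵢ[ℂ] Lp ℂ 2 ((volume : Measure (ℝ × ℝ)).restrict unitSquare) where
  toFun := zakSquare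
  map_add' f g := by
    unfold zakSquare
    rw [← (summable_zakTerm f).tsum_add (summable_zakTerm g)]
    exact tsum_congr fun k => zakTerm_add f g k
  map_smul' c f := by
    unfold zakSquare
    rw [RingHom.id_apply, ← (summable_zakTerm f).tsum_const_smul c]
    exact tsum_congr fun k => zakTerm_smul c f k
  norm_map' := norm_zakSquare

theorem zak_add (f g : Lp ℂ 2 (volume : Measure ℝ)) :
    ∀ᵐ z : ℝ × ℝ, zak (f + g) z = zak f z + zak g z := by
  have h := Lp.coeFn_add (zakSquare f) (zakSquare g)
  rw [← show zakSquare (f + g) = zakSquare f + zakSquare g from zakIsometry.map_add f g] at h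
  filter_upwards [ae_fract_of_ae_unitSquare h] with z hz
  rw [zak_apply, zak_apply, zak_apply, hz, Pi.add_apply, mul_add]

theorem zak_smul (c : ℂ) (f : Lp ℂ 2 (volume : Measure ℝ)) :
    ∀ᵐ z : ℝ × ℝ, zak (c • f) z = c * zak f z := by
  have h := Lp.coeFn_smul c (zakSquare f)
  rw [← show zakSquare (c • f) = c • zakSquare f from zakIsometry.map_smul c f] at h
  filter_upwards [ae_fract_of_ae_unitSquare h] with z hz
  rw [zak_apply, zak_apply, hz, Pi.smul_apply, smul_eq_mul, mul_left_comm]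

theorem zak_zero : ∀ᵐ z : ℝ × ℝ, zak 0 z = 0 := by
  filter_upwards [zak_smul 0 0] with z hz
  rwa [zero_smul, zero_mul] at hz

theorem zak_sum {ι : Type*} (s : Finset ι) (c : ι → ℂ) (f : ι → Lp ℂ 2 (volume : Measure ℝ)) :
    ∀ᵐ z : ℝ × ℝ, zak (∑ i ∈ s, c i • f i) z = ∑ i ∈ s, c i * zak (f i) z := by
  classical
  induction s using Finset.induction_on with
  | empty => simpa using zak_zero
  | insert i s hi ih =>
    filter_upwards [ih, zak_add (c i • f i) (∑ i ∈ s, c i • f i), zak_smul (c i) (f i)]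
      with z h1 h2 h3
    rw [Finset.sum_insert hi, Finset.sum_insert hi, h2, h1, h3]

/-- Partial sums of the Zak series. -/
noncomputable def zakSum (s : Finset ℤ) (f : Lp ℂ 2 (volume : Measure ℝ)) (z : ℝ × ℝ) : ℂ :=
  ∑ k ∈ s, f (z.1 + k) * zakChar k z.2

theorem measurable_zakSum (s : Finset ℤ) (f : Lp ℂ 2 (volume : Measure ℝ)) :
    Measurable (zakSum s f) := by
  have h1 : Measurable f := (Lp.stronglyMeasurable f).measurable
  refine Finset.measurable_sum _ fun k _ => (h1.comp (measurable_fst.add_const _)).mul ?_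
  exact (continuous_zakChar k).measurable.comp measurable_snd

/-- The squared error of the partial sums of the Zak series. -/
noncomputable def zakError (s : Finset ℤ) (f : Lp ℂ 2 (volume : Measure ℝ)) (z : ℝ × ℝ) : ℝ≥0∞ :=
  ‖zakSum s f z - zak f z‖ₑ ^ 2

theorem measurable_zakError (s : Finset ℤ) (f : Lp ℂ 2 (volume : Measure ℝ)) :
    Measurable (zakError s f) :=
  ((measurable_zakSum s f).sub (measurable_zak f)).enorm.pow_const 2

theorem tendsto_lintegral_zakError (f : Lp ℂ 2 (volume : Measure ℝ)) :
    Tendsto (fun s => ∫⁻ z in unitSquare, zakError s f z) atTop (𝓝 0) := by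
  have h1 : Tendsto (fun s : Finset ℤ => ‖∑ k ∈ s, zakTerm f k - zakSquare f‖ₑ ^ 2) atTop (𝓝 0) := by
    have h2 : Tendsto (fun s : Finset ℤ => ∑ k ∈ s, zakTerm f k) atTop (𝓝 (zakSquare f)) :=
      (summable_zakTerm f).hasSum
    have h3 := (h2.sub_const (zakSquare f)).enorm
    rw [sub_self, enorm_zero] at h3
    simpa using ENNReal.Tendsto.pow (n := 2) h3
  refine h1.congr fun s => ?_
  have h4 : (fun z => zakSum s f z - zak f z) =ᵐ[volume.restrict unitSquare]
      (∑ k ∈ s, zakTerm f k - zakSquare f : Lp ℂ 2 (volume.restrict unitSquare)) := by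
    have h5 : ∀ᵐ z ∂(volume.restrict unitSquare), ∀ k : ℤ,
        zakTerm f k z = f (z.1 + k) * zakChar k z.2 :=
      ae_all_iff.2 fun k => (memLp_zakTerm f k).coeFn_toLp
    have h6 : ((∑ k ∈ s, zakTerm f k : Lp ℂ 2 (volume.restrict unitSquare)) : ℝ × ℝ → ℂ)
        =ᵐ[volume.restrict unitSquare] fun z => ∑ k ∈ s, zakTerm f k z := by
      exact Lp.coeFn_fun_finsetSum s _
    filter_upwards [h5, h6, Lp.coeFn_sub (∑ k ∈ s, zakTerm f k) (zakSquare f),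
      zak_ae_eq_zakSquare f] with z a1 a2 a3 a4
    rw [a3, Pi.sub_apply, a2, a4, zakSum]
    simp only [a1]
  rw [Lp.enorm_def, ← eLpNorm_congr_ae h4, eLpNorm_eq_lintegral_rpow_enorm_toReal (by norm_num) (by norm_num)]
  simp only [ENNReal.toReal_ofNat, one_div, zakError]
  rw [← ENNReal.rpow_natCast, ← ENNReal.rpow_mul]
  norm_num

theorem zakSum_add_int (s : Finset ℤ) (f : Lp ℂ 2 (volume : Measure ℝ)) (z : ℝ × ℝ) (m n : ℤ) :
    zakSum s f (z + ((m : ℝ), (n : ℝ))) =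
      unitExp (m * z.2) * zakSum (s.map (Equiv.addLeft m).toEmbedding) f z := by
  rw [zakSum, zakSum, Finset.sum_map, Finset.mul_sum]
  refine Finset.sum_congr rfl fun k _ => ?_
  have h1 : (z + ((m : ℝ), (n : ℝ))).1 + k = z.1 + ((m + k : ℤ) : ℝ) := by
    push_cast; simp; ring
  rw [h1]
  change _ = unitExp (m * z.2) * (f (z.1 + ((m + k : ℤ) : ℝ)) * zakChar (m + k) z.2)
  rw [mul_left_comm, zakChar_eq_unitExp, zakChar_eq_unitExp, ← unitExp_add]
  congr 1
  have h2 : (-(k * (z + ((m : ℝ), (n : ℝ))).2) : ℝ) =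
      (m * z.2 + -(((m + k : ℤ) : ℝ) * z.2)) + (-(k * n) : ℤ) := by
    push_cast; simp; ring
  rw [h2, unitExp_add_int]

theorem zakError_add_int (s : Finset ℤ) (f : Lp ℂ 2 (volume : Measure ℝ)) (z : ℝ × ℝ) (m n : ℤ) :
    zakError s f (z + ((m : ℝ), (n : ℝ))) = zakError (s.map (Equiv.addLeft m).toEmbedding) f z := by
  rw [zakError, zakError, zakSum_add_int, quasiPeriodic_zak f, ← mul_sub, enorm_mul]
  have : ‖unitExp (m * z.2)‖ₑ = 1 := by rw [← ofReal_norm, norm_unitExp, ENNReal.ofReal_one]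
  rw [this, one_mul]

/-- The translated square meets finitely many integer cells. Moving a cell back to the unit square
only translates the index set of the partial sum, and such translations preserve `atTop`. -/
theorem tendsto_lintegral_zakError_sub (f : Lp ℂ 2 (volume : Measure ℝ)) (μ : ℝ × ℝ) :
    Tendsto (fun s => ∫⁻ z in unitSquare, zakError s f (z - μ)) atTop (𝓝 0) := by
  have hsq := measurableSet_unitSquare
  set T : Finset (ℤ × ℤ) := Finset.Icc ⌊-μ.1⌋ ⌊1 - μ.1⌋ ×ˢ Finset.Icc ⌊-μ.2⌋ ⌊1 - μ.2⌋
  have hshift : ∀ m : ℤ, Tendsto (fun s : Finset ℤ => s.map (Equiv.addLeft m).toEmbedding)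
      atTop atTop := by
    intro m
    refine tendsto_atTop_atTop_of_monotone (fun s t h => Finset.map_subset_map.2 h) fun t => ?_
    refine ⟨t.map (Equiv.addLeft (-m)).toEmbedding, fun k hk => ?_⟩
    simp only [Finset.mem_map, Equiv.coe_toEmbedding, Equiv.coe_addLeft, exists_exists_and_eq_and]
    exact ⟨k, hk, by ring⟩
  have hle : ∀ s, ∫⁻ z in unitSquare, zakError s f (z - μ) ≤
      ∑ x ∈ T, ∫⁻ z in unitSquare, zakError (s.map (Equiv.addLeft x.1).toEmbedding) f z := by
    intro s
    have h1 : ∀ x : ℤ × ℤ, ∫⁻ z in unitSquare, zakError (s.map (Equiv.addLeft x.1).toEmbedding) f z =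
        ∫⁻ z, unitSquare.indicator (zakError (s.map (Equiv.addLeft x.1).toEmbedding) f)
          (z - (μ + ((x.1 : ℝ), (x.2 : ℝ)))) := by
      intro x
      rw [lintegral_sub_right_eq_self
        (fun z => unitSquare.indicator (zakError (s.map (Equiv.addLeft x.1).toEmbedding) f) z),
        lintegral_indicator hsq]
    simp only [h1]
    refine le_trans ?_ (lintegral_finsetSum (μ := volume) T (f := fun (x : ℤ × ℤ) z =>
      unitSquare.indicator (zakError (s.map (Equiv.addLeft x.1).toEmbedding) f)
        (z - (μ + ((x.1 : ℝ), (x.2 : ℝ))))) fun x _ =>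
      ((measurable_zakError _ f).indicator hsq).comp (measurable_id.sub_const _)).le
    rw [← lintegral_indicator hsq]
    refine lintegral_mono fun z => ?_
    by_cases hz : z ∈ unitSquare
    · rw [indicator_of_mem hz]
      have hx : (⌊z.1 - μ.1⌋, ⌊z.2 - μ.2⌋) ∈ T := by
        simp only [T, Finset.mem_product, Finset.mem_Icc]
        exact ⟨⟨Int.floor_mono (by linarith [hz.1.1]), Int.floor_mono (by linarith [hz.1.2])⟩,
          Int.floor_mono (by linarith [hz.2.1]), Int.floor_mono (by linarith [hz.2.2])⟩
      refine le_trans ?_ (Finset.single_le_sum (f := fun x : ℤ × ℤ =>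
        unitSquare.indicator (zakError (s.map (Equiv.addLeft x.1).toEmbedding) f)
          (z - (μ + ((x.1 : ℝ), (x.2 : ℝ))))) (fun _ _ => zero_le) hx)
      have hmem : z - (μ + ((⌊z.1 - μ.1⌋ : ℝ), (⌊z.2 - μ.2⌋ : ℝ))) ∈ unitSquare := by
        have e : z - (μ + ((⌊z.1 - μ.1⌋ : ℝ), (⌊z.2 - μ.2⌋ : ℝ))) =
            (Int.fract (z.1 - μ.1), Int.fract (z.2 - μ.2)) := by
          ext <;> simp only [Int.fract, Prod.fst_sub, Prod.snd_sub, Prod.fst_add, Prod.snd_add] <;> ring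
        rw [e]
        exact ⟨⟨Int.fract_nonneg _, (Int.fract_lt_one _).le⟩,
          Int.fract_nonneg _, (Int.fract_lt_one _).le⟩
      simp only
      rw [indicator_of_mem hmem, ← zakError_add_int s f _ _ ⌊z.2 - μ.2⌋]
      refine le_of_eq (congrArg _ ?_)
      abel
    · rw [indicator_of_notMem hz]
      exact zero_le
  have hlim : Tendsto (fun s : Finset ℤ => ∑ x ∈ T, ∫⁻ z in unitSquare,
      zakError (s.map (Equiv.addLeft x.1).toEmbedding) f z) atTop (𝓝 0) := by
    have := tendsto_finsetSum T fun (x : ℤ × ℤ) _ =>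
      (tendsto_lintegral_zakError f).comp (hshift x.1)
    simpa using this
  exact tendsto_of_tendsto_of_tendsto_of_le_of_le tendsto_const_nhds hlim (fun _ => zero_le) hle

theorem zakSum_timeFreqShift (s : Finset ℤ) (μ : ℝ × ℝ) (f : Lp ℂ 2 (volume : Measure ℝ)) :
    ∀ᵐ z : ℝ × ℝ, zakSum s (timeFreqShift μ f) z = zakShift μ (zakSum s f) z := by
  have h1 : ∀ᵐ z : ℝ × ℝ, ∀ k : ℤ, timeFreqShift μ f (z.1 + k) =
      Complex.exp (2 * Real.pi * Complex.I * μ.2 * ((z.1 + k : ℝ) : ℂ)) * f (z.1 + k - μ.1) :=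
    ae_all_iff.2 fun k => ae_fst_add (memLp_timeFreqShift μ.1 μ.2 f).coeFn_toLp k
  filter_upwards [h1] with z hz
  rw [zakSum, zakShift, zakSum, Finset.mul_sum]
  refine Finset.sum_congr rfl fun k _ => ?_
  have h2 : Complex.exp (2 * Real.pi * Complex.I * μ.2 * ((z.1 + k : ℝ) : ℂ)) =
      unitExp (μ.2 * (z.1 + k)) := by
    rw [unitExp]; congr 1; push_cast; ring
  have h3 : z.1 + k - μ.1 = (z - μ).1 + k := by rw [Prod.fst_sub]; ring
  rw [hz k, h2, h3, mul_right_comm, mul_left_comm _ (f _), mul_comm _ (f _)]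
  congr 1
  rw [zakChar_eq_unitExp, zakChar_eq_unitExp, ← unitExp_add, ← unitExp_add]
  congr 1
  rw [Prod.snd_sub]
  ring

/-- The relation is exact, almost everywhere, for partial sums. Both sides are L² limits of these on
the unit square, and quasi-periodicity carries the equality to the plane. -/
theorem zak_timeFreqShift (μ : ℝ × ℝ) (f : Lp ℂ 2 (volume : Measure ℝ)) :
    ∀ᵐ z : ℝ × ℝ, zak (timeFreqShift μ f) z = zakShift μ (zak f) z := by
  set K : ℝ × ℝ → ℂ := zakShift μ (zak f) with hK
  have hKm : Measurable K :=
    (continuous_unitExp.measurable.comp (measurable_fst.const_mul _)).mul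
      ((measurable_zak f).comp (measurable_id.sub_const _))
  have h1 : ∀ s, ∫⁻ z in unitSquare, ‖zak (timeFreqShift μ f) z - K z‖ₑ ^ 2 ≤
      2 * (∫⁻ z in unitSquare, zakError s (timeFreqShift μ f) z) +
        2 * ∫⁻ z in unitSquare, zakError s f (z - μ) := by
    intro s
    have hm : Measurable fun z => zakError s f (z - μ) :=
      (measurable_zakError _ _).comp (measurable_id.sub_const _)
    rw [← lintegral_const_mul _ (measurable_zakError _ _), ← lintegral_const_mul _ hm,
      ← lintegral_add_left ((measurable_zakError _ _).const_mul _)]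
    refine lintegral_mono_ae (ae_restrict_of_ae ?_)
    filter_upwards [zakSum_timeFreqShift s μ f] with z hz
    have e1 : zakError s f (z - μ) = ‖zakSum s (timeFreqShift μ f) z - K z‖ₑ ^ 2 := by
      rw [hz, hK, zakError, zakShift, zakShift, ← mul_sub, enorm_mul]
      have : ‖unitExp (μ.2 * z.1)‖ₑ = 1 := by
        rw [← ofReal_norm, norm_unitExp, ENNReal.ofReal_one]
      rw [this, one_mul]
    rw [e1, zakError]
    set a := zakSum s (timeFreqShift μ f) z
    have e2 : zak (timeFreqShift μ f) z - K z = (a - K z) - (a - zak (timeFreqShift μ f) z) := by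
      ring
    rw [e2, add_comm, ← mul_add]
    have e3 : ‖(a - K z) - (a - zak (timeFreqShift μ f) z)‖ₑ ≤
        ‖a - K z‖ₑ + ‖a - zak (timeFreqShift μ f) z‖ₑ := enorm_sub_le
    calc _ ≤ (‖a - K z‖ₑ + ‖a - zak (timeFreqShift μ f) z‖ₑ) ^ 2 := by gcongr
      _ ≤ _ := by
        have := ENNReal.rpow_add_le_mul_rpow_add_rpow ‖a - K z‖ₑ
          ‖a - zak (timeFreqShift μ f) z‖ₑ (p := 2) (by norm_num)
        norm_num at this
        exact this
  have h2 : ∫⁻ z in unitSquare, ‖zak (timeFreqShift μ f) z - K z‖ₑ ^ 2 = 0 := by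
    have h3 := (ENNReal.Tendsto.const_mul (a := 2)
      (tendsto_lintegral_zakError (timeFreqShift μ f)) (by simp)).add
      (ENNReal.Tendsto.const_mul (a := 2) (tendsto_lintegral_zakError_sub f μ) (by simp))
    rw [mul_zero, add_zero] at h3
    exact le_antisymm (ge_of_tendsto' h3 h1) zero_le
  have hm : Measurable fun z => ‖zak (timeFreqShift μ f) z - K z‖ₑ ^ 2 :=
    ((measurable_zak _).sub hKm).enorm.pow_const 2
  rw [lintegral_eq_zero_iff hm] at h2
  refine ae_of_ae_unitSquare ?_ fun z m n hz => ?_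
  · filter_upwards [h2] with z hz
    simpa [sub_eq_zero] using hz
  · rw [quasiPeriodic_zak, hK, (quasiPeriodic_zak f).zakShift μ, ← hK, hz]

theorem zakShift_lattice {F : ℝ × ℝ → ℂ} (hF : QuasiPeriodic F) (P : ℕ) {Q : ℕ} (hQ : 0 < Q)
    (l : ℕ) (q n : ℤ) (w : ℝ × ℝ) :
    zakShift (((l + q * Q : ℤ) : ℝ) / Q, (n : ℝ) * P) F w =
      unitExp (n * P * w.1) * unitExp (-(q * w.2)) * F (w - ((l : ℝ) / Q, 0)) := by
  have hQ' : (Q : ℝ) ≠ 0 := by positivity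
  have h1 : w - (((l + q * Q : ℤ) : ℝ) / Q, (n : ℝ) * P) =
      (w - ((l : ℝ) / Q, 0)) + (((-q : ℤ) : ℝ), ((-(n * P) : ℤ) : ℝ)) := by
    ext
    · simp; field_simp; ring
    · simp; ring
  have h2 : ((-q : ℤ) : ℝ) * (w - ((l : ℝ) / Q, (0 : ℝ))).2 = -(q * w.2) := by simp
  rw [zakShift, h1, hF, h2, ← mul_assoc]

/-! ### From the Gabor space to the column space of the Zak matrix -/

section ColumnSpace

variable {P Q : ℕ}

/-- The column space of the Zak matrix. -/
noncomputable def columnSpace (P Q : ℕ) (F : ℝ × ℝ → ℂ) (z : ℝ × ℝ) : Submodule ℂ (Fin P → ℂ) :=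
  LinearMap.range (zakMatrix P Q F z).mulVecLin

theorem column_mem_columnSpace (F : ℝ × ℝ → ℂ) (z : ℝ × ℝ) (l : Fin Q) :
    (fun k : Fin P => F (gridPoint P Q z k l)) ∈ columnSpace P Q F z := by
  classical
  refine ⟨Pi.single l 1, ?_⟩
  rw [Matrix.mulVecLin_apply, Matrix.mulVec_single_one]
  rfl

/-- Division of the time index by Q selects a column. The remaining factor is the same in every row
because P · k/P is an integer; this is why rows are sampled at step 1/P. -/
theorem zakShift_lattice_mem_columnSpace {F : ℝ × ℝ → ℂ} (hF : QuasiPeriodic F) (hP : 0 < P)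
    (hQ : 0 < Q) {p : ℝ × ℝ} (hp : p ∈ separableLattice P Q) (z : ℝ × ℝ) :
    (fun k : Fin P => zakShift p F (gridPoint P Q z k 0)) ∈ columnSpace P Q F z := by
  obtain ⟨m, n, rfl⟩ := hp
  have hQ' : (0 : ℤ) < Q := by exact_mod_cast hQ
  have hP' : (P : ℝ) ≠ 0 := by positivity
  obtain ⟨l, hl⟩ : ∃ l : ℕ, (l : ℤ) = m % Q := ⟨(m % Q).toNat, Int.toNat_of_nonneg
    (Int.emod_nonneg _ hQ'.ne')⟩
  have hlQ : l < Q := by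
    have := Int.emod_lt_of_pos m hQ'
    omega
  have hm : m = l + (m / Q) * Q := by
    rw [hl]; exact (Int.emod_add_ediv_mul m Q).symm
  have h := (columnSpace P Q F z).smul_mem
    (unitExp (n * P * z.1) * unitExp (-((m / Q : ℤ) * z.2)))
    (column_mem_columnSpace F z ⟨l, hlQ⟩)
  convert h using 1
  funext k
  rw [hm, zakShift_lattice hF P hQ, Pi.smul_apply, smul_eq_mul, ← hm]
  have h1 : gridPoint P Q z k 0 - ((l : ℝ) / Q, 0) = gridPoint P Q z k l := by
    ext <;> simp [gridPoint]
    ring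
  have h2 : (n : ℝ) * P * (gridPoint P Q z k 0).1 = n * P * z.1 + ((n * (k : ℕ) : ℤ) : ℝ) := by
    simp [gridPoint]; field_simp
  rw [h1, h2, unitExp_add_int]
  simp [gridPoint]

theorem ae_gridPoint {p : ℝ × ℝ → Prop} (h : ∀ᵐ z, p z) (P Q : ℕ) :
    ∀ᵐ z : ℝ × ℝ, ∀ k l : ℕ, p (gridPoint P Q z k l) :=
  ae_all_iff.2 fun _ => ae_all_iff.2 fun _ => ae_add h _

theorem ae_mem_columnSpace_of_mem_span (hP : 0 < P) (hQ : 0 < Q)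
    (g : Lp ℂ 2 (volume : Measure ℝ)) {f : Lp ℂ 2 (volume : Measure ℝ)}
    (hf : f ∈ Submodule.span ℂ ((fun p => timeFreqShift p g) '' separableLattice P Q)) :
    ∀ᵐ z : ℝ × ℝ, (fun k : Fin P => zak f (gridPoint P Q z k 0)) ∈
      columnSpace P Q (zak g) z := by
  induction hf using Submodule.span_induction with
  | mem f hf =>
    obtain ⟨p, hp, rfl⟩ := hf
    filter_upwards [ae_gridPoint (zak_timeFreqShift p g) P Q] with z hz
    simp only [hz]
    exact zakShift_lattice_mem_columnSpace (quasiPeriodic_zak g) hP hQ hp z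
  | zero =>
    filter_upwards [ae_gridPoint zak_zero P Q] with z hz
    simp only [hz]
    exact Submodule.zero_mem _
  | add f f' _ _ h h' =>
    filter_upwards [ae_gridPoint (zak_add f f') P Q, h, h'] with z hz h1 h2
    simp only [hz]
    exact Submodule.add_mem _ h1 h2
  | smul c f _ h =>
    filter_upwards [ae_gridPoint (zak_smul c f) P Q, h] with z hz h1
    simp only [hz]
    exact Submodule.smul_mem _ c h1

theorem exists_seq_tendsto_zak {f : ℕ → Lp ℂ 2 (volume : Measure ℝ)}
    {f₀ : Lp ℂ 2 (volume : Measure ℝ)} (h : Tendsto f atTop (𝓝 f₀)) :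
    ∃ ns : ℕ → ℕ, ∀ᵐ z : ℝ × ℝ, Tendsto (fun i => zak (f (ns i)) z) atTop (𝓝 (zak f₀ z)) := by
  have h1 : Tendsto (fun n => zakSquare (f n)) atTop (𝓝 (zakSquare f₀)) :=
    (zakIsometry.continuous.tendsto f₀).comp h
  obtain ⟨ns, -, hns⟩ := (tendstoInMeasure_of_tendsto_Lp h1).exists_seq_tendsto_ae
  refine ⟨ns, ?_⟩
  filter_upwards [ae_fract_of_ae_unitSquare hns] with z hz
  simp only [zak_apply]
  exact hz.const_mul _

/-- The property passes from the span to its closure: a subsequence of Zak transforms converges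
almost everywhere, and a finite-dimensional column space is closed. -/
theorem ae_mem_columnSpace_of_mem_gaborSpace (hP : 0 < P) (hQ : 0 < Q)
    (g : Lp ℂ 2 (volume : Measure ℝ)) {f : Lp ℂ 2 (volume : Measure ℝ)}
    (hf : f ∈ gaborSpace g (separableLattice P Q)) :
    ∀ᵐ z : ℝ × ℝ, (fun k : Fin P => zak f (gridPoint P Q z k 0)) ∈
      columnSpace P Q (zak g) z := by
  obtain ⟨x, hx, hlim⟩ := mem_closure_iff_seq_limit.1 hf
  obtain ⟨ns, hns⟩ := exists_seq_tendsto_zak hlim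
  have h1 : ∀ᵐ z : ℝ × ℝ, ∀ n, (fun k : Fin P => zak (x n) (gridPoint P Q z k 0)) ∈
      columnSpace P Q (zak g) z :=
    ae_all_iff.2 fun n => ae_mem_columnSpace_of_mem_span hP hQ g (hx n)
  filter_upwards [h1, ae_gridPoint hns P Q] with z h2 h3
  refine (Submodule.closed_of_finiteDimensional (columnSpace P Q (zak g) z)).mem_of_tendsto
    (tendsto_pi_nhds.2 fun k => h3 k 0) (Eventually.of_forall fun i => h2 (ns i))

/-- Translation by l/Q only permutes columns up to phases. It lets the statement about the column l
= 0 be applied to every column. -/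
theorem columnSpace_sub_le {F : ℝ × ℝ → ℂ} (hF : QuasiPeriodic F) (hP : 0 < P) (hQ : 0 < Q)
    (z : ℝ × ℝ) (l : ℕ) : columnSpace P Q F (z - ((l : ℝ) / Q, 0)) ≤ columnSpace P Q F z := by
  conv_lhs => rw [columnSpace, Matrix.range_mulVecLin]
  rw [Submodule.span_le]
  rintro _ ⟨l', rfl⟩
  have h := zakShift_lattice_mem_columnSpace hF hP hQ
    (p := (((l + l' : ℤ) : ℝ) / Q, ((0 : ℤ) : ℝ) * P)) ⟨_, _, rfl⟩ z
  rw [SetLike.mem_coe]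
  convert h using 1
  funext k
  have h1 : gridPoint P Q z k 0 - (((l + (l' : ℕ) : ℤ) : ℝ) / Q, ((0 : ℤ) : ℝ) * P) =
      gridPoint P Q (z - ((l : ℝ) / Q, 0)) k l' := by
    ext <;> simp [gridPoint]
    ring
  rw [zakShift, h1]
  simp [unitExp_zero, zakMatrix]

theorem shiftInRange_of_mem_gaborSpace (hP : 0 < P) (hQ : 0 < Q)
    (g : Lp ℂ 2 (volume : Measure ℝ)) {p : ℝ × ℝ}
    (hp : timeFreqShift p g ∈ gaborSpace g (separableLattice P Q)) :
    ShiftInRange P Q (zak g) p := by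
  have h1 := ae_mem_columnSpace_of_mem_gaborSpace hP hQ g hp
  have h2 : ∀ᵐ z : ℝ × ℝ, ∀ l : ℕ,
      (fun k : Fin P => zak (timeFreqShift p g) (gridPoint P Q (z - ((l : ℝ) / Q, 0)) k 0)) ∈
        columnSpace P Q (zak g) (z - ((l : ℝ) / Q, 0)) := ae_all_iff.2 fun l => ae_sub h1 _
  filter_upwards [h2, ae_gridPoint (zak_timeFreqShift p g) P Q] with z h3 h4
  have h5 : ∀ l : Fin Q, ∃ x : Fin Q → ℂ, (zakMatrix P Q (zak g) z).mulVec x =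
      fun k : Fin P => zakShift p (zak g) (gridPoint P Q z k l) := by
    intro l
    obtain ⟨x, hx⟩ := columnSpace_sub_le (quasiPeriodic_zak g) hP hQ z l (h3 l)
    refine ⟨x, hx.trans ?_⟩
    funext k
    rw [← h4]
    congr 1
    ext <;> simp [gridPoint]
    ring
  choose x hx using h5
  refine ⟨Matrix.of fun i l => x l i, ?_⟩
  ext k l
  exact (congrFun (hx l) k).symm

end ColumnSpace

/-! ### Positivity tested against squares of trigonometric polynomials -/

theorem integrableOn_bdd_mul {X : Type*} [TopologicalSpace X] [MeasurableSpace X] [BorelSpace X]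
    [SecondCountableTopology X] {μ : Measure X} {s : Set X} {K : X → ℝ} (hK : IntegrableOn K s μ)
    {u : X → ℝ} (hu : Continuous u) {c : ℝ} (hc : ∀ x, |u x| ≤ c) :
    IntegrableOn (fun x => u x * K x) s μ :=
  hK.bdd_mul (c := c) hu.aestronglyMeasurable (Eventually.of_forall hc)

section Circle

variable {T : ℝ} [hT : Fact (0 < T)]

/-- Trigonometric polynomials are uniformly dense in the continuous functions on the circle, and the
integral is continuous under uniform limits. -/
theorem setIntegral_sq_norm_mul_nonneg_of_trigPoly {K : ℝ → ℝ} (hK : IntegrableOn K (Ico 0 T))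
    (hpos : ∀ (s : Finset ℤ) (α : ℤ → ℂ),
      0 ≤ ∫ x in Ico 0 T, ‖∑ n ∈ s, α n * unitExp (n / T * x)‖ ^ 2 * K x)
    (h : C(AddCircle T, ℂ)) : 0 ≤ ∫ x in Ico 0 T, ‖h x‖ ^ 2 * K x := by
  have hmem : h ∈ (Submodule.span ℂ (range (@fourier T))).topologicalClosure := by
    rw [span_fourier_closure_eq_top]; trivial
  obtain ⟨q, hq, hlim⟩ := mem_closure_iff_seq_limit.1 hmem
  have hq' : ∀ n, 0 ≤ ∫ x in Ico 0 T, ‖q n x‖ ^ 2 * K x := by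
    intro n
    obtain ⟨c, hc⟩ := Finsupp.mem_span_range_iff_exists_finsupp.1 (hq n)
    convert hpos c.support c using 4 with x
    congr 2
    rw [← hc, Finsupp.sum, ContinuousMap.coe_sum, Finset.sum_apply]
    refine Finset.sum_congr rfl fun m _ => ?_
    rw [ContinuousMap.smul_apply, smul_eq_mul, fourier_coe_apply, unitExp]
    congr 2
    push_cast
    ring
  have hbd : ∀ᶠ n in atTop, ‖q n‖ ≤ ‖h‖ + 1 := by
    filter_upwards [hlim.norm.eventually (gt_mem_nhds (lt_add_one ‖h‖))] with n hn using hn.le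
  have hcont : ∀ n, Continuous fun x : ℝ => ‖q n (x : AddCircle T)‖ ^ 2 := fun n =>
    (((q n).continuous.comp (AddCircle.continuous_mk' T)).norm).pow 2
  suffices hint : Tendsto (fun n => ∫ x in Ico 0 T, ‖q n x‖ ^ 2 * K x) atTop
      (𝓝 (∫ x in Ico 0 T, ‖h x‖ ^ 2 * K x)) from ge_of_tendsto' hint hq'
  refine tendsto_integral_filter_of_dominated_convergence
    (fun x => (‖h‖ + 1) ^ 2 * ‖K x‖) ?_ ?_ (hK.norm.const_mul _) ?_
  · exact Eventually.of_forall fun n => (hcont n).aestronglyMeasurable.mul hK.aestronglyMeasurable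
  · filter_upwards [hbd] with n hn
    refine Eventually.of_forall fun x => ?_
    rw [norm_mul, norm_pow, norm_norm]
    gcongr
    exact ((q n).norm_coe_le_norm x).trans hn
  · refine Eventually.of_forall fun x => ?_
    have h1 : Tendsto (fun n => q n (x : AddCircle T)) atTop (𝓝 (h x)) :=
      ((continuous_eval_const (F := C(AddCircle T, ℂ)) (x : AddCircle T)).tendsto h).comp hlim
    exact (h1.norm.pow 2).mul_const _

theorem setIntegral_Icc_nonneg_of_trigPoly {K : ℝ → ℝ} (hK : IntegrableOn K (Ico 0 T))
    (hpos : ∀ (s : Finset ℤ) (α : ℤ → ℂ),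
      0 ≤ ∫ x in Ico 0 T, ‖∑ n ∈ s, α n * unitExp (n / T * x)‖ ^ 2 * K x)
    {a b : ℝ} (ha : 0 ≤ a) (hab : a ≤ b) (hb : b < T) : 0 ≤ ∫ x in Icc a b, K x := by
  set F : Set (AddCircle T) := (fun x : ℝ => (x : AddCircle T)) '' Icc a b with hF
  have hFc : IsClosed F := (isCompact_Icc.image (AddCircle.continuous_mk' T)).isClosed
  have hFne : F.Nonempty := (nonempty_Icc.2 hab).image _
  -- Continuous functions decreasing to the indicator of the closed arc. Since `b < T`, the arc
  -- pulls back to exactly [a, b] in the fundamental interval.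
  set u : ℕ → AddCircle T → ℝ := fun n y => max 0 (1 - n * Metric.infDist y F) with hu
  have hu0 : ∀ n y, 0 ≤ u n y := fun n y => le_max_left _ _
  have hu1 : ∀ n y, u n y ≤ 1 := fun n y => max_le zero_le_one (by
    have : 0 ≤ (n : ℝ) * Metric.infDist y F := mul_nonneg n.cast_nonneg Metric.infDist_nonneg
    linarith)
  have hucont : ∀ n, Continuous (u n) := fun n =>
    continuous_const.max (continuous_const.sub (continuous_const.mul (Metric.continuous_infDist_pt F)))
  have hulim : ∀ y, Tendsto (fun n => u n y) atTop (𝓝 (F.indicator 1 y)) := by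
    intro y
    by_cases hy : y ∈ F
    · have : ∀ n, u n y = 1 := fun n => by simp [hu, Metric.infDist_zero_of_mem hy]
      simp [this, hy]
    · have hpos' : 0 < Metric.infDist y F := (hFc.notMem_iff_infDist_pos hFne).1 hy
      rw [indicator_of_notMem hy]
      refine tendsto_const_nhds.congr' ?_
      obtain ⟨N, hN⟩ := exists_nat_gt (1 / Metric.infDist y F)
      rw [div_lt_iff₀ hpos'] at hN
      filter_upwards [eventually_ge_atTop N] with n hn
      have : (N : ℝ) ≤ n := by exact_mod_cast hn
      rw [hu]
      simp only
      rw [max_eq_left]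
      nlinarith
  have hmemF : ∀ x ∈ Ico 0 T, ((x : AddCircle T) ∈ F ↔ x ∈ Icc a b) := by
    intro x hx
    refine ⟨?_, fun h => ⟨x, h, rfl⟩⟩
    rintro ⟨y, hy, hyx⟩
    have hyT : y ∈ Ico 0 (0 + T) := by
      rw [zero_add]; exact ⟨ha.trans hy.1, hy.2.trans_lt hb⟩
    have := (AddCircle.coe_eq_coe_iff_of_mem_Ico hyT (by rwa [zero_add])).1 hyx
    rwa [← this]
  have hlim : Tendsto (fun n => ∫ x in Ico 0 T, ‖((u n x : ℝ) : ℂ)‖ ^ 2 * K x) atTop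
      (𝓝 (∫ x in Ico 0 T, (F.indicator 1 (x : AddCircle T) : ℝ) ^ 2 * K x)) := by
    refine tendsto_integral_of_dominated_convergence (fun x => ‖K x‖) (fun n => ?_) hK.norm
      (fun n => Eventually.of_forall fun x => ?_) (Eventually.of_forall fun x => ?_)
    · have : Continuous fun x : ℝ => ‖((u n (x : AddCircle T) : ℝ) : ℂ)‖ ^ 2 :=
        ((Complex.continuous_ofReal.comp
          ((hucont n).comp (AddCircle.continuous_mk' T))).norm).pow 2
      exact this.aestronglyMeasurable.mul hK.aestronglyMeasurable
    · rw [norm_mul, norm_pow, norm_norm, Complex.norm_real, Real.norm_of_nonneg (hu0 _ _)]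
      have : u n (x : AddCircle T) ^ 2 ≤ 1 := pow_le_one₀ (hu0 _ _) (hu1 _ _)
      nlinarith [norm_nonneg (K x)]
    · simp only [Complex.norm_real, Real.norm_of_nonneg (hu0 _ _)]
      exact ((hulim _).pow 2).mul_const _
  have hfinal : ∫ x in Ico 0 T, (F.indicator 1 (x : AddCircle T) : ℝ) ^ 2 * K x =
      ∫ x in Icc a b, K x := by
    have hsub : Icc a b ⊆ Ico 0 T := fun x hx => ⟨ha.trans hx.1, hx.2.trans_lt hb⟩
    have h1 : ∫ x in Ico 0 T, (F.indicator 1 (x : AddCircle T) : ℝ) ^ 2 * K x =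
        ∫ x in Ico 0 T, (Icc a b).indicator K x := by
      refine setIntegral_congr_fun measurableSet_Ico fun x hx => ?_
      by_cases h : x ∈ Icc a b
      · simp [h, (hmemF x hx).2 h]
      · have h' : (x : AddCircle T) ∉ F := fun h' => h ((hmemF x hx).1 h')
        simp only [indicator_of_notMem h, indicator_of_notMem h']
        ring
    rw [h1, setIntegral_indicator measurableSet_Icc, inter_eq_self_of_subset_right hsub]
  rw [← hfinal]
  refine ge_of_tendsto' hlim fun n => ?_
  exact setIntegral_sq_norm_mul_nonneg_of_trigPoly hK hpos
    ⟨fun y => ((u n y : ℝ) : ℂ), Complex.continuous_ofReal.comp (hucont n)⟩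

end Circle

section Rectangle

/-- The sum of the translates of `D` by `(k/P, 0)`, `0 ≤ k < P`. -/
noncomputable def translateSum (P : ℕ) (D : ℝ × ℝ → ℝ) (z : ℝ × ℝ) : ℝ :=
  ∑ k ∈ Finset.range P, D (z + ((k : ℝ) / P, 0))

theorem locallyIntegrable_translateSum {D : ℝ × ℝ → ℝ} (hD : LocallyIntegrable D) (P : ℕ) :
    LocallyIntegrable (translateSum P D) := by
  refine (locallyIntegrable_finsetSum (Finset.range P) fun k _ => ?_)
  intro z
  obtain ⟨U, hU, hUD⟩ := hD (z + ((k : ℝ) / P, 0))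
  refine ⟨(fun w => w + ((k : ℝ) / P, 0)) ⁻¹' U,
    (continuous_add_const _).continuousAt.preimage_mem_nhds hU, ?_⟩
  exact ((measurePreserving_add_right volume _).integrableOn_comp_preimage
    (measurableEmbedding_addRight _)).2 hUD

variable {P : ℕ} {D : ℝ × ℝ → ℝ}

theorem integrableOn_rectangle (hD : LocallyIntegrable D) {s t : Set ℝ} {a b c d : ℝ}
    (hs : s ⊆ Icc a b) (ht : t ⊆ Icc c d) : IntegrableOn D (s ×ˢ t) :=
  (hD.integrableOn_isCompact (isCompact_Icc.prod isCompact_Icc)).mono_set (prod_mono hs ht)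

/-- A weight of period 1/P sees D only through the sum of its P translates, which is how the sum
over the rows of the Zak matrix arises. -/
theorem setIntegral_mul_translateSum (hP : 0 < P) (hD : LocallyIntegrable D)
    (u v : ℝ → ℝ) (hu : Continuous u) (hv : Continuous v)
    (hup : Function.Periodic u (1 / (P : ℝ))) {cu cv : ℝ} (hcu : ∀ x, |u x| ≤ cu)
    (hcv : ∀ x, |v x| ≤ cv) :
    ∫ x in Ico 0 (1 / (P : ℝ)), u x * ∫ ω in Icc (0 : ℝ) 1, v ω * translateSum P D (x, ω) =
      ∫ z in unitSquare, u z.1 * v z.2 * D z := by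
  have hP' : (P : ℝ) ≠ 0 := by positivity
  have hI : ∀ a b : ℝ, IntegrableOn (fun z : ℝ × ℝ => u z.1 * v z.2 * D z) (Icc a b ×ˢ Icc 0 1) := by
    intro a b
    refine integrableOn_bdd_mul (integrableOn_rectangle hD subset_rfl subset_rfl)
      ((hu.comp continuous_fst).mul (hv.comp continuous_snd)) (c := cu * cv) fun z => ?_
    rw [abs_mul]
    exact mul_le_mul (hcu _) (hcv _) (abs_nonneg _) ((abs_nonneg _).trans (hcu 0))
  set G : ℝ → ℝ := fun x => ∫ ω in Icc (0 : ℝ) 1, u x * v ω * D (x, ω) with hG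
  have hGI : ∀ a b : ℝ, IntegrableOn G (Icc a b) := by
    intro a b
    have h := hI a b
    rw [IntegrableOn, Measure.volume_eq_prod, ← Measure.prod_restrict] at h
    exact h.integral_prod_left
  have hGi : ∀ a b : ℝ, IntervalIntegrable G volume a b := by
    intro a b
    rw [intervalIntegrable_iff]
    exact (hGI (min a b) (max a b)).mono_set Ioc_subset_Icc_self
  have h1 : ∫ z in unitSquare, u z.1 * v z.2 * D z = ∫ x in (0 : ℝ)..1, G x := by
    have h := hI 0 1
    rw [Measure.volume_eq_prod] at h
    rw [unitSquare, Measure.volume_eq_prod, setIntegral_prod _ h,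
      intervalIntegral.integral_of_le zero_le_one, ← integral_Icc_eq_integral_Ioc]
  have h2 : ∫ x in (0 : ℝ)..1, G x =
      ∑ k ∈ Finset.range P, ∫ x in (0 : ℝ)..(1 / P), G (x + (k : ℝ) / P) := by
    have h3 := intervalIntegral.sum_integral_adjacent_intervals (f := G) (μ := volume)
      (a := fun k : ℕ => (k : ℝ) / P) (n := P) (fun k _ => hGi _ _)
    rw [Nat.cast_zero, zero_div, div_self hP'] at h3
    rw [← h3]
    refine Finset.sum_congr rfl fun k _ => ?_
    rw [intervalIntegral.integral_comp_add_right, zero_add]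
    congr 1
    push_cast
    ring
  have hGt : ∀ k : ℕ, IntegrableOn (fun x => G (x + (k : ℝ) / P)) (Ico 0 (1 / (P : ℝ))) := by
    intro k
    have h3 := ((hGi ((0 : ℝ) + (k : ℝ) / P) (1 / P + (k : ℝ) / P)).comp_add_right ((k : ℝ) / P))
    rw [add_sub_cancel_right, add_sub_cancel_right, intervalIntegrable_iff_integrableOn_Ico_of_le
      (by positivity)] at h3
    exact h3
  have h4 : ∀ k : ℕ, ∫ x in (0 : ℝ)..(1 / P), G (x + (k : ℝ) / P) =
      ∫ x in Ico 0 (1 / (P : ℝ)), G (x + (k : ℝ) / P) := fun k => by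
    rw [intervalIntegral.integral_of_le (by positivity), integral_Ico_eq_integral_Ioc]
  rw [h1, h2]
  simp only [h4]
  rw [← integral_finsetSum _ fun k _ => hGt k]
  have hae : ∀ᵐ x : ℝ, ∀ k : ℕ,
      IntegrableOn (fun ω => v ω * D ((x, ω) + ((k : ℝ) / P, 0))) (Icc (0 : ℝ) 1) := by
    have h5 : ∀ᵐ x : ℝ, IntegrableOn (fun ω => D (x, ω)) (Icc (0 : ℝ) 1) := by
      have h6 : ∀ᵐ x : ℝ, ∀ n : ℕ, x ∈ Icc (-(n : ℝ)) n →
          IntegrableOn (fun ω => D (x, ω)) (Icc (0 : ℝ) 1) := by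
        refine ae_all_iff.2 fun n => ?_
        have h := integrableOn_rectangle hD (Subset.refl (Icc (-(n : ℝ)) n))
          (Subset.refl (Icc (0 : ℝ) 1))
        rw [IntegrableOn, Measure.volume_eq_prod, ← Measure.prod_restrict] at h
        have := h.prod_right_ae
        rwa [ae_restrict_iff' measurableSet_Icc] at this
      filter_upwards [h6] with x hx
      obtain ⟨n, hn⟩ := exists_nat_ge |x|
      exact hx n (abs_le.1 hn)
    have h7 : ∀ᵐ x : ℝ, ∀ k : ℕ,
        IntegrableOn (fun ω => D (x + (k : ℝ) / P, ω)) (Icc (0 : ℝ) 1) :=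
      ae_all_iff.2 fun k => (measurePreserving_add_right volume _).quasiMeasurePreserving.ae h5
    filter_upwards [h7] with x hx k
    refine integrableOn_bdd_mul ?_ hv hcv
    simpa using hx k
  refine integral_congr_ae (ae_restrict_of_ae ?_)
  filter_upwards [hae] with x hx
  have h8 : ∀ k : ℕ, G (x + (k : ℝ) / P) =
      u x * ∫ ω in Icc (0 : ℝ) 1, v ω * D ((x, ω) + ((k : ℝ) / P, 0)) := by
    intro k
    have h9 : u (x + (k : ℝ) / P) = u x := by
      have := (hup.nat_mul k) x
      rwa [mul_one_div] at this
    simp only [hG, h9, mul_assoc]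
    rw [integral_const_mul]
    simp
  simp only [h8]
  rw [← Finset.mul_sum, ← integral_finsetSum _ fun k _ => hx k]
  simp only [translateSum, Finset.mul_sum]

theorem norm_trigPoly_le (s : Finset ℤ) (α : ℤ → ℂ) (r : ℤ → ℝ) (x : ℝ) :
    |‖∑ n ∈ s, α n * unitExp (r n * x)‖ ^ 2| ≤ (∑ n ∈ s, ‖α n‖) ^ 2 := by
  rw [abs_of_nonneg (by positivity)]
  gcongr
  refine (norm_sum_le _ _).trans (Finset.sum_le_sum fun n _ => ?_)
  rw [norm_mul, norm_unitExp, mul_one]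

theorem continuous_trigPoly (s : Finset ℤ) (α : ℤ → ℂ) (r : ℤ → ℝ) :
    Continuous fun x : ℝ => ‖∑ n ∈ s, α n * unitExp (r n * x)‖ ^ 2 := by
  fun_prop

/-- The one-variable criterion is used twice: first in x at period 1/P with the polynomial in ω
fixed, then, after exchanging the integrals, in ω at period 1. -/
theorem setIntegral_translateSum_nonneg (hP : 0 < P) (hD : LocallyIntegrable D)
    (hpos : ∀ (s t : Finset ℤ) (α β : ℤ → ℂ), 0 ≤ ∫ z in unitSquare,
      ‖∑ n ∈ s, α n * unitExp (n * P * z.1)‖ ^ 2 * ‖∑ n ∈ t, β n * unitExp (n * z.2)‖ ^ 2 * D z)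
    {a b c d : ℝ} (ha : 0 ≤ a) (hab : a ≤ b) (hb : b < 1 / P) (hc : 0 ≤ c) (hcd : c ≤ d)
    (hd : d < 1) : 0 ≤ ∫ z in Icc a b ×ˢ Icc c d, translateSum P D z := by
  have hP' : (0 : ℝ) < P := by positivity
  have : Fact ((0 : ℝ) < 1 / P) := ⟨by positivity⟩
  have : Fact ((0 : ℝ) < 1) := ⟨one_pos⟩
  have hW := locallyIntegrable_translateSum hD P
  set W := translateSum P D with hWdef
  have hInt : ∀ {v : ℝ → ℝ}, Continuous v → ∀ {cv : ℝ}, (∀ x, |v x| ≤ cv) → ∀ a b c d : ℝ,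
      Integrable (fun z : ℝ × ℝ => v z.2 * W z)
        ((volume.restrict (Icc a b)).prod (volume.restrict (Icc c d))) := by
    intro v hv cv hcv a b c d
    rw [Measure.prod_restrict, ← Measure.volume_eq_prod]
    exact integrableOn_bdd_mul (integrableOn_rectangle hW subset_rfl subset_rfl)
      (hv.comp continuous_snd) fun z => hcv _
  have step : ∀ (t : Finset ℤ) (β : ℤ → ℂ), 0 ≤ ∫ x in Icc a b, ∫ ω in Icc (0 : ℝ) 1,
      ‖∑ n ∈ t, β n * unitExp (n * ω)‖ ^ 2 * W (x, ω) := by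
    intro t β
    have hv := continuous_trigPoly t β (fun n => (n : ℝ))
    have hvb := norm_trigPoly_le t β (fun n => (n : ℝ))
    refine setIntegral_Icc_nonneg_of_trigPoly (T := 1 / (P : ℝ)) ?_ (fun s α => ?_) ha hab hb
    · have h := (hInt hv hvb 0 (1 / P) 0 1).integral_prod_left
      exact IntegrableOn.mono_set h Ico_subset_Icc_self
    · have h := setIntegral_mul_translateSum hP hD
        (fun x => ‖∑ n ∈ s, α n * unitExp (n / (1 / (P : ℝ)) * x)‖ ^ 2) _
        (continuous_trigPoly s α (fun n => n / (1 / (P : ℝ)))) hv (fun x => ?_)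
        (norm_trigPoly_le s α (fun n => n / (1 / (P : ℝ)))) hvb
      · rw [h]
        simpa only [div_div_eq_mul_div, div_one] using hpos s t α β
      · simp only
        congr 3 with n
        have : (n : ℝ) / (1 / P) * (x + 1 / P) = n / (1 / P) * x + n := by
          field_simp
        rw [this, unitExp_add_int]
  have hone : ∀ x : ℝ, |(fun _ : ℝ => (1 : ℝ)) x| ≤ 1 := fun x => by simp
  have hswap : ∫ z in Icc a b ×ˢ Icc c d, W z = ∫ ω in Icc c d, ∫ x in Icc a b, W (x, ω) := by
    have h := hInt continuous_const hone a b c d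
    simp only [one_mul] at h
    rw [Measure.volume_eq_prod, ← Measure.prod_restrict]
    exact integral_prod_symm _ h
  rw [hswap]
  refine setIntegral_Icc_nonneg_of_trigPoly (T := 1) ?_ (fun t β => ?_) hc hcd hd
  · have h := hInt continuous_const hone a b 0 1
    simp only [one_mul] at h
    exact IntegrableOn.mono_set h.integral_prod_right Ico_subset_Icc_self
  · have hv := continuous_trigPoly t β (fun n => (n : ℝ))
    have hvb := norm_trigPoly_le t β (fun n => (n : ℝ))
    have h := step t β
    rw [integral_integral_swap (hInt hv hvb a b 0 1)] at h
    rw [integral_Ico_eq_integral_Ioc, ← integral_Icc_eq_integral_Ioc]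
    simpa only [div_one, integral_const_mul] using h

/-- Lebesgue differentiation: closed balls of the sup metric are squares, over which the integral is
nonnegative. -/
theorem ae_translateSum_nonneg (hP : 0 < P) (hD : LocallyIntegrable D)
    (hper : ∀ (z : ℝ × ℝ) (m n : ℤ), D (z + ((m : ℝ), (n : ℝ))) = D z)
    (hpos : ∀ (s t : Finset ℤ) (α β : ℤ → ℂ), 0 ≤ ∫ z in unitSquare,
      ‖∑ n ∈ s, α n * unitExp (n * P * z.1)‖ ^ 2 * ‖∑ n ∈ t, β n * unitExp (n * z.2)‖ ^ 2 * D z) :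
    ∀ᵐ z, 0 ≤ translateSum P D z := by
  have hP' : (0 : ℝ) < P := by positivity
  have hW := locallyIntegrable_translateSum hD P
  have hbox : ∀ᵐ z : ℝ × ℝ, z ∈ Ioo (0 : ℝ) (1 / P) ×ˢ Ioo (0 : ℝ) 1 → 0 ≤ translateSum P D z := by
    filter_upwards [IsUnifLocDoublingMeasure.ae_tendsto_average volume hW 1] with z hz hmem
    have h1 := hz (l := 𝓝[>] (0 : ℝ)) (fun _ => z) (fun r => r) tendsto_id
      (by filter_upwards [self_mem_nhdsWithin] with r hr
          exact Metric.mem_closedBall_self (by simpa using (le_of_lt hr)))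
    refine ge_of_tendsto h1 ?_
    obtain ⟨⟨a1, a2⟩, b1, b2⟩ := hmem
    have hr0 : 0 < min (min z.1 (1 / P - z.1)) (min z.2 (1 - z.2)) := by
      refine lt_min (lt_min a1 (by linarith)) (lt_min b1 (by linarith))
    filter_upwards [Ioo_mem_nhdsGT hr0] with r hr
    have r1 := hr.2.trans_le ((min_le_left _ _).trans (min_le_left _ _))
    have r2 := hr.2.trans_le ((min_le_left _ _).trans (min_le_right _ _))
    have r3 := hr.2.trans_le ((min_le_right _ _).trans (min_le_left _ _))
    have r4 := hr.2.trans_le ((min_le_right _ _).trans (min_le_right _ _))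
    have hr1 := hr.1
    rw [setAverage_eq, smul_eq_mul]
    refine mul_nonneg (by positivity) ?_
    have hball : Metric.closedBall z r = Icc (z.1 - r) (z.1 + r) ×ˢ Icc (z.2 - r) (z.2 + r) := by
      rw [← Real.closedBall_eq_Icc, ← Real.closedBall_eq_Icc, closedBall_prod_same]
    rw [hball]
    exact setIntegral_translateSum_nonneg hP hD hpos (by linarith) (by linarith) (by linarith)
      (by linarith) (by linarith) (by linarith)
  have hper1 : Function.Periodic (translateSum P D) (1 / (P : ℝ), 0) := by
    intro z
    have h1 := Finset.sum_range_succ (fun k : ℕ => D (z + ((k : ℝ) / P, 0))) P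
    rw [Finset.sum_range_succ'] at h1
    have h2 : D (z + ((P : ℝ) / P, 0)) = D (z + (((0 : ℕ) : ℝ) / P, 0)) := by
      have := hper z 1 0
      rw [Int.cast_one, Int.cast_zero] at this
      rw [div_self hP'.ne', this, Nat.cast_zero, zero_div, Prod.mk_zero_zero, add_zero]
    rw [h2] at h1
    rw [translateSum, translateSum, ← add_right_cancel h1]
    refine Finset.sum_congr rfl fun k _ => congrArg D ?_
    ext
    · simp; ring
    · simp
  have hper2 : Function.Periodic (translateSum P D) (0, 1) := by
    intro z
    refine Finset.sum_congr rfl fun k _ => ?_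
    have := hper (z + ((k : ℝ) / P, 0)) 0 1
    rw [← this]
    congr 1
    ext <;> simp
  have hall : ∀ᵐ z : ℝ × ℝ, ∀ x : ℤ × ℤ, z - ((x.1 : ℝ) / P, (x.2 : ℝ)) ∈
      Ioo (0 : ℝ) (1 / P) ×ˢ Ioo (0 : ℝ) 1 →
      0 ≤ translateSum P D (z - ((x.1 : ℝ) / P, (x.2 : ℝ))) := ae_all_iff.2 fun x => ae_sub hbox _
  -- Positivity is known only inside the open cell, so the null set of grid lines is excluded before
  -- translating.
  have hne1 : ∀ᵐ z : ℝ × ℝ, ∀ m : ℤ, z.1 ≠ (m : ℝ) / P := ae_all_iff.2 fun m => ae_fst_ne _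
  have hne2 : ∀ᵐ z : ℝ × ℝ, ∀ m : ℤ, z.2 ≠ (m : ℝ) := ae_all_iff.2 fun m => ae_snd_ne _
  filter_upwards [hall, hne1, hne2] with z hz h1 h2
  have key := hz (⌊z.1 * P⌋, ⌊z.2⌋) ?_
  · have h3 := (hper1.zsmul ⌊z.1 * P⌋).add_period (hper2.zsmul ⌊z.2⌋)
      (z - ((⌊z.1 * P⌋ : ℝ) / P, (⌊z.2⌋ : ℝ)))
    rw [← h3] at key
    convert key using 2
    ext <;> simp
    ring
  · have f1 := Int.floor_le (z.1 * P)
    have f2 := Int.lt_floor_add_one (z.1 * P)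
    have f3 := Int.floor_le z.2
    have f4 := Int.lt_floor_add_one z.2
    have g1 : (⌊z.1 * P⌋ : ℝ) / P < z.1 :=
      lt_of_le_of_ne ((div_le_iff₀ hP').2 f1) (h1 _).symm
    have g2 : z.1 < ((⌊z.1 * P⌋ : ℝ) + 1) / P := (lt_div_iff₀ hP').2 f2
    have g3 : (⌊z.2⌋ : ℝ) < z.2 := lt_of_le_of_ne f3 (h2 _).symm
    rw [add_div] at g2
    refine ⟨⟨?_, ?_⟩, ?_, ?_⟩ <;> simp only [Prod.fst_sub, Prod.snd_sub] <;> linarith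

end Rectangle

/-! ### From the Riesz bounds to pointwise bounds for the Zak matrix -/

theorem IsRieszBasis.exists_bounds {ι H : Type*} [NormedAddCommGroup H] [InnerProductSpace ℂ H]
    {φ : ι → H} (h : IsRieszBasis φ) : ∃ c C : ℝ, 0 < c ∧ 0 < C ∧
      ∀ (s : Finset ι) (a : ι → ℂ), c * ∑ i ∈ s, ‖a i‖ ^ 2 ≤ ‖∑ i ∈ s, a i • φ i‖ ^ 2 ∧
        ‖∑ i ∈ s, a i • φ i‖ ^ 2 ≤ C * ∑ i ∈ s, ‖a i‖ ^ 2 := by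
  classical
  obtain ⟨T, hT⟩ := h
  set A : ℝ := ‖(T.symm : H →L[ℂ] lp (fun _ : ι => ℂ) 2)‖ with hA
  set B : ℝ := ‖(T : lp (fun _ : ι => ℂ) 2 →L[ℂ] H)‖ with hB
  -- Adding 1 keeps both constants positive even if an operator norm vanishes.
  refine ⟨1 / (A ^ 2 + 1), B ^ 2 + 1, by positivity, by positivity, fun s a => ?_⟩
  set x : lp (fun _ : ι => ℂ) 2 := ∑ i ∈ s, lp.single 2 i (a i) with hx
  have hxn : ‖x‖ ^ 2 = ∑ i ∈ s, ‖a i‖ ^ 2 := by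
    have := lp.norm_sum_single (E := fun _ : ι => ℂ) (p := 2) (by norm_num) a s
    simpa using this
  have hTx : T x = ∑ i ∈ s, a i • φ i := by
    rw [hx, map_sum]
    refine Finset.sum_congr rfl fun i _ => ?_
    rw [← hT i, ← map_smul, ← lp.single_smul, smul_eq_mul, mul_one]
  rw [← hTx, ← hxn]
  have h1 : ‖T x‖ ≤ B * ‖x‖ := (T : lp (fun _ : ι => ℂ) 2 →L[ℂ] H).le_opNorm x
  have h2 : ‖x‖ ≤ A * ‖T x‖ := by
    have := (T.symm : H →L[ℂ] lp (fun _ : ι => ℂ) 2).le_opNorm (T x)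
    simpa using this
  constructor
  · rw [one_div_mul_eq_div, div_le_iff₀ (by positivity)]
    calc ‖x‖ ^ 2 ≤ (A * ‖T x‖) ^ 2 := by gcongr
      _ ≤ ‖T x‖ ^ 2 * (A ^ 2 + 1) := by nlinarith [sq_nonneg ‖T x‖]
  · calc ‖T x‖ ^ 2 ≤ (B * ‖x‖) ^ 2 := by gcongr
      _ ≤ (B ^ 2 + 1) * ‖x‖ ^ 2 := by nlinarith [sq_nonneg ‖x‖]

/-- The Gabor lattice `(1/Q)ℤ × Pℤ`, indexed by `Fin Q × ℤ × ℤ`. -/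
noncomputable def latticePoint (P Q : ℕ) (i : Fin Q × ℤ × ℤ) : ℝ × ℝ :=
  ((((i.1 : ℕ) + -i.2.2 * Q : ℤ) : ℝ) / Q, (i.2.1 : ℝ) * P)

theorem latticePoint_mem (P Q : ℕ) (i : Fin Q × ℤ × ℤ) :
    latticePoint P Q i ∈ separableLattice P Q := ⟨_, _, rfl⟩

theorem latticePoint_injective {P Q : ℕ} (hP : 0 < P) (hQ : 0 < Q) :
    Function.Injective (latticePoint P Q) := by
  have hP' : (P : ℝ) ≠ 0 := by positivity
  have hQ' : (Q : ℝ) ≠ 0 := by positivity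
  rintro ⟨l, n, q⟩ ⟨l', n', q'⟩ h
  rw [latticePoint, latticePoint, Prod.mk.injEq, div_left_inj' hQ', mul_left_inj' hP',
    Int.cast_inj, Int.cast_inj] at h
  obtain ⟨h1, h2⟩ := h
  simp only at h1 h2
  have h3 := congrArg (· % (Q : ℤ)) h1
  simp only [Int.add_mul_emod_self_right] at h3
  rw [Int.emod_eq_of_lt (by positivity) (by exact_mod_cast l.2),
    Int.emod_eq_of_lt (by positivity) (by exact_mod_cast l'.2)] at h3
  have h4 : l = l' := Fin.ext (by exact_mod_cast h3)
  subst h4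
  have h5 : q * (Q : ℤ) = q' * Q := by linarith
  have h6 : (Q : ℤ) ≠ 0 := by exact_mod_cast hQ.ne'
  rw [mul_right_cancel₀ h6 h5, h2]

theorem IsRieszBasis.exists_latticePoint_bounds {g : Lp ℂ 2 (volume : Measure ℝ)} {P Q : ℕ}
    (hP : 0 < P) (hQ : 0 < Q) (h : IsRieszBasis (gaborSystem g (separableLattice P Q))) :
    ∃ c C : ℝ, 0 < c ∧ 0 < C ∧ ∀ (s : Finset (Fin Q × ℤ × ℤ)) (a : Fin Q × ℤ × ℤ → ℂ),
      c * ∑ i ∈ s, ‖a i‖ ^ 2 ≤ ‖∑ i ∈ s, a i • timeFreqShift (latticePoint P Q i) g‖ ^ 2 ∧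
        ‖∑ i ∈ s, a i • timeFreqShift (latticePoint P Q i) g‖ ^ 2 ≤ C * ∑ i ∈ s, ‖a i‖ ^ 2 := by
  obtain ⟨c, C, hc, hC, hb⟩ := h.exists_bounds
  refine ⟨c, C, hc, hC, fun s a => ?_⟩
  let e : Fin Q × ℤ × ℤ ↪ separableLattice P Q :=
    ⟨fun i => ⟨latticePoint P Q i, latticePoint_mem P Q i⟩, fun i j hij =>
      latticePoint_injective hP hQ (Subtype.mk.inj hij)⟩
  have h1 := hb (s.map e) (Function.extend e a 0)
  simp only [Finset.sum_map, e.injective.extend_apply] at h1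
  have h2 : ‖∑ i ∈ s, a i • gaborSystem g (separableLattice P Q) (e i)‖ =
      ‖∑ i ∈ s, a i • timeFreqShift (latticePoint P Q i) g‖ := by
    change ‖((∑ i ∈ s, a i • gaborSystem g (separableLattice P Q) (e i) :
      gaborSpace g (separableLattice P Q)) : Lp ℂ 2 (volume : Measure ℝ))‖ = _
    rw [Submodule.coe_sum]
    rfl
  rwa [h2] at h1

theorem integrable_mul_conj_unitExp (r s : ℝ) (c : ℂ) :
    IntegrableOn (fun x : ℝ => c * (unitExp (r * x) * unitExp (s * x))) (Icc 0 1) :=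
  (by fun_prop : Continuous fun x : ℝ =>
    c * (unitExp (r * x) * unitExp (s * x))).continuousOn.integrableOn_compact isCompact_Icc

theorem integral_norm_sq_trigPoly (s : Finset ℤ) (α : ℤ → ℂ) {r : ℤ} (hr : r ≠ 0) :
    ∫ x in Icc (0 : ℝ) 1, ‖∑ n ∈ s, α n * unitExp (n * r * x)‖ ^ 2 = ∑ n ∈ s, ‖α n‖ ^ 2 := by
  have h1 : ∀ x : ℝ, ((‖∑ n ∈ s, α n * unitExp (n * r * x)‖ ^ 2 : ℝ) : ℂ) =
      ∑ n ∈ s, ∑ m ∈ s, α n * (starRingEnd ℂ) (α m) *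
        (unitExp (n * r * x) * unitExp (-(m * r) * x)) := by
    intro x
    rw [Complex.ofReal_pow, ← Complex.mul_conj', map_sum, Finset.sum_mul_sum]
    refine Finset.sum_congr rfl fun n _ => Finset.sum_congr rfl fun m _ => ?_
    rw [map_mul, conj_unitExp, neg_mul]
    ring
  have h2 : ∀ n m : ℤ, ∫ x in Icc (0 : ℝ) 1, unitExp (n * r * x) * unitExp (-(m * r) * x) =
      if n = m then 1 else 0 := by
    intro n m
    split_ifs with hnm
    · subst hnm
      have : ∀ x : ℝ, unitExp (n * r * x) * unitExp (-(n * r) * x) = 1 := fun x => by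
        rw [mul_comm, neg_mul, unitExp_neg_mul]
      simp only [this]
      simp
    · have hne : -(m * r) ≠ -(n * r) := fun h => hnm (mul_right_cancel₀ hr (neg_injective h)).symm
      have := integral_zakChar hne
      rw [← this]
      refine setIntegral_congr_fun measurableSet_Icc fun x _ => ?_
      simp only [zakChar_eq_unitExp, conj_unitExp]
      congr 2 <;> push_cast <;> ring
  apply Complex.ofReal_injective
  rw [← integral_complex_ofReal]
  simp only [h1]
  rw [integral_finsetSum _ fun n _ => integrable_finsetSum _ fun m _ =>
    integrable_mul_conj_unitExp _ _ _]
  push_cast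
  refine Finset.sum_congr rfl fun n hn => ?_
  rw [integral_finsetSum _ fun m _ => integrable_mul_conj_unitExp _ _ _]
  simp only [integral_const_mul, h2, mul_ite, mul_one, mul_zero]
  rw [Finset.sum_ite_eq, if_pos hn, Complex.mul_conj']

theorem integral_unitSquare_trigPoly (s t : Finset ℤ) (α β : ℤ → ℂ) {P : ℕ} (hP : 0 < P) :
    ∫ z in unitSquare, ‖∑ n ∈ s, α n * unitExp (n * P * z.1)‖ ^ 2 *
      ‖∑ n ∈ t, β n * unitExp (n * z.2)‖ ^ 2 = (∑ n ∈ s, ‖α n‖ ^ 2) * ∑ n ∈ t, ‖β n‖ ^ 2 := by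
  rw [restrict_unitSquare, integral_prod_mul (fun x : ℝ => ‖∑ n ∈ s, α n * unitExp (n * P * x)‖ ^ 2)
    (fun x : ℝ => ‖∑ n ∈ t, β n * unitExp (n * x)‖ ^ 2)]
  have h1 := integral_norm_sq_trigPoly s α (r := P) (by exact_mod_cast hP.ne')
  have h2 := integral_norm_sq_trigPoly t β one_ne_zero
  simp only [Int.cast_natCast, Int.cast_one, mul_one] at h1 h2
  rw [h1, h2]

theorem locallyIntegrable_of_periodic {f : ℝ × ℝ → ℝ} (hf : IntegrableOn f unitSquare)
    (hper : ∀ (z : ℝ × ℝ) (m n : ℤ), f (z + ((m : ℝ), (n : ℝ))) = f z) : LocallyIntegrable f := by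
  have hcell : ∀ m n : ℤ, IntegrableOn f ((fun z => z + ((m : ℝ), (n : ℝ))) ⁻¹' unitSquare) := by
    intro m n
    have h := ((measurePreserving_add_right volume ((m : ℝ), (n : ℝ))).integrableOn_comp_preimage
      (measurableEmbedding_addRight _)).2 hf
    exact h.congr_fun (fun z _ => hper z m n)
      ((measurable_id.add_const _) measurableSet_unitSquare)
  intro z
  refine ⟨Ioo ((⌊z.1⌋ : ℝ) - 1) (⌊z.1⌋ + 1) ×ˢ Ioo ((⌊z.2⌋ : ℝ) - 1) (⌊z.2⌋ + 1),
    prod_mem_nhds (Ioo_mem_nhds ?_ (Int.lt_floor_add_one _))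
      (Ioo_mem_nhds ?_ (Int.lt_floor_add_one _)), ?_⟩
  · linarith [Int.floor_le z.1]
  · linarith [Int.floor_le z.2]
  · refine IntegrableOn.mono_set (((hcell (-⌊z.1⌋) (-⌊z.2⌋)).union
      (hcell (-⌊z.1⌋ + 1) (-⌊z.2⌋))).union ((hcell (-⌊z.1⌋) (-⌊z.2⌋ + 1)).union
      (hcell (-⌊z.1⌋ + 1) (-⌊z.2⌋ + 1)))) ?_
    rintro w ⟨⟨a1, a2⟩, b1, b2⟩
    simp only [mem_union, mem_preimage, unitSquare, mem_prod, mem_Icc, Prod.fst_add, Prod.snd_add]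
    push_cast
    rcases le_total (⌊z.1⌋ : ℝ) w.1 with h1 | h1 <;> rcases le_total (⌊z.2⌋ : ℝ) w.2 with h2 | h2
    · exact Or.inl (Or.inl ⟨⟨by linarith, by linarith⟩, by linarith, by linarith⟩)
    · exact Or.inr (Or.inl ⟨⟨by linarith, by linarith⟩, by linarith, by linarith⟩)
    · exact Or.inl (Or.inr ⟨⟨by linarith, by linarith⟩, by linarith, by linarith⟩)
    · exact Or.inr (Or.inr ⟨⟨by linarith, by linarith⟩, by linarith, by linarith⟩)

theorem norm_sq_eq_integral_zak (f : Lp ℂ 2 (volume : Measure ℝ)) :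
    IntegrableOn (fun z => ‖zak f z‖ ^ 2) unitSquare ∧
      ‖f‖ ^ 2 = ∫ z in unitSquare, ‖zak f z‖ ^ 2 := by
  have h1 : (fun z => ‖zak f z‖ ^ 2) =ᵐ[volume.restrict unitSquare]
      fun z => ‖zakSquare f z‖ ^ 2 := by
    filter_upwards [zak_ae_eq_zakSquare f] with z hz
    rw [hz]
  refine ⟨?_, ?_⟩
  · exact ((memLp_two_iff_integrable_sq_norm (Lp.memLp (zakSquare f)).1).1
      (Lp.memLp (zakSquare f))).congr h1.symm
  · rw [integral_congr_ae h1, ← norm_zakSquare]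
    have h2 := L2.inner_def (𝕜 := ℂ) (zakSquare f) (zakSquare f)
    simp only [inner_self_eq_norm_sq_to_K] at h2
    apply Complex.ofReal_injective
    rw [← integral_complex_ofReal]
    push_cast
    exact h2

/-- The hypothesis bounds every eigenvalue of the Gram matrix below by κ, and the determinant is
their product. -/
theorem Matrix.pow_card_le_norm_det_gram {m n : Type*} [Fintype m] [Fintype n] [DecidableEq n]
    (M : Matrix m n ℂ) {κ : ℝ} (hκ : 0 ≤ κ)
    (h : ∀ v : n → ℂ, κ * ∑ l, ‖v l‖ ^ 2 ≤ ∑ k, ‖M.mulVec v k‖ ^ 2) :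
    κ ^ Fintype.card n ≤ ‖(M.conjTranspose * M).det‖ := by
  have hA : (M.conjTranspose * M).IsHermitian := Matrix.isHermitian_conjTranspose_mul_self M
  have hle : ∀ i, κ ≤ hA.eigenvalues i := by
    intro i
    set v : n → ℂ := ⇑(hA.eigenvectorBasis i) with hv
    have h1 : ∑ l, ‖v l‖ ^ 2 = 1 := by
      rw [← EuclideanSpace.norm_sq_eq, hA.eigenvectorBasis.orthonormal.1 i, one_pow]
    have h2 : dotProduct (star v) ((M.conjTranspose * M).mulVec v) =
        ((∑ k, ‖M.mulVec v k‖ ^ 2 : ℝ) : ℂ) := by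
      rw [← Matrix.mulVec_mulVec, Matrix.dotProduct_mulVec, ← Matrix.star_mulVec, dotProduct]
      push_cast
      exact Finset.sum_congr rfl fun k _ => Complex.conj_mul' _
    rw [hA.eigenvalues_eq i, ← hv, h2, RCLike.re_eq_complex_re, Complex.ofReal_re]
    simpa [h1] using h v
  rw [hA.det_eq_prod_eigenvalues, norm_prod]
  calc κ ^ Fintype.card n = ∏ _i : n, κ := by simp
    _ ≤ _ := Finset.prod_le_prod (fun _ _ => hκ) fun i _ => ?_
  exact (hle i).trans ((le_abs_self _).trans_eq (RCLike.norm_ofReal _).symm)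

section Bounds

variable {P Q : ℕ}

/-- Coefficients of product form make the Zak transform factor into a polynomial in x, a polynomial
in ω and a combination of columns. The minus sign in `latticePoint` gives the second polynomial
positive frequencies. -/
theorem zak_sum_latticePoint (g : Lp ℂ 2 (volume : Measure ℝ)) (P : ℕ) (hQ : 0 < Q)
    (v : Fin Q → ℂ) (s t : Finset ℤ) (α β : ℤ → ℂ) :
    ∀ᵐ z : ℝ × ℝ, zak (∑ i ∈ Finset.univ ×ˢ s ×ˢ t,
      (v i.1 * (α i.2.1 * β i.2.2)) • timeFreqShift (latticePoint P Q i) g) z =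
      (∑ n ∈ s, α n * unitExp (n * P * z.1)) * (∑ n ∈ t, β n * unitExp (n * z.2)) *
        ∑ l : Fin Q, v l * zak g (z - ((l : ℝ) / Q, 0)) := by
  have h : ∀ᵐ z : ℝ × ℝ, ∀ i : Fin Q × ℤ × ℤ,
      zak (timeFreqShift (latticePoint P Q i) g) z = zakShift (latticePoint P Q i) (zak g) z :=
    ae_all_iff.2 fun i => zak_timeFreqShift _ g
  filter_upwards [h, zak_sum (Finset.univ ×ˢ s ×ˢ t) (fun i => v i.1 * (α i.2.1 * β i.2.2))
    (fun i => timeFreqShift (latticePoint P Q i) g)] with z h1 h2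
  rw [h2, Finset.sum_product]
  simp only [Finset.sum_product, h1]
  rw [Finset.sum_mul_sum, Finset.mul_sum]
  refine Finset.sum_congr rfl fun l _ => ?_
  rw [Finset.sum_mul]
  refine Finset.sum_congr rfl fun n _ => ?_
  rw [Finset.sum_mul]
  refine Finset.sum_congr rfl fun q _ => ?_
  rw [latticePoint, zakShift_lattice (quasiPeriodic_zak g) P hQ, Int.cast_neg, neg_mul, neg_neg]
  ring

theorem sum_norm_sq_latticeCoeff (v : Fin Q → ℂ) (s t : Finset ℤ) (α β : ℤ → ℂ) :
    ∑ i ∈ Finset.univ ×ˢ s ×ˢ t, ‖v i.1 * (α i.2.1 * β i.2.2)‖ ^ 2 =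
      (∑ l, ‖v l‖ ^ 2) * ((∑ n ∈ s, ‖α n‖ ^ 2) * ∑ n ∈ t, ‖β n‖ ^ 2) := by
  simp only [Finset.sum_product, norm_mul, mul_pow]
  rw [Finset.sum_mul]
  refine Finset.sum_congr rfl fun l _ => ?_
  rw [Finset.sum_mul_sum, Finset.mul_sum]
  refine Finset.sum_congr rfl fun n _ => ?_
  rw [Finset.mul_sum]

theorem norm_sq_sum_latticePoint (g : Lp ℂ 2 (volume : Measure ℝ)) (P : ℕ) (hQ : 0 < Q)
    (v : Fin Q → ℂ) (s t : Finset ℤ) (α β : ℤ → ℂ) :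
    ‖∑ i ∈ Finset.univ ×ˢ s ×ˢ t,
      (v i.1 * (α i.2.1 * β i.2.2)) • timeFreqShift (latticePoint P Q i) g‖ ^ 2 =
    ∫ z in unitSquare, ‖∑ n ∈ s, α n * unitExp (n * P * z.1)‖ ^ 2 *
      ‖∑ n ∈ t, β n * unitExp (n * z.2)‖ ^ 2 *
        ‖∑ l : Fin Q, v l * zak g (z - ((l : ℝ) / Q, 0))‖ ^ 2 := by
  rw [(norm_sq_eq_integral_zak _).2]
  refine integral_congr_ae (ae_restrict_of_ae ?_)
  filter_upwards [zak_sum_latticePoint g P hQ v s t α β] with z hz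
  rw [hz, norm_mul, norm_mul, mul_pow, mul_pow]

theorem periodic_norm_sq_sum {F : ℝ × ℝ → ℂ} (hF : QuasiPeriodic F) (v : Fin Q → ℂ) (z : ℝ × ℝ)
    (m n : ℤ) : ‖∑ l : Fin Q, v l * F (z + ((m : ℝ), (n : ℝ)) - ((l : ℝ) / Q, 0))‖ ^ 2 =
      ‖∑ l : Fin Q, v l * F (z - ((l : ℝ) / Q, 0))‖ ^ 2 := by
  have h : ∀ l : Fin Q, v l * F (z + ((m : ℝ), (n : ℝ)) - ((l : ℝ) / Q, 0)) =
      unitExp (m * z.2) * (v l * F (z - ((l : ℝ) / Q, 0))) := by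
    intro l
    rw [add_sub_right_comm, hF]
    simp only [Prod.snd_sub, sub_zero]
    ring
  simp only [h]
  rw [← Finset.mul_sum, norm_mul, norm_unitExp, one_mul]

theorem locallyIntegrable_norm_sq_sum (g : Lp ℂ 2 (volume : Measure ℝ)) (hQ : 0 < Q)
    (v : Fin Q → ℂ) : LocallyIntegrable
      fun z : ℝ × ℝ => ‖∑ l : Fin Q, v l * zak g (z - ((l : ℝ) / Q, 0))‖ ^ 2 := by
  refine locallyIntegrable_of_periodic ?_ (periodic_norm_sq_sum (quasiPeriodic_zak g) v)
  -- The function is |Zf|² for a finite combination f of translates of g: take the single frequency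
  -- 0 in both variables.
  refine IntegrableOn.congr_fun_ae (norm_sq_eq_integral_zak (∑ i ∈ Finset.univ ×ˢ {0} ×ˢ {0},
    (v i.1 * ((1 : ℤ → ℂ) i.2.1 * (1 : ℤ → ℂ) i.2.2)) • timeFreqShift (latticePoint 1 Q i) g)).1
    (ae_restrict_of_ae ?_)
  filter_upwards [zak_sum_latticePoint g 1 hQ v {0} {0} 1 1] with z hz
  rw [hz]
  simp [unitExp_zero]

theorem integrableOn_trigPoly_mul {D : ℝ × ℝ → ℝ} (hD : LocallyIntegrable D) (P : ℕ)
    (s t : Finset ℤ) (α β : ℤ → ℂ) : IntegrableOn (fun z => ‖∑ n ∈ s, α n * unitExp (n * P * z.1)‖ ^ 2 *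
      ‖∑ n ∈ t, β n * unitExp (n * z.2)‖ ^ 2 * D z) unitSquare := by
  have hc1 := continuous_trigPoly s α (fun n => (n : ℝ) * P)
  have hc2 := continuous_trigPoly t β (fun n => (n : ℝ))
  refine integrableOn_bdd_mul (hD.integrableOn_isCompact (isCompact_Icc.prod isCompact_Icc))
    ((hc1.comp continuous_fst).mul (hc2.comp continuous_snd))
    (c := (∑ n ∈ s, ‖α n‖) ^ 2 * (∑ n ∈ t, ‖β n‖) ^ 2) fun z => ?_
  rw [abs_mul]
  exact mul_le_mul (norm_trigPoly_le s α (fun n => (n : ℝ) * P) _)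
    (norm_trigPoly_le t β (fun n => (n : ℝ)) _) (abs_nonneg _) (by positivity)

theorem sum_norm_sq_mulVec_zakMatrix (F : ℝ × ℝ → ℂ) (v : Fin Q → ℂ) (z : ℝ × ℝ) :
    ∑ k, ‖(zakMatrix P Q F z).mulVec v k‖ ^ 2 = ∑ k ∈ Finset.range P,
      ‖∑ l : Fin Q, v l * F (z + ((k : ℝ) / P, 0) - ((l : ℝ) / Q, 0))‖ ^ 2 := by
  rw [← Fin.sum_univ_eq_sum_range
    (fun k => ‖∑ l : Fin Q, v l * F (z + ((k : ℝ) / P, 0) - ((l : ℝ) / Q, 0))‖ ^ 2)]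
  refine Finset.sum_congr rfl fun k _ => ?_
  rw [Matrix.mulVec, dotProduct]
  congr 2
  refine Finset.sum_congr rfl fun l _ => ?_
  rw [mul_comm, zakMatrix, Matrix.of_apply, gridPoint, add_sub_assoc, Prod.mk_sub_mk, sub_zero]

/-- The inequality `c ‖v‖² ≤ ‖M v‖² ≤ C ‖v‖²` between the norms of a vector and its image under the
Zak matrix `M`, summed over the `P` rows. -/
theorem ae_zakMatrix_mulVec_bounds {g : Lp ℂ 2 (volume : Measure ℝ)} (hP : 0 < P) (hQ : 0 < Q)
    {c C : ℝ} (hb : ∀ (s : Finset (Fin Q × ℤ × ℤ)) (a : Fin Q × ℤ × ℤ → ℂ),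
      c * ∑ i ∈ s, ‖a i‖ ^ 2 ≤ ‖∑ i ∈ s, a i • timeFreqShift (latticePoint P Q i) g‖ ^ 2 ∧
        ‖∑ i ∈ s, a i • timeFreqShift (latticePoint P Q i) g‖ ^ 2 ≤ C * ∑ i ∈ s, ‖a i‖ ^ 2)
    (v : Fin Q → ℂ) : ∀ᵐ z : ℝ × ℝ,
      P * c * ∑ l, ‖v l‖ ^ 2 ≤ ∑ k, ‖(zakMatrix P Q (zak g) z).mulVec v k‖ ^ 2 ∧
      ∑ k, ‖(zakMatrix P Q (zak g) z).mulVec v k‖ ^ 2 ≤ P * C * ∑ l, ‖v l‖ ^ 2 := by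
  set u : ℝ × ℝ → ℝ := fun z => ‖∑ l : Fin Q, v l * zak g (z - ((l : ℝ) / Q, 0))‖ ^ 2 with hu
  have huI : LocallyIntegrable u := locallyIntegrable_norm_sq_sum g hQ v
  have huper : ∀ (z : ℝ × ℝ) (m n : ℤ), u (z + ((m : ℝ), (n : ℝ))) = u z :=
    periodic_norm_sq_sum (quasiPeriodic_zak g) v
  have hcI : ∀ r : ℝ, LocallyIntegrable fun _ : ℝ × ℝ => r := fun r => locallyIntegrable_const r
  have hint : ∀ (r : ℝ) (s t : Finset ℤ) (α β : ℤ → ℂ), ∫ z in unitSquare,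
      ‖∑ n ∈ s, α n * unitExp (n * P * z.1)‖ ^ 2 * ‖∑ n ∈ t, β n * unitExp (n * z.2)‖ ^ 2 * r =
      r * ((∑ n ∈ s, ‖α n‖ ^ 2) * ∑ n ∈ t, ‖β n‖ ^ 2) := by
    intro r s t α β
    rw [integral_mul_const, integral_unitSquare_trigPoly s t α β hP, mul_comm]
  -- Tested against products of squared polynomials, the sign of D is exactly the Riesz inequality
  -- for product coefficients. Summing the constant over the P translates produces the factor P.
  have hlow := ae_translateSum_nonneg hP (D := fun z => u z - c * ∑ l, ‖v l‖ ^ 2)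
    (huI.sub (hcI _)) (fun z m n => by simp only [huper]) (fun s t α β => by
      simp only [mul_sub]
      rw [integral_sub (integrableOn_trigPoly_mul huI P s t α β)
        (integrableOn_trigPoly_mul (hcI _) P s t α β), hint,
        ← norm_sq_sum_latticePoint g P hQ v s t α β, mul_assoc, ← sum_norm_sq_latticeCoeff]
      exact sub_nonneg.2 (hb _ fun i => v i.1 * (α i.2.1 * β i.2.2)).1)
  have hupp := ae_translateSum_nonneg hP (D := fun z => C * ∑ l, ‖v l‖ ^ 2 - u z)
    ((hcI _).sub huI) (fun z m n => by simp only [huper]) (fun s t α β => by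
      simp only [mul_sub]
      rw [integral_sub (integrableOn_trigPoly_mul (hcI _) P s t α β)
        (integrableOn_trigPoly_mul huI P s t α β), hint,
        ← norm_sq_sum_latticePoint g P hQ v s t α β, mul_assoc, ← sum_norm_sq_latticeCoeff]
      exact sub_nonneg.2 (hb _ fun i => v i.1 * (α i.2.1 * β i.2.2)).2)
  filter_upwards [hlow, hupp] with z h1 h2
  rw [sum_norm_sq_mulVec_zakMatrix]
  simp only [translateSum, Finset.sum_sub_distrib, Finset.sum_const, Finset.card_range,
    nsmul_eq_mul, sub_nonneg] at h1 h2
  exact ⟨by rw [mul_assoc]; exact h1, by rw [mul_assoc]; exact h2⟩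

/-- The null set depends on v; a countable dense set of vectors and continuity in v remove this
dependence. -/
theorem ae_forall_zakMatrix_mulVec_bounds {F : ℝ × ℝ → ℂ} {c C : ℝ}
    (h : ∀ v : Fin Q → ℂ, ∀ᵐ z : ℝ × ℝ, c * ∑ l, ‖v l‖ ^ 2 ≤ ∑ k, ‖(zakMatrix P Q F z).mulVec v k‖ ^ 2 ∧
      ∑ k, ‖(zakMatrix P Q F z).mulVec v k‖ ^ 2 ≤ C * ∑ l, ‖v l‖ ^ 2) :
    ∀ᵐ z : ℝ × ℝ, ∀ v : Fin Q → ℂ, c * ∑ l, ‖v l‖ ^ 2 ≤ ∑ k, ‖(zakMatrix P Q F z).mulVec v k‖ ^ 2 ∧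
      ∑ k, ‖(zakMatrix P Q F z).mulVec v k‖ ^ 2 ≤ C * ∑ l, ‖v l‖ ^ 2 := by
  filter_upwards [ae_all_iff.2 fun n => h (TopologicalSpace.denseSeq (Fin Q → ℂ) n)] with z hz
  have hc1 : Continuous fun v : Fin Q → ℂ => ∑ l, ‖v l‖ ^ 2 := by fun_prop
  have hc2 : Continuous fun v : Fin Q → ℂ => ∑ k, ‖(zakMatrix P Q F z).mulVec v k‖ ^ 2 :=
    continuous_finsetSum _ fun k _ =>
      (((continuous_apply k).comp (Continuous.matrix_mulVec continuous_const continuous_id)).norm).pow 2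
  have hclosed : IsClosed {v : Fin Q → ℂ | c * ∑ l, ‖v l‖ ^ 2 ≤
      ∑ k, ‖(zakMatrix P Q F z).mulVec v k‖ ^ 2 ∧
      ∑ k, ‖(zakMatrix P Q F z).mulVec v k‖ ^ 2 ≤ C * ∑ l, ‖v l‖ ^ 2} :=
    (isClosed_le (continuous_const.mul hc1) hc2).inter (isClosed_le hc2 (continuous_const.mul hc1))
  have huniv : closure (range (TopologicalSpace.denseSeq (Fin Q → ℂ))) = univ :=
    (TopologicalSpace.denseRange_denseSeq _).closure_eq
  intro v
  exact closure_minimal (by rintro _ ⟨n, rfl⟩; exact hz n) hclosed (huniv ▸ mem_univ v)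

theorem ae_zakBounded {g : Lp ℂ 2 (volume : Measure ℝ)} (hP : 0 < P) (hQ : 0 < Q)
    (h : IsRieszBasis (gaborSystem g (separableLattice P Q))) :
    ∃ C κ : ℝ, 0 < κ ∧ (∀ᵐ z, ‖zak g z‖ ≤ C) ∧ ∀ᵐ z, ZakBounded P Q (zak g) C κ z := by
  obtain ⟨c, C, hc, hC, hb⟩ := h.exists_latticePoint_bounds hP hQ
  have hP' : (0 : ℝ) < P := by positivity
  have hall := ae_forall_zakMatrix_mulVec_bounds (ae_zakMatrix_mulVec_bounds hP hQ hb)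
  -- Entries are bounded by testing on basis vectors; the determinant is bounded below by the power
  -- Q of the lower Riesz constant P · c.
  have hbdd : ∀ᵐ z, ZakBounded P Q (zak g) (Real.sqrt (P * C)) ((P * c) ^ Q) z := by
    filter_upwards [hall] with z hz
    refine ⟨fun k l => Real.le_sqrt_of_sq_le ?_, ?_⟩
    · have h1 := (hz (Pi.single l 1)).2
      have h2 : ∑ l', ‖(Pi.single l 1 : Fin Q → ℂ) l'‖ ^ 2 = 1 := by
        rw [Finset.sum_eq_single l (fun b _ hbl => by simp [hbl]) (by simp)]
        simp
      rw [h2, mul_one, Matrix.mulVec_single_one] at h1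
      exact (Finset.single_le_sum (f := fun k => ‖(zakMatrix P Q (zak g) z).col l k‖ ^ 2)
        (fun _ _ => by positivity) (Finset.mem_univ k)).trans h1
    · have h1 := Matrix.pow_card_le_norm_det_gram (zakMatrix P Q (zak g) z)
        (κ := P * c) (by positivity) fun v => (hz v).1
      rwa [Fintype.card_fin] at h1
  refine ⟨_, _, by positivity, ?_, hbdd⟩
  filter_upwards [hbdd] with z hz
  simpa [zakMatrix, gridPoint, Prod.mk_zero_zero] using hz.1 ⟨0, hP⟩ ⟨0, hQ⟩

end Bounds

/-! ### Conclusion -/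

/-- The time-frequency shifts preserving the range of the Zak matrices form a monoid. -/
theorem ShiftInRange.exists_addSubmonoid {P Q : ℕ} {F : ℝ × ℝ → ℂ} (h0 : ShiftInRange P Q F 0) :
    ∃ Γ : AddSubmonoid (ℝ × ℝ), ∀ μ, μ ∈ Γ ↔ ShiftInRange P Q F μ :=
  ⟨{ carrier := {μ | ShiftInRange P Q F μ}
     add_mem' := fun hμ hν => hμ.add hν
     zero_mem' := h0 }, fun _ => Iff.rfl⟩

theorem proposition4p1 (g : Lp ℂ 2 (volume : Measure ℝ)) (P Q : ℕ) (hP : 0 < P) (hQ : 0 < Q)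
    (hPQ : Nat.Coprime P Q)
    (hRiesz : IsRieszBasis (gaborSystem g (separableLattice P Q)))
    (u η : ℝ) (hnot : (u, η) ∉ separableLattice P Q)
    (hmem : timeFreqShift (u, η) g ∈ gaborSpace g (separableLattice P Q)) :
    ¬ MemVMOLoc (zak g) := by
  intro hV
  have hlat : ∀ p ∈ separableLattice P Q, ShiftInRange P Q (zak g) p := fun p hp =>
    shiftInRange_of_mem_gaborSpace hP hQ g (timeFreqShift_mem_gaborSpace g hp)
  obtain ⟨Γ, hΓ⟩ := ShiftInRange.exists_addSubmonoid (hlat 0 ⟨0, 0, by simp [Prod.mk_zero_zero]⟩)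
  obtain ⟨C, κ, hκ, hC, hb⟩ := ae_zakBounded hP hQ hRiesz
  obtain ⟨H, hHc, hHq, hlt⟩ := exists_continuous_crossDet_lt (quasiPeriodic_zak g) hV hκ hC hb
  exact hnot (mem_separableLattice_of_crossDet hP hQ hPQ Γ (fun p hp => (hΓ p).2 (hlat p hp))
    hHc hHq (fun μ hμ ν hν => hlt μ ν ((hΓ μ).1 hμ) ((hΓ ν).1 hν))
    ((hΓ _).2 (shiftInRange_of_mem_gaborSpace hP hQ g hmem)))
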